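/- Let $K$ be an algebraically closed field, let $p\ge 1$ be an odd integer, and let $q\in K^*$ not be a root of unity. Fix a fourth root $r$ of $q$ and write $q^{k/4}=r^k$ for $k\in\mathbb Z$. Let $A$ be the quantum torus over $K$ with generators $z_1^{\pm1},\dots,z_p^{\pm1}$ and relations $z_iz_j=q_{ij}z_jz_i$ for $1\le j<i\le p$, where $q_{ij}=q^{-1}$ if $i$ is even and $j$ is odd, and $q_{ij}=1$ otherwise; then $z_p$ is central in $A$. Let $\alpha$ be the $K$-automorphism of $A$ with $\alpha(z_i)=z_i$ for $i$ even and $\alpha(z_i)=q^{-1}z_i$ for $i$ odd. Let $u=q^{(p-1)/2}z_p^{-1}+qz_p$ and $v=u-\alpha(u)=(1-q)(q^{(p-1)/2}z_p^{-1}-z_p)$. Let $R=R(A,\alpha,v,1)$ be the ambiskew polynomial algebra, that is, the iterated skew polynomial algebra $A[y;\alpha][x;\beta,\delta]$ with $\beta|_A=\alpha^{-1}$, $\beta(y)=y$, $\delta(A)=0$, $\delta(y)=v$; thus $ya=\alpha(a)y$ and $xa=\alpha^{-1}(a)x$ for $a\in A$, and $xy=yx+v$. Let $z=xy-u$ be its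 (central) Casimir element. For $\lambda\in K$, the ring $R/(z-\lambda)R$ is identified with the generalized Weyl algebra $W(A,\alpha,u+\lambda)$, with $X$ and $Y$ the images of $x$ and $y$. For an integer $m\ge1$ and an ideal $I$ of $A$ put $I_i=\bigcap_{\ell=0}^{m-1-i}\alpha^{-\ell}(I)$ and $I_{-i}=\bigcap_{\ell=i}^{m-1}\alpha^{-\ell}(I)$ for $0\le i\le m-1$, put $I_i=I_{-i}=A$ for $i\ge m$, and let $J(I)=\sum_{i\ge0}I_iY^i+\sum_{i\ge0}I_{-i}X^i$. For $m\ge1$ and $\varepsilon\in\{1,-1\}$ let $$\lambda_{m,\varepsilon}=-\varepsilon\, q^{\frac{p-2m+1}{4}}(q^m+1),\qquad F_{m,\varepsilon}=\pi^{-1}\bigl(J((z_p-\varepsilon q^{\frac{p+2m-3}{4}})A)\bigr),$$ where $J$ is formed with this $m$ in $R/(z-\lambda_{m,\varepsilon})R$ and $\pi:R\to R/(z-\lambda_{m,\varepsilon})R$ is the canonical epimorphism. Then: 1. The ideal $0$ of $R$ is prime. For every $\lambda\in K$, $(z-\lambda)R$ is a two-sided ideal; these ideals are distinct for distinct $\lambda$,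 and they are exactly the height one prime ideals of $R$. 2. The ideal $(z-\lambda)R$ is maximal if and only if $\lambda\ne\lambda_{m,\varepsilon}$ for all $m\ge1$ and $\varepsilon\in\{1,-1\}$. 3. For all $m\ge1$ and $\varepsilon\in\{1,-1\}$, the ring $R/(z-\lambda_{m,\varepsilon})R$ has a unique non-zero prime ideal, namely $J((z_p-\varepsilon q^{\frac{p+2m-3}{4}})A)$. 4. The height two prime ideals of $R$ are exactly the ideals $F_{m,\varepsilon}$ with $m\ge1$ and $\varepsilon\in\{1,-1\}$. One has $F_{m,\varepsilon}=F_{m',\varepsilon'}$ if and only if $m=m'$ and $\varepsilon=\varepsilon'$ in $K$; so for each $m$ there are two of them if $\operatorname{char}K\ne2$, and one if $\operatorname{char}K=2$. 5. The prime spectrum of $R$ consists of $0$, the ideals $(z-\lambda)R$ with $\lambda\in K$, and the ideals $F_{m,\varepsilon}$ with $m\ge1$ and $\varepsilon\in\{1,-1\}$. -/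

import Mathlib

noncomputable section

/-! ### Prime ideals and heights in noncommutative rings -/

/-- A two-sided ideal `P` of a (noncommutative) ring is prime if it is proper and
`a R b ⊆ P` implies `a ∈ P` or `b ∈ P`. -/
def TwoSidedIdeal.IsPrimeIdeal {R : Type*} [Ring R] (P : TwoSidedIdeal R) : Prop :=
  P ≠ ⊤ ∧ ∀ a b : R, (∀ r : R, a * r * b ∈ P) → a ∈ P ∨ b ∈ P

/-- The prime spectrum of a (noncommutative) ring, ordered by inclusion. -/
abbrev PrimeSpec (R : Type*) [Ring R] : Type _ := {P : TwoSidedIdeal R // P.IsPrimeIdeal}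

/-- `P` is a prime ideal of height `n`: the supremum of the lengths `l` of the chains
`P₀ ⊂ P₁ ⊂ ⋯ ⊂ P_l = P` of prime ideals is `n`. -/
def TwoSidedIdeal.IsPrimeOfHeight {R : Type*} [Ring R] (P : TwoSidedIdeal R) (n : ℕ∞) : Prop :=
  ∃ h : P.IsPrimeIdeal, Order.height (⟨P, h⟩ : PrimeSpec R) = n

/-! ### Skew polynomial rings `B[x; σ, δ]` -/

/-- The data for a skew polynomial algebra: an endomorphism `σ` and a `σ`-derivation `δ`. -/
structure OreDatum (K B : Type*) [Field K] [Ring B] [Algebra K B] where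
  σ : B →ₐ[K] B
  δ : B →ₗ[K] B
  leibniz : ∀ a b, δ (a * b) = σ a * δ b + δ a * b

/-- The skew polynomial algebra `B[x; σ, δ]`; the finitely supported function `f` stands for
`∑ₙ f(n) xⁿ`. The multiplication (defined below) is the one with `x b = σ(b) x + δ(b)`. -/
def OreExt {K B : Type*} [Field K] [Ring B] [Algebra K B] (_D : OreDatum K B) : Type _ := ℕ →₀ B

namespace OreExt

variable {K B : Type*} [Field K] [Ring B] [Algebra K B] (D : OreDatum K B)

instance : AddCommGroup (OreExt D) := inferInstanceAs (AddCommGroup (ℕ →₀ B))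
instance : Module B (OreExt D) := inferInstanceAs (Module B (ℕ →₀ B))
instance : Module K (OreExt D) := inferInstanceAs (Module K (ℕ →₀ B))
instance : IsScalarTower K B (OreExt D) := inferInstanceAs (IsScalarTower K B (ℕ →₀ B))
instance : SMulCommClass K B (OreExt D) := inferInstanceAs (SMulCommClass K B (ℕ →₀ B))
instance : SMulCommClass B K (OreExt D) := inferInstanceAs (SMulCommClass B K (ℕ →₀ B))

/-- The monomial `b xⁿ`. -/
def monomial (n : ℕ) (b : B) : OreExt D := Finsupp.single n b

/-- `monomial` as a linear map in the coefficient. -/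
def lmonomial (n : ℕ) : B →ₗ[K] OreExt D := Finsupp.lsingle (M := B) (R := K) n

/-- Extension of a family of linear maps on the coefficients. -/
def liftLin {M : Type*} [AddCommGroup M] [Module K M] (f : ℕ → B →ₗ[K] M) : OreExt D →ₗ[K] M :=
  Finsupp.lsum K f

variable {D}

@[simp] theorem lmonomial_apply (n : ℕ) (b : B) : lmonomial D n b = monomial D n b := rfl

@[simp] theorem liftLin_monomial {M : Type*} [AddCommGroup M] [Module K M]
    (f : ℕ → B →ₗ[K] M) (n : ℕ) (b : B) : liftLin D f (monomial D n b) = f n b :=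
  (Finsupp.lsum_single (S := K) f n b)

@[simp] theorem smul_monomial (c : B) (n : ℕ) (b : B) :
    c • monomial D n b = monomial D n (c * b) := Finsupp.smul_single _ _ _

@[simp] theorem smul_monomial' (c : K) (n : ℕ) (b : B) :
    c • monomial D n b = monomial D n (c • b) := Finsupp.smul_single _ _ _

theorem monomial_add (n : ℕ) (a b : B) :
    monomial D n (a + b) = monomial D n a + monomial D n b := Finsupp.single_add _ _ _

@[simp] theorem monomial_zero (n : ℕ) : monomial D n (0 : B) = 0 := Finsupp.single_zero _

theorem hom_ext {M : Type*} [AddCommGroup M] [Module K M] {f g : OreExt D →ₗ[K] M}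
    (h : ∀ n b, f (monomial D n b) = g (monomial D n b)) : f = g :=
  Finsupp.lhom_ext h

variable (D)

/-- Left multiplication by `x`: the operator `b xⁿ ↦ σ(b) xⁿ⁺¹ + δ(b) xⁿ`. -/
def shift : Module.End K (OreExt D) :=
  liftLin D fun n => lmonomial D (n + 1) ∘ₗ D.σ.toLinearMap + lmonomial D n ∘ₗ D.δ

/-- Left multiplication by an element: `b xⁿ` acts as `b` times the `n`-th power of `shift`. -/
def lmul : OreExt D →ₗ[K] Module.End K (OreExt D) :=
  liftLin D fun n =>
    LinearMap.mulRight K (shift D ^ n) ∘ₗ (Algebra.lsmul K K (OreExt D)).toLinearMap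

instance : Mul (OreExt D) := ⟨fun f g => lmul D f g⟩
instance : One (OreExt D) := ⟨monomial D 0 1⟩

variable {D}

theorem mul_def (f g : OreExt D) : f * g = lmul D f g := rfl
theorem one_def : (1 : OreExt D) = monomial D 0 1 := rfl

theorem lmul_monomial (n : ℕ) (b : B) :
    lmul D (monomial D n b) = Algebra.lsmul K K (OreExt D) b * shift D ^ n := by
  simp [lmul]

theorem shift_monomial (n : ℕ) (b : B) :
    shift D (monomial D n b) = monomial D (n + 1) (D.σ b) + monomial D n (D.δ b) := by
  simp [shift]

theorem shift_smul (b : B) (f : OreExt D) :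
    shift D (b • f) = D.σ b • shift D f + D.δ b • f := by
  have : shift D * Algebra.lsmul K K (OreExt D) b =
      Algebra.lsmul K K (OreExt D) (D.σ b) * shift D + Algebra.lsmul K K (OreExt D) (D.δ b) := by
    refine hom_ext fun n c => ?_
    simp [shift_monomial, D.leibniz, monomial_add, add_assoc]
  simpa using LinearMap.congr_fun this f

theorem lmul_smul (b : B) (f : OreExt D) :
    lmul D (b • f) = Algebra.lsmul K K (OreExt D) b * lmul D f := by
  have : lmul D ∘ₗ Algebra.lsmul K K (OreExt D) b =
      LinearMap.mulLeft K (Algebra.lsmul K K (OreExt D) b) ∘ₗ lmul D := by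
    refine hom_ext fun n c => ?_
    simp [lmul_monomial, mul_assoc]
  simpa using LinearMap.congr_fun this f

theorem lmul_shift (f : OreExt D) : lmul D (shift D f) = shift D * lmul D f := by
  have : lmul D ∘ₗ shift D = LinearMap.mulLeft K (shift D) ∘ₗ lmul D := by
    refine hom_ext fun n c => LinearMap.ext fun g => ?_
    simp [shift_monomial, lmul_monomial, shift_smul, pow_succ']
  simpa using LinearMap.congr_fun this f

theorem lmul_pow_shift (n : ℕ) (f : OreExt D) :
    lmul D ((shift D ^ n) f) = shift D ^ n * lmul D f := by
  induction n with
  | zero => simp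
  | succ n ih => rw [pow_succ', Module.End.mul_apply, lmul_shift, ih, mul_assoc]

theorem lmul_lmul (f g : OreExt D) : lmul D (lmul D f g) = lmul D f * lmul D g := by
  have : lmul D ∘ₗ (lmul D).flip g = LinearMap.mulRight K (lmul D g) ∘ₗ lmul D := by
    refine hom_ext fun n b => ?_
    simp [lmul_monomial, lmul_smul, lmul_pow_shift, mul_assoc]
  simpa using LinearMap.congr_fun this f

theorem pow_shift_one (n : ℕ) : (shift D ^ n) (monomial D 0 1) = monomial D n 1 := by
  induction n with
  | zero => simp
  | succ n ih =>
    have h1 : D.δ 1 = 0 := by simpa using D.leibniz 1 1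
    rw [pow_succ', Module.End.mul_apply, ih, shift_monomial, h1]
    simp

theorem lmul_one (f : OreExt D) : lmul D f (monomial D 0 1) = f := by
  have : (lmul D).flip (monomial D 0 1) = LinearMap.id := by
    refine hom_ext fun n b => ?_
    simp [lmul_monomial, pow_shift_one]
  simpa using LinearMap.congr_fun this f

instance : Ring (OreExt D) where
  __ := (inferInstance : AddCommGroup (OreExt D))
  mul := (· * ·)
  one := 1
  left_distrib f g h := by simp [mul_def]
  right_distrib f g h := by simp [mul_def]
  zero_mul f := by simp [mul_def]
  mul_zero f := by simp [mul_def]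
  mul_assoc f g h := by simp [mul_def, lmul_lmul]
  one_mul f := by simp [mul_def, one_def, lmul_monomial]
  mul_one f := by simp [mul_def, one_def, lmul_one]

instance : Algebra K (OreExt D) :=
  Algebra.ofModule (fun c f g => by simp [mul_def]) (fun c f g => by simp [mul_def])

variable (D)

/-- The inclusion of the coefficient algebra. -/
def C : B →ₐ[K] OreExt D where
  toFun b := monomial D 0 b
  map_one' := rfl
  map_mul' a b := by simp [mul_def, lmul_monomial]
  map_zero' := by simp
  map_add' a b := monomial_add 0 a b
  commutes' c := by
    rw [Algebra.algebraMap_eq_smul_one, Algebra.algebraMap_eq_smul_one, one_def, smul_monomial']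

/-- The indeterminate `x`. -/
def X : OreExt D := monomial D 1 1

variable {D}

/-- The defining relation. -/
theorem X_mul_C (b : B) : X D * C D b = C D (D.σ b) * X D + C D (D.δ b) := by
  simp [mul_def, X, C, lmul_monomial, shift_monomial]

theorem monomial_mul_monomial (hδ : D.δ = 0) (n k : ℕ) (a b : B) :
    monomial D n a * monomial D k b = monomial D (n + k) (a * D.σ^[n] b) := by
  have h : ∀ n, (shift D ^ n) (monomial D k b) = monomial D (n + k) (D.σ^[n] b) := by
    intro n
    induction n with
    | zero => simp
    | succ n ih =>
      rw [pow_succ', Module.End.mul_apply, ih, shift_monomial, hδ, Function.iterate_succ_apply',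
        Nat.add_right_comm n 1 k]
      simp
  simp [mul_def, lmul_monomial, h]

end OreExt

/-! ### Ambiskew polynomial algebras -/

namespace Ambiskew

variable {K A : Type*} [Field K] [Ring A] [Algebra K A]

/-- The datum for `A[y; α]`. -/
def datumY (α : A ≃ₐ[K] A) : OreDatum K A where
  σ := α
  δ := 0
  leibniz := by simp

/-- `v⁽ᵐ⁾ = ∑_{l < m} ρˡ αˡ(v)`. -/
def vSum (α : A ≃ₐ[K] A) (v : A) (ρ : K) (m : ℕ) : A :=
  ∑ l ∈ Finset.range m, ρ ^ l • α^[l] v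

/-- The extension of `β = α⁻¹` to `A[y; α]` with `β(y) = ρ y`. -/
def betaLin (α : A ≃ₐ[K] A) (ρ : K) : OreExt (datumY α) →ₗ[K] OreExt (datumY α) :=
  OreExt.liftLin _ fun n => (ρ ^ n) • (OreExt.lmonomial (datumY α) n ∘ₗ α.symm.toLinearMap)

/-- The `β`-derivation of `A[y; α]` with `δ(A) = 0` and `δ(y) = v`; explicitly
`δ(a yⁿ) = β(a) v⁽ⁿ⁾ yⁿ⁻¹`. -/
def deltaLin (α : A ≃ₐ[K] A) (v : A) (ρ : K) : OreExt (datumY α) →ₗ[K] OreExt (datumY α) :=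
  OreExt.liftLin _ fun n => OreExt.lmonomial (datumY α) (n - 1) ∘ₗ
    LinearMap.mulRight K (vSum α v ρ n) ∘ₗ α.symm.toLinearMap

theorem betaLin_monomial (α : A ≃ₐ[K] A) (ρ : K) (n : ℕ) (a : A) :
    betaLin α ρ (OreExt.monomial _ n a) = OreExt.monomial _ n (ρ ^ n • α.symm a) := by
  simp [betaLin]

theorem deltaLin_monomial (α : A ≃ₐ[K] A) (v : A) (ρ : K) (n : ℕ) (a : A) :
    deltaLin α v ρ (OreExt.monomial _ n a) =
      OreExt.monomial _ (n - 1) (α.symm a * vSum α v ρ n) := by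
  simp [deltaLin]

theorem iterate_comm (α : A ≃ₐ[K] A) (n : ℕ) (a : A) : α.symm (α^[n] a) = α^[n] (α.symm a) := by
  induction n generalizing a with
  | zero => rfl
  | succ n ih => simp [ih]

theorem iterate_smul (α : A ≃ₐ[K] A) (n : ℕ) (c : K) (a : A) :
    α^[n] (c • a) = c • α^[n] a := by
  induction n generalizing a with
  | zero => rfl
  | succ n ih => simp [ih]

theorem bilin_ext {D : OreDatum K A} {M : Type*} [AddCommGroup M] [Module K M]
    {f g : OreExt D →ₗ[K] OreExt D →ₗ[K] M}
    (h : ∀ n a k b, f (OreExt.monomial D n a) (OreExt.monomial D k b) =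
      g (OreExt.monomial D n a) (OreExt.monomial D k b)) : f = g :=
  OreExt.hom_ext fun n a => OreExt.hom_ext fun k b => h n a k b

/-- The automorphism `β` of `A[y; α]` as an algebra homomorphism. -/
def betaHom (α : A ≃ₐ[K] A) (ρ : K) : OreExt (datumY α) →ₐ[K] OreExt (datumY α) :=
  AlgHom.ofLinearMap (betaLin α ρ) (by simp [OreExt.one_def, betaLin_monomial]) (by
    have h : (LinearMap.mul K (OreExt (datumY α))).compr₂ (betaLin α ρ) =
        (LinearMap.mul K (OreExt (datumY α))).compl₁₂ (betaLin α ρ) (betaLin α ρ) := by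
      refine bilin_ext fun n a k b => ?_
      have e : ∀ n : ℕ, ∀ a : A, (datumY α).σ^[n] a = α^[n] a := fun _ _ => rfl
      simp [betaLin_monomial, OreExt.monomial_mul_monomial (D := datumY α) rfl, e, iterate_smul,
        iterate_comm, pow_add, smul_smul, mul_comm (ρ ^ k)]
    intro f g
    simpa using LinearMap.congr_fun₂ h f g)

theorem iterate_mem_center (α : A ≃ₐ[K] A) {v : A} (hv : v ∈ Subalgebra.center K A) (n : ℕ) :
    α^[n] v ∈ Subalgebra.center K A := by
  induction n with
  | zero => exact hv
  | succ n ih =>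
    rw [Function.iterate_succ_apply', Subalgebra.mem_center_iff]
    intro b
    have := congrArg α (Subalgebra.mem_center_iff.1 ih (α.symm b))
    simpa using this

theorem vSum_mem_center (α : A ≃ₐ[K] A) {v : A} (hv : v ∈ Subalgebra.center K A) (ρ : K)
    (n : ℕ) : vSum α v ρ n ∈ Subalgebra.center K A :=
  Subalgebra.sum_mem _ fun _ _ => Subalgebra.smul_mem _ (iterate_mem_center α hv _) _

theorem vSum_add (α : A ≃ₐ[K] A) (v : A) (ρ : K) (n k : ℕ) :
    vSum α v ρ (n + k) = vSum α v ρ n + ρ ^ n • α^[n] (vSum α v ρ k) := by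
  have e : ∀ (n : ℕ) (a : A), α^[n] a = (α.toLinearMap ^ n) a := by
    intro n a
    rw [Module.End.pow_apply]
    rfl
  simp only [vSum, Finset.sum_range_add, Finset.smul_sum, pow_add, e, map_sum, map_smul, smul_smul,
    Module.End.mul_apply]

/-- The datum for the extension of `A[y; α]` by `x`. -/
def datumX (α : A ≃ₐ[K] A) (v : Subalgebra.center K A) (ρ : K) :
    OreDatum K (OreExt (datumY α)) where
  σ := betaHom α ρ
  δ := deltaLin α v ρ
  leibniz := by
    have h : (LinearMap.mul K (OreExt (datumY α))).compr₂ (deltaLin α v ρ) =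
        (LinearMap.mul K (OreExt (datumY α))).compl₁₂ (betaLin α ρ) (deltaLin α v ρ) +
        (LinearMap.mul K (OreExt (datumY α))).compl₁₂ (deltaLin α v ρ) LinearMap.id := by
      refine bilin_ext fun n a k b => ?_
      have e : ∀ n : ℕ, ∀ a : A, (datumY α).σ^[n] a = α^[n] a := fun _ _ => rfl
      have hc : ∀ n (b : A), b * vSum α v ρ n = vSum α v ρ n * b := fun n =>
        Subalgebra.mem_center_iff.1 (vSum_mem_center α v.2 ρ n)
      have h0 : vSum α (v : A) ρ 0 = 0 := by simp [vSum]
      have h1 : OreExt.monomial (datumY α) (n + (k - 1))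
            (ρ ^ n • α.symm a * α^[n] (α.symm b * vSum α v ρ k)) =
          OreExt.monomial (datumY α) (n + k - 1)
            (α.symm a * α^[n] (α.symm b) * (ρ ^ n • α^[n] (vSum α v ρ k))) := by
        rcases k with _ | k
        · simp [h0]
        · simp [mul_assoc]
      have h2 : OreExt.monomial (datumY α) (n - 1 + k)
            (α.symm a * vSum α v ρ n * α^[n - 1] b) =
          OreExt.monomial (datumY α) (n + k - 1)
            (α.symm a * α^[n] (α.symm b) * vSum α v ρ n) := by
        rcases n with _ | n
        · simp [h0]
        · have : n + 1 + k - 1 = n + k := by omega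
          simp [this, mul_assoc, hc]
      simp only [LinearMap.compr₂_apply, LinearMap.mul_apply', LinearMap.add_apply,
        LinearMap.compl₁₂_apply, LinearMap.id_apply, betaLin_monomial, deltaLin_monomial,
        OreExt.monomial_mul_monomial (D := datumY α) rfl, e]
      rw [h1, h2, ← OreExt.monomial_add, ← mul_add, map_mul, iterate_comm, vSum_add,
        add_comm (vSum α (v : A) ρ n)]
    intro f g
    simpa [betaHom] using LinearMap.congr_fun₂ h f g

/-- The ambiskew polynomial algebra `R(A, α, v, ρ) = A[y; α][x; β, δ]`, where `v` is central in `A`,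
`β = α⁻¹` on `A`, `β(y) = ρ y`, `δ(A) = 0` and `δ(y) = v`. -/
abbrev _root_.Ambiskew {K A : Type*} [Field K] [Ring A] [Algebra K A]
    (α : A ≃ₐ[K] A) (v : Subalgebra.center K A) (ρ : K) : Type _ :=
  OreExt (Ambiskew.datumX α v ρ)

variable (α : A ≃ₐ[K] A) (v : Subalgebra.center K A) (ρ : K)

/-- The inclusion `A → R(A, α, v, ρ)`. -/
def ofBase : A →ₐ[K] Ambiskew α v ρ := (OreExt.C _).comp (OreExt.C _)

/-- The generator `x`. -/
def x : Ambiskew α v ρ := OreExt.X _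

/-- The generator `y`. -/
def y : Ambiskew α v ρ := OreExt.C _ (OreExt.X _)

theorem y_mul_ofBase (a : A) :
    y α v ρ * ofBase α v ρ a = ofBase α v ρ (α a) * y α v ρ := by
  have h := OreExt.X_mul_C (D := datumY α) a
  have h0 : (datumY α).δ a = 0 := rfl
  rw [h0, map_zero, add_zero] at h
  have h' := congrArg (OreExt.C (datumX α v ρ)) h
  rw [map_mul, map_mul] at h'
  exact h'

theorem x_mul_ofBase (a : A) :
    x α v ρ * ofBase α v ρ a = ofBase α v ρ (α.symm a) * x α v ρ := by
  have h := OreExt.X_mul_C (D := datumX α v ρ) (OreExt.C _ a)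
  have h1 : (datumX α v ρ).σ (OreExt.C _ a) = OreExt.C _ (α.symm a) :=
    (betaLin_monomial α ρ 0 a).trans (by simp [OreExt.C])
  have h2 : (datumX α v ρ).δ (OreExt.C _ a) = 0 :=
    (deltaLin_monomial α v ρ 0 a).trans (by simp [vSum])
  rw [h1, h2, map_zero, add_zero] at h
  exact h

theorem x_mul_y :
    x α v ρ * y α v ρ = ρ • (y α v ρ * x α v ρ) + ofBase α v ρ v := by
  have h := OreExt.X_mul_C (D := datumX α v ρ) (OreExt.X _)
  have h1 : (datumX α v ρ).σ (OreExt.X _) = ρ • OreExt.X _ :=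
    (betaLin_monomial α ρ 1 1).trans (by simp [OreExt.X])
  have h2 : (datumX α v ρ).δ (OreExt.X _) = OreExt.C _ (v : A) :=
    (deltaLin_monomial α v ρ 1 1).trans (by simp [vSum, OreExt.C])
  rw [h1, h2, map_smul, smul_mul_assoc] at h
  exact h

/-- The element `xy - u`; it is the Casimir element if `u` is a splitting element, that is,
if `u` is central and `v = u - ρ α(u)`. -/
def casimir (u : A) : Ambiskew α v ρ := x α v ρ * y α v ρ - ofBase α v ρ u

/-- Let `W` be a ring with a ring homomorphism `ι : A → W` and elements `X`, `Y`
(for a generalized Weyl algebra `W(A, α, u)`, the inclusion of `A` and the standard generators).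
For an ideal `I` of `A`, this is `J(I) = ∑_{i ≥ 0} I_i Yⁱ + ∑_{i ≥ 0} I_{-i} Xⁱ`, where
`I_i = I_{-i} = A` for `i ≥ m` and, for `0 ≤ i ≤ m - 1`,
`I_i = ⋂_{0 ≤ l ≤ m-1-i} α⁻ˡ(I)` and `I_{-i} = ⋂_{i ≤ l ≤ m-1} α⁻ˡ(I)`. -/
def gradedJ {W : Type*} [Ring W] (ι : A →+* W) (X Y : W) (m : ℕ) (I : TwoSidedIdeal A) :
    AddSubgroup W :=
  AddSubgroup.closure
    ({w | ∃ (i : ℕ) (a : A), (∀ l, l + i < m → α^[l] a ∈ I) ∧ w = ι a * Y ^ i} ∪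
     {w | ∃ (i : ℕ) (a : A), (∀ l, i ≤ l → l < m → α^[l] a ∈ I) ∧ w = ι a * X ^ i})

end Ambiskew

/-! ### Quantum tori -/

/-- The bicharacter `(a, b) ↦ ∏_{j < i} Q_{ij}^{a_i b_j}` on `ℤⁿ`. -/
def torusCocycle {K : Type*} [Field K] {n : ℕ} (Q : Fin n → Fin n → Kˣ) (a b : Fin n → ℤ) : Kˣ :=
  ∏ i, ∏ j, if j < i then Q i j ^ (a i * b j) else 1

/-- The quantum torus with generators `z_i^{±1}` and relations `z_i z_j = Q_{ij} z_j z_i` for `j < i`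
(only the entries `Q_{ij}` with `j < i` are used), as the twisted group algebra of `ℤⁿ`: it has the
`K`-basis of ordered monomials `z^a = z_1^{a_1} ⋯ z_n^{a_n}`, `a ∈ ℤⁿ`, with the multiplication
`z^a z^b = (∏_{j < i} Q_{ij}^{a_i b_j}) z^{a+b}` defined below. -/
def QTorus {K : Type*} [Field K] {n : ℕ} (_Q : Fin n → Fin n → Kˣ) : Type _ := (Fin n → ℤ) →₀ K

namespace QTorus

variable {K : Type*} [Field K] {n : ℕ} (Q : Fin n → Fin n → Kˣ)

instance : AddCommGroup (QTorus Q) := inferInstanceAs (AddCommGroup ((Fin n → ℤ) →₀ K))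
instance : Module K (QTorus Q) := inferInstanceAs (Module K ((Fin n → ℤ) →₀ K))

/-- The monomial `z^a`. -/
def mono (a : Fin n → ℤ) : QTorus Q := Finsupp.single a 1

/-- The monomials form a basis: extension of a map on monomials by linearity. -/
def liftLin {M : Type*} [AddCommGroup M] [Module K M] (f : (Fin n → ℤ) → M) : QTorus Q →ₗ[K] M :=
  Finsupp.linearCombination K f

/-- Multiplication, as a bilinear map. -/
def mulLin : QTorus Q →ₗ[K] QTorus Q →ₗ[K] QTorus Q :=
  liftLin Q fun a => liftLin Q fun b => (torusCocycle Q a b : K) • mono Q (a + b)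

instance : Mul (QTorus Q) := ⟨fun f g => mulLin Q f g⟩
instance : One (QTorus Q) := ⟨mono Q 0⟩

variable {Q}

theorem mul_def (f g : QTorus Q) : f * g = mulLin Q f g := rfl
theorem one_def : (1 : QTorus Q) = mono Q 0 := rfl

@[simp] theorem liftLin_mono {M : Type*} [AddCommGroup M] [Module K M] (f : (Fin n → ℤ) → M)
    (a : Fin n → ℤ) : liftLin Q f (mono Q a) = f a :=
  (Finsupp.linearCombination_single K (1 : K) a).trans (one_smul K _)

theorem hom_ext {M : Type*} [AddCommGroup M] [Module K M] {f g : QTorus Q →ₗ[K] M}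
    (h : ∀ a, f (mono Q a) = g (mono Q a)) : f = g :=
  Finsupp.lhom_ext' fun a => LinearMap.ext_ring (h a)

theorem mulLin_mono (a b : Fin n → ℤ) :
    mulLin Q (mono Q a) (mono Q b) = (torusCocycle Q a b : K) • mono Q (a + b) := by
  simp [mulLin]

theorem mono_mul_mono (a b : Fin n → ℤ) :
    mono Q a * mono Q b = (torusCocycle Q a b : K) • mono Q (a + b) := mulLin_mono a b

theorem cocycle_add_left (a b c : Fin n → ℤ) :
    torusCocycle Q (a + b) c = torusCocycle Q a c * torusCocycle Q b c := by
  simp only [torusCocycle, ← Finset.prod_mul_distrib]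
  refine Finset.prod_congr rfl fun i _ => Finset.prod_congr rfl fun j _ => ?_
  split_ifs <;> simp [add_mul, zpow_add]

theorem cocycle_add_right (a b c : Fin n → ℤ) :
    torusCocycle Q a (b + c) = torusCocycle Q a b * torusCocycle Q a c := by
  simp only [torusCocycle, ← Finset.prod_mul_distrib]
  refine Finset.prod_congr rfl fun i _ => Finset.prod_congr rfl fun j _ => ?_
  split_ifs <;> simp [mul_add, zpow_add]

theorem cocycle_zero_left (a : Fin n → ℤ) : torusCocycle Q 0 a = 1 := by simp [torusCocycle]
theorem cocycle_zero_right (a : Fin n → ℤ) : torusCocycle Q a 0 = 1 := by simp [torusCocycle]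

theorem mulLin_assoc (f g h : QTorus Q) :
    mulLin Q (mulLin Q f g) h = mulLin Q f (mulLin Q g h) := by
  have : (LinearMap.compr₂ (mulLin Q) (mulLin Q)) =
      ((LinearMap.llcomp K _ _ _).flip ∘ₗ (mulLin Q)).flip ∘ₗ (mulLin Q) := by
    refine hom_ext fun a => hom_ext fun b => hom_ext fun c => ?_
    simp [mulLin_mono, smul_smul, cocycle_add_left, cocycle_add_right, add_assoc]
    ring_nf
  exact LinearMap.congr_fun (LinearMap.congr_fun₂ this f g) h

theorem one_mulLin (f : QTorus Q) : mulLin Q (mono Q 0) f = f := by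
  have : mulLin Q (mono Q 0) = LinearMap.id := by
    refine hom_ext fun a => ?_
    simp [mulLin_mono, cocycle_zero_left]
  simpa using LinearMap.congr_fun this f

theorem mulLin_one (f : QTorus Q) : mulLin Q f (mono Q 0) = f := by
  have : (mulLin Q).flip (mono Q 0) = LinearMap.id := by
    refine hom_ext fun a => ?_
    simp [mulLin_mono, cocycle_zero_right]
  simpa using LinearMap.congr_fun this f

instance : Ring (QTorus Q) where
  __ := (inferInstance : AddCommGroup (QTorus Q))
  mul := (· * ·)
  one := 1
  left_distrib f g h := by simp [mul_def]
  right_distrib f g h := by simp [mul_def]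
  zero_mul f := by simp [mul_def]
  mul_zero f := by simp [mul_def]
  mul_assoc f g h := mulLin_assoc f g h
  one_mul f := one_mulLin f
  mul_one f := mulLin_one f

instance : Algebra K (QTorus Q) :=
  Algebra.ofModule (fun c f g => by simp [mul_def]) (fun c f g => by simp [mul_def])

theorem cocycle_single_single (i j : Fin n) (s t : ℤ) :
    torusCocycle Q (Pi.single i s) (Pi.single j t) = if j < i then Q i j ^ (s * t) else 1 := by
  rw [torusCocycle, Finset.prod_eq_single i, Finset.prod_eq_single j]
  · simp
  · intro b _ hb
    simp [Pi.single_eq_of_ne hb]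
  · simp
  · intro b _ hb
    simp [Pi.single_eq_of_ne hb]
  · simp

variable (Q)

/-- The generator `z_i`, a unit with inverse `z_i⁻¹`. -/
def gen (i : Fin n) : (QTorus Q)ˣ where
  val := mono Q (Pi.single i 1)
  inv := mono Q (Pi.single i (-1))
  val_inv := by
    rw [mono_mul_mono, cocycle_single_single, ← Pi.single_add]
    simp [one_def]
  inv_val := by
    rw [mono_mul_mono, cocycle_single_single, ← Pi.single_add]
    simp [one_def]

/-- The defining relations of the quantum torus. -/
theorem gen_mul_gen {i j : Fin n} (h : j < i) :
    (gen Q i * gen Q j : QTorus Q) = (Q i j : K) • (gen Q j * gen Q i : QTorus Q) := by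
  simp [gen, mono_mul_mono, cocycle_single_single, h, h.not_gt, add_comm]

/-- The linear map `z^a ↦ (∏ χ_i^{a_i}) z^a`. -/
def scaleLin (χ : Fin n → Kˣ) : QTorus Q →ₗ[K] QTorus Q :=
  liftLin Q fun a => ((∏ i, χ i ^ a i : Kˣ) : K) • mono Q a

theorem scaleLin_mono (χ : Fin n → Kˣ) (a : Fin n → ℤ) :
    scaleLin Q χ (mono Q a) = ((∏ i, χ i ^ a i : Kˣ) : K) • mono Q a := by
  simp [scaleLin]

theorem scaleLin_mul (χ : Fin n → Kˣ) (f g : QTorus Q) :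
    scaleLin Q χ (f * g) = scaleLin Q χ f * scaleLin Q χ g := by
  have : (mulLin Q).compr₂ (scaleLin Q χ) =
      (mulLin Q).compl₁₂ (scaleLin Q χ) (scaleLin Q χ) := by
    refine hom_ext fun a => hom_ext fun b => ?_
    simp [mulLin_mono, scaleLin_mono, smul_smul, zpow_add, Finset.prod_mul_distrib]
    ring_nf
  exact LinearMap.congr_fun₂ this f g

theorem scaleLin_scaleLin (χ ψ : Fin n → Kˣ) (h : χ * ψ = 1) :
    scaleLin Q χ ∘ₗ scaleLin Q ψ = LinearMap.id := by
  refine hom_ext fun a => ?_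
  have e : ∏ i, (ψ i ^ a i * χ i ^ a i) = 1 :=
    Finset.prod_eq_one fun i _ => by
      rw [mul_comm, ← mul_zpow, show χ i * ψ i = 1 from congrFun h i, one_zpow]
  rw [Finset.prod_mul_distrib] at e
  rw [LinearMap.comp_apply, scaleLin_mono, map_smul, scaleLin_mono, smul_smul, ← Units.val_mul, e,
    Units.val_one, one_smul, LinearMap.id_apply]

/-- The automorphism `z_i ↦ χ_i z_i`. -/
def scale (χ : Fin n → Kˣ) : QTorus Q ≃ₐ[K] QTorus Q :=
  AlgEquiv.ofLinearEquiv
    (LinearEquiv.ofLinearMap (scaleLin Q χ) (scaleLin Q χ⁻¹)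
      (scaleLin_scaleLin Q _ _ (mul_inv_cancel χ)) (scaleLin_scaleLin Q _ _ (inv_mul_cancel χ)))
    (by simp [one_def, scaleLin_mono]) (scaleLin_mul Q χ)

theorem scale_gen (χ : Fin n → Kˣ) (i : Fin n) :
    scale Q χ (gen Q i) = (χ i : K) • (gen Q i : QTorus Q) := by
  have : ∏ j, χ j ^ (Pi.single i (1 : ℤ) : Fin n → ℤ) j = χ i := by
    rw [Finset.prod_eq_single i]
    · simp
    · intro b _ hb
      simp [Pi.single_eq_of_ne hb]
    · simp
  simp only [gen]
  exact (scaleLin_mono Q χ _).trans (by rw [this])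

theorem gen_mem_center (i : Fin n) (h1 : ∀ j, j < i → Q i j = 1) (h2 : ∀ j, i < j → Q j i = 1) :
    (gen Q i : QTorus Q) ∈ Subalgebra.center K (QTorus Q) := by
  have e1 : ∀ a, torusCocycle Q (Pi.single i 1) a = 1 := by
    intro a
    refine Finset.prod_eq_one fun k _ => Finset.prod_eq_one fun j _ => ?_
    split_ifs with hk
    · by_cases hki : k = i
      · subst hki; simp [h1 j hk]
      · simp [Pi.single_eq_of_ne hki]
    · rfl
  have e2 : ∀ a, torusCocycle Q a (Pi.single i 1) = 1 := by
    intro a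
    refine Finset.prod_eq_one fun k _ => Finset.prod_eq_one fun j _ => ?_
    split_ifs with hk
    · by_cases hji : j = i
      · subst hji; simp [h2 k hk]
      · simp [Pi.single_eq_of_ne hji]
    · rfl
  have : (mulLin Q).flip (gen Q i : QTorus Q) = mulLin Q (gen Q i : QTorus Q) := by
    refine hom_ext fun a => ?_
    simp [gen, mulLin_mono, e1, e2, add_comm]
  rw [Subalgebra.mem_center_iff]
  exact fun b => LinearMap.congr_fun this b

end QTorus

/-! ### The ambiskew polynomial algebra over the quantum torus -/

namespace TorusExample

variable {K : Type*} [Field K] (p : ℕ) (hp : Odd p) (q : Kˣ)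

/-- The parameters `q_{ij}`, `j < i`: `q⁻¹` if `i` is even and `j` is odd, and `1` otherwise.
Indices in `Fin p` start at `0`, so `i : Fin p` stands for the index `i + 1 ∈ {1, …, p}`. -/
def qMatrix (i j : Fin p) : Kˣ := if Even (i.val + 1) ∧ Odd (j.val + 1) then q⁻¹ else 1

/-- The quantum torus `A`. -/
abbrev A : Type _ := QTorus (qMatrix p q)

/-- The automorphism `α` of `A`: `z_i ↦ z_i` for `i` even and `z_i ↦ q⁻¹ z_i` for `i` odd. -/
def α : A p q ≃ₐ[K] A p q :=
  QTorus.scale _ fun i => if Even (i.val + 1) then 1 else q⁻¹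

/-- The last generator `z_p` of `A`. -/
def zp : (A p q)ˣ := QTorus.gen _ ⟨p - 1, by have := hp.pos; omega⟩

theorem zp_mem_center : (zp p hp q : A p q) ∈ Subalgebra.center K (A p q) := by
  refine QTorus.gen_mem_center _ _ (fun j _ => ?_) (fun j hj => ?_)
  · have : ¬ Even (p - 1 + 1) := by
      rw [Nat.sub_add_cancel hp.pos]
      exact Nat.not_even_iff_odd.2 hp
    simp [qMatrix, this]
  · have := j.isLt
    have : p - 1 < j.val := hj
    omega

theorem zp_inv_mem_center : (((zp p hp q)⁻¹ : (A p q)ˣ) : A p q) ∈ Subalgebra.center K (A p q) := by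
  rw [Subalgebra.mem_center_iff]
  intro b
  rw [Units.eq_inv_mul_iff_mul_eq, ← mul_assoc,
    ← Subalgebra.mem_center_iff.1 (zp_mem_center p hp q) b, mul_assoc, Units.mul_inv, mul_one]

/-- `u = q^{(p-1)/2} z_p⁻¹ + q z_p`. -/
def u : A p q :=
  ((q : K) ^ ((p - 1) / 2)) • (((zp p hp q)⁻¹ : (A p q)ˣ) : A p q) + (q : K) • (zp p hp q : A p q)

/-- `v = (1 - q)(q^{(p-1)/2} z_p⁻¹ - z_p)`, a central element. -/
def v : Subalgebra.center K (A p q) :=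
  ⟨(1 - (q : K)) • (((q : K) ^ ((p - 1) / 2)) • (((zp p hp q)⁻¹ : (A p q)ˣ) : A p q)
      - (zp p hp q : A p q)),
    Subalgebra.smul_mem _ (Subalgebra.sub_mem _
      (Subalgebra.smul_mem _ (zp_inv_mem_center p hp q) _) (zp_mem_center p hp q)) _⟩

/-- The algebra `R = R(A, α, v, 1)`. -/
abbrev R : Type _ := Ambiskew (α p q) (v p hp q) 1

/-- The Casimir element `z = xy - u` of `R`. -/
def z : R p hp q := Ambiskew.casimir _ _ _ (u p hp q)

/-- The two-sided ideal of `R` generated by `z - c`, for a scalar `c`. -/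
def zIdeal (c : K) : TwoSidedIdeal (R p hp q) :=
  TwoSidedIdeal.span {z p hp q - algebraMap K (R p hp q) c}

/-- The canonical epimorphism `π : R → R/(z - c)R`. -/
def proj (c : K) : R p hp q →+* (zIdeal p hp q c).ringCon.Quotient := (zIdeal p hp q c).ringCon.mk'

/-- The scalar `λ = -ε q^{(p-2m+1)/4} (q^m + 1)`, for a sign `ε`; here and below `r` is a fixed
fourth root of `q`, and `q^{k/4}` means `rᵏ`. -/
def lam (r : Kˣ) (m : ℕ) (ε : ℤˣ) : K :=
  -((ε : ℤ) : K) * ((r ^ ((p : ℤ) - 2 * m + 1) : Kˣ) : K) * ((q : K) ^ m + 1)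

/-- The ideal `(z_p - ε q^{(p+2m-3)/4}) A` of `A` (note that `z_p` is central). -/
def M (r : Kˣ) (m : ℕ) (ε : ℤˣ) : TwoSidedIdeal (A p q) :=
  TwoSidedIdeal.span {(zp p hp q : A p q) -
    algebraMap K (A p q) (((ε : ℤ) : K) * ((r ^ ((p : ℤ) + 2 * m - 3) : Kˣ) : K))}

/-- `J((z_p - ε q^{(p+2m-3)/4}) A)` in `R/(z - λ)R`, which is the generalized Weyl algebra
`W(A, α, u + λ)` with `X` and `Y` the images of `x` and `y`. -/
def J (r : Kˣ) (m : ℕ) (ε : ℤˣ) :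
    AddSubgroup (zIdeal p hp q (lam p q r m ε)).ringCon.Quotient :=
  Ambiskew.gradedJ (α p q)
    ((proj p hp q (lam p q r m ε)).comp (Ambiskew.ofBase (α p q) (v p hp q) 1).toRingHom)
    (proj p hp q (lam p q r m ε) (Ambiskew.x _ _ _))
    (proj p hp q (lam p q r m ε) (Ambiskew.y _ _ _)) m (M p hp q r m ε)

/-- The preimage `F_{m,ε} = π⁻¹(J((z_p - ε q^{(p+2m-3)/4}) A))` in `R`. -/
def F (r : Kˣ) (m : ℕ) (ε : ℤˣ) : Set (R p hp q) :=
  {s | proj p hp q (lam p q r m ε) s ∈ J p hp q r m ε}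

end TorusExample

end

/-!
Write `t = z_p`. Conjugation by the generators `z_1, …, z_p` acts diagonally on the spanning set
`z^a Y^(n)` of `R` over `K[z]`, where `Y^(n) = yⁿ` or `x⁻ⁿ`, and the weights determine `n` and all
the exponents in `a` but the last one (`TorusExample.eq_of_totalWt`). So two-sided ideals are
graded (`TorusExample.comb_filter_mem`), and all questions about them reduce to the subalgebra
generated by `x`, `y`, `z` and `t^{±1}`, which is described by `RankOneRelations`. Multiplication
by `y` or `x` separates the powers of `t` as well, so that a coefficient in `K[z]` of an element of
an ideal, times a power of `y` or `x`, lies in the ideal (`TorusExample.exists_mul_pow_mem`).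

As `x yⁿ⁺¹ = (z + u) yⁿ` and `yⁿ⁺¹ x = (z + αⁿ⁺¹(u)) yⁿ`, an ideal that contains `w yⁿ⁺¹`, for a
central element `w`, also contains `w (z² - ρ) yⁿ`, where `z² - ρ` is the resultant of the two
factors with respect to `t` (`RankOneRelations.mul_resultant_mem`). By descent, every non-zero
ideal contains a non-zero element of `K[z]`. As `K` is algebraically closed, every non-zero prime
ideal contains some `z - a`, and the ideal `(z - a)R` is maximal unless `a² = ρ` for one of the resultants. These values of
`a` are the exceptional ones, `λ_{m,ε}`, with `n + 1 = m`. That the ideals `(z - a)R` and `0` are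
prime follows from representations `TorusExample.phi` of `R` in the quantum torus with one more
generator, in which `z` acts as the scalar `a`; the kernel is `(z - a)R`, and the image is a
domain.

Let `a` be exceptional, with exponent `m`. Then `t (u + a)` is a multiple of `(t - μ)(t - q⁻ᵐ μ)`,
which makes `J((t - μ)A)` an ideal; its preimage in `R` is `TorusExample.expIdeal`. An ideal `I`
strictly above `(z - a)R` contains `yᵐ` or `xᵐ`, because the exponent `m` is the only obstruction
to the descent. Combining the products with `x` on both sides, one obtains
`∏_{l < m - n} (t - q⁻ˡ μ) yⁿ ∈ I`, hence a polynomial in `t`, both `yᵐ` and `xᵐ`, and all of the exceptional ideal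
(`TorusExample.expIdeal_le_of_lt`). If `I` is proper then, conversely, the polynomials `P` with
`P(t) yⁿ ∈ I` have the zeros `q⁻ˡ μ`, `l < m - n` (`RankOneRelations.eval_eq_zero`), so that `I` is
not larger than the exceptional ideal. The latter is therefore maximal
(`TorusExample.expIdeal_isCoatom`) and the only proper ideal strictly above `(z - a)R`. The list of
the prime ideals and their heights follow.
-/

/-! ### Separation of weights -/

/-- If a space of coefficient functions is stable under multiplication by the functions in `D`,
then each of its members may be cut down to the indices that `D` does not separate from `i₀`. -/
theorem Submodule.exists_mem_restrict_of_mul_mem {K ι : Type*} [Field K]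
    (N : Submodule K (ι → K)) (D : Set (ι → K)) (hD : ∀ d ∈ D, ∀ c ∈ N, d * c ∈ N)
    (i₀ : ι) {c₀ : ι → K} (hc₀ : c₀ ∈ N) (s : Finset ι) :
    ∃ c ∈ N, (∀ i, (∀ d ∈ D, d i = d i₀) → c i = c₀ i) ∧
      ∀ i ∈ s, ¬ (∀ d ∈ D, d i = d i₀) → c i = 0 := by
  classical
  induction s using Finset.induction_on with
  | empty => exact ⟨c₀, hc₀, fun _ _ => rfl, by simp⟩
  | insert j s _ ih =>
    obtain ⟨c, hc, h1, h2⟩ := ih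
    by_cases hj : ∀ d ∈ D, d j = d i₀
    · refine ⟨c, hc, h1, fun i hi hn => ?_⟩
      rcases Finset.mem_insert.1 hi with rfl | hi
      · exact absurd hj hn
      · exact h2 i hi hn
    · push Not at hj
      obtain ⟨d, hd, hne⟩ := hj
      have hne' : d i₀ - d j ≠ 0 := sub_ne_zero.2 hne.symm
      refine ⟨(d i₀ - d j)⁻¹ • (d * c - d j • c),
        N.smul_mem _ (N.sub_mem (hD d hd c hc) (N.smul_mem _ hc)), fun i hi => ?_,
        fun i hi hn => ?_⟩
      · simp only [Pi.smul_apply, Pi.sub_apply, Pi.mul_apply, smul_eq_mul, hi d hd, h1 i hi]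
        rw [← sub_mul, inv_mul_cancel_left₀ hne']
      · rcases Finset.mem_insert.1 hi with rfl | hi
        · simp
        · simp [h2 i hi hn]

/-! ### Two-sided ideals of algebras -/

theorem TwoSidedIdeal.smul_mem_of_algebra {K S : Type*} [Field K] [Ring S] [Algebra K S]
    (I : TwoSidedIdeal S) (c : K) {s : S} (h : s ∈ I) : c • s ∈ I := by
  rw [Algebra.smul_def]
  exact I.mul_mem_left _ _ h

theorem TwoSidedIdeal.smul_mem_iff_of_ne_zero {K S : Type*} [Field K] [Ring S] [Algebra K S]
    (I : TwoSidedIdeal S) {c : K} (hc : c ≠ 0) {s : S} : c • s ∈ I ↔ s ∈ I := by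
  refine ⟨fun h => ?_, I.smul_mem_of_algebra c⟩
  simpa [smul_smul, inv_mul_cancel₀ hc] using I.smul_mem_of_algebra c⁻¹ h

theorem TwoSidedIdeal.mem_span_singleton_of_central {S : Type*} [Ring S] {c : S}
    (hc : ∀ r, c * r = r * c) {w : S} : w ∈ TwoSidedIdeal.span {c} ↔ ∃ t, w = c * t := by
  constructor
  · intro h
    let I : TwoSidedIdeal S := TwoSidedIdeal.mk' {w | ∃ t, w = c * t} ⟨0, by rw [mul_zero]⟩
      (by rintro _ _ ⟨t, rfl⟩ ⟨t', rfl⟩; exact ⟨t + t', by rw [mul_add]⟩)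
      (by rintro _ ⟨t, rfl⟩; exact ⟨-t, by rw [mul_neg]⟩)
      (by rintro r _ ⟨t, rfl⟩; exact ⟨r * t, by rw [← mul_assoc, ← hc, mul_assoc]⟩)
      (by rintro _ r ⟨t, rfl⟩; exact ⟨t * r, by rw [mul_assoc]⟩)
    have hle : TwoSidedIdeal.span {c} ≤ I := by
      rw [TwoSidedIdeal.span_le, Set.singleton_subset_iff, SetLike.mem_coe, TwoSidedIdeal.mem_mk']
      exact ⟨1, by rw [mul_one]⟩
    have h' : w ∈ I := hle h
    simp only [I, TwoSidedIdeal.mem_mk'] at h'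
    exact h'
  · rintro ⟨t, rfl⟩
    exact TwoSidedIdeal.mul_mem_right _ _ _ (TwoSidedIdeal.subset_span rfl)

/-! ### Universal properties of skew polynomial algebras -/

namespace OreExt

variable {K B S : Type*} [Field K] [Ring B] [Algebra K B] [Ring S] [Algebra K S] {D : OreDatum K B}

/-- The algebra homomorphism `B[x; σ, δ] → S` that extends `f : B → S` and sends `x` to `t`. -/
noncomputable def lift (f : B →ₐ[K] S) (t : S)
    (h : ∀ b, t * f b = f (D.σ b) * t + f (D.δ b)) : OreExt D →ₐ[K] S :=
  AlgHom.ofLinearMap (liftLin D fun n => LinearMap.mulRight K (t ^ n) ∘ₗ f.toLinearMap)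
    (by simp [one_def]) (by
      set L : OreExt D →ₗ[K] S := liftLin D fun n => LinearMap.mulRight K (t ^ n) ∘ₗ f.toLinearMap
      have h1 : L ∘ₗ shift D = LinearMap.mulLeft K t ∘ₗ L := by
        refine hom_ext fun n b => ?_
        simp [L, shift_monomial, ← mul_assoc, h, add_mul, pow_succ']
      have h2 : ∀ n, L ∘ₗ (shift D ^ n) = LinearMap.mulLeft K (t ^ n) ∘ₗ L := by
        intro n
        induction n with
        | zero => ext; simp
        | succ n ih =>
          ext g
          have := LinearMap.congr_fun h1 ((shift D ^ n) g)
          have ih' := LinearMap.congr_fun ih g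
          simp only [LinearMap.comp_apply, LinearMap.mulLeft_apply] at this ih' ⊢
          rw [pow_succ', Module.End.mul_apply, this, ih', pow_succ', mul_assoc]
      have h3 : ∀ b, L ∘ₗ Algebra.lsmul K K (OreExt D) b = LinearMap.mulLeft K (f b) ∘ₗ L := by
        intro b
        refine hom_ext fun n c => ?_
        simp [L, mul_assoc]
      have h4 : (LinearMap.mul K (OreExt D)).compr₂ L = (LinearMap.mul K S).compl₁₂ L L := by
        refine hom_ext fun n b => LinearMap.ext fun g => ?_
        have e2 := LinearMap.congr_fun (h2 n) g
        have e3 := LinearMap.congr_fun (h3 b) ((shift D ^ n) g)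
        simp only [LinearMap.comp_apply, LinearMap.mulLeft_apply] at e2 e3
        simp only [LinearMap.compr₂_apply, LinearMap.mul_apply', LinearMap.compl₁₂_apply, mul_def,
          lmul_monomial, Module.End.mul_apply, e3, e2]
        simp [L, mul_assoc]
      exact fun g g' => LinearMap.congr_fun₂ h4 g g')

theorem lift_monomial (f : B →ₐ[K] S) (t : S) (h : ∀ b, t * f b = f (D.σ b) * t + f (D.δ b))
    (n : ℕ) (b : B) : lift f t h (monomial D n b) = f b * t ^ n :=
  liftLin_monomial _ n b

@[simp] theorem lift_C (f : B →ₐ[K] S) (t : S) (h : ∀ b, t * f b = f (D.σ b) * t + f (D.δ b))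
    (b : B) : lift f t h (C D b) = f b :=
  (lift_monomial f t h 0 b).trans (by simp)

@[simp] theorem lift_X (f : B →ₐ[K] S) (t : S) (h : ∀ b, t * f b = f (D.σ b) * t + f (D.δ b)) :
    lift f t h (X D) = t :=
  (lift_monomial f t h 1 1).trans (by simp)

theorem X_pow (n : ℕ) : X D ^ n = monomial D n 1 := by
  induction n with
  | zero => rfl
  | succ n ih =>
    have h1 : D.δ 1 = 0 := by simpa using D.leibniz 1 1
    rw [pow_succ', ih, mul_def, X, lmul_monomial]
    simp [shift_monomial, h1]

theorem monomial_eq (n : ℕ) (b : B) : monomial D n b = C D b * X D ^ n := by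
  rw [X_pow, mul_def, C]
  simp [lmul_monomial]

theorem induction_on {P : OreExt D → Prop} (f : OreExt D) (h0 : P 0)
    (hadd : ∀ f g, P f → P g → P (f + g)) (hm : ∀ b n, P (C D b * X D ^ n)) : P f := by
  refine Finsupp.induction_linear (motive := fun f : ℕ →₀ B => P f) f h0 hadd fun n b => ?_
  have h := hm b n
  rw [← monomial_eq] at h
  exact h

end OreExt

namespace Ambiskew

variable {K A S : Type*} [Field K] [Ring A] [Algebra K A] [Ring S] [Algebra K S]
  {α : A ≃ₐ[K] A} {v : Subalgebra.center K A} {ρ : K}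

/-- The homomorphism `R(A, α, v, ρ) → S` that extends `g : A → S` and sends `x`, `y` to `x'`, `y'`,
for `x'` and `y'` satisfying the defining relations. -/
theorem exists_lift (g : A →ₐ[K] S) (x' y' : S) (hy : ∀ a, y' * g a = g (α a) * y')
    (hx : ∀ a, x' * g a = g (α.symm a) * x') (hxy : x' * y' = ρ • (y' * x') + g v) :
    ∃ φ : Ambiskew α v ρ →ₐ[K] S, (∀ a, φ (ofBase α v ρ a) = g a) ∧ φ (x α v ρ) = x' ∧
      φ (y α v ρ) = y' := by
  have hy' : ∀ a, y' * g a = g ((datumY α).σ a) * y' + g ((datumY α).δ a) := fun a => by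
    have h0 : (datumY α).δ a = 0 := rfl
    rw [h0, map_zero, add_zero]
    exact hy a
  have hyn : ∀ n a, y' ^ n * g a = g (α^[n] a) * y' ^ n := by
    intro n
    induction n with
    | zero => simp
    | succ n ih =>
      intro a
      rw [pow_succ', mul_assoc, ih, ← mul_assoc, hy, mul_assoc, Function.iterate_succ_apply']
  have hn : ∀ n, x' * y' ^ n = ρ ^ n • (y' ^ n * x') + g (vSum α v ρ n) * y' ^ (n - 1) := by
    intro n
    induction n with
    | zero => simp [vSum]
    | succ n ih =>
      have e : g (vSum α v ρ n) * y' ^ (n - 1) * y' = g (vSum α v ρ n) * y' ^ n := by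
        rcases n with _ | n
        · simp [vSum]
        · simp [mul_assoc, pow_succ]
      have e2 : vSum α (v : A) ρ (n + 1) = vSum α v ρ n + ρ ^ n • α^[n] (v : A) := by
        simp [vSum, Finset.sum_range_succ]
      rw [pow_succ, ← mul_assoc, ih, add_mul, e, smul_mul_assoc, mul_assoc, hxy, e2, map_add,
        map_smul, Nat.add_sub_cancel, mul_add, hyn, mul_smul_comm, smul_add, smul_smul, add_mul,
        pow_succ, smul_mul_assoc, ← mul_assoc]
      abel
  set f := OreExt.lift (D := datumY α) g y' hy'
  have hf : ∀ b, x' * f b = f ((datumX α v ρ).σ b) * x' + f ((datumX α v ρ).δ b) := by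
    have : LinearMap.mulLeft K x' ∘ₗ f.toLinearMap =
        LinearMap.mulRight K x' ∘ₗ f.toLinearMap ∘ₗ betaLin α ρ +
          f.toLinearMap ∘ₗ deltaLin α v ρ := by
      refine OreExt.hom_ext fun n a => ?_
      simp only [LinearMap.comp_apply, LinearMap.mulLeft_apply, LinearMap.mulRight_apply,
        LinearMap.add_apply, AlgHom.toLinearMap_apply, betaLin_monomial, deltaLin_monomial, f,
        OreExt.lift_monomial]
      rw [← mul_assoc, hx, mul_assoc, hn, map_smul, map_mul, mul_add]
      simp [mul_assoc]
    exact fun b => LinearMap.congr_fun this b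
  refine ⟨OreExt.lift f x' hf, fun a => ?_, OreExt.lift_X _ _ _, ?_⟩
  · exact (OreExt.lift_C f x' hf _).trans (OreExt.lift_C g y' hy' a)
  · exact (OreExt.lift_C f x' hf _).trans (OreExt.lift_X g y' hy')

/-- Induction on the basis `a yⁱ xʲ`. -/
theorem induction_on {P : Ambiskew α v ρ → Prop} (w : Ambiskew α v ρ) (h0 : P 0)
    (hadd : ∀ f g, P f → P g → P (f + g))
    (hm : ∀ a i j, P (ofBase α v ρ a * y α v ρ ^ i * x α v ρ ^ j)) : P w := by
  refine OreExt.induction_on w h0 hadd fun b j => ?_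
  refine OreExt.induction_on
    (P := fun b => P (OreExt.C (datumX α v ρ) b * OreExt.X (datumX α v ρ) ^ j)) b
    (by simpa using h0) (fun f g hf hg => ?_) fun a i => ?_
  · rw [map_add, add_mul]
    exact hadd _ _ hf hg
  · rw [map_mul, map_pow]
    exact hm a i j

end Ambiskew

/-! ### Quantum tori -/

namespace QTorus

variable {K : Type*} [Field K] {n : ℕ} {Q : Fin n → Fin n → Kˣ}

/-- The coefficient of the monomial `z^a`. -/
noncomputable def coeff (a : Fin n → ℤ) : QTorus Q →ₗ[K] K := Finsupp.lapply (R := K) a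

theorem coeff_mono (a b : Fin n → ℤ) : coeff a (mono Q b) = if b = a then 1 else 0 :=
  Finsupp.single_apply

theorem exists_sum_mono (f : QTorus Q) :
    ∃ s : Finset (Fin n → ℤ), (∀ a ∈ s, coeff a f ≠ 0) ∧ (∀ a, coeff a f ≠ 0 → a ∈ s) ∧
      f = ∑ a ∈ s, coeff a f • mono Q a := by
  refine ⟨Finsupp.support (f : (Fin n → ℤ) →₀ K), fun a h => Finsupp.mem_support_iff.1 h,
    fun a h => Finsupp.mem_support_iff.2 h, ?_⟩
  have := Finsupp.sum_single (f : (Fin n → ℤ) →₀ K)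
  refine this.symm.trans (Finset.sum_congr rfl fun a _ => ?_)
  exact (Finsupp.smul_single_one a _).symm

theorem induction_on {P : QTorus Q → Prop} (f : QTorus Q) (h0 : P 0)
    (hadd : ∀ f g, P f → P g → P (f + g)) (hm : ∀ (c : K) a, P (c • mono Q a)) : P f := by
  refine Finsupp.induction_linear (motive := fun f : (Fin n → ℤ) →₀ K => P f) f h0 hadd
    fun a c => ?_
  have : (Finsupp.single a c : (Fin n → ℤ) →₀ K) = c • mono Q a :=
    (Finsupp.smul_single_one a c).symm
  exact this ▸ hm c a

/-- Quantum tori are domains, since `ℤⁿ` has unique sums. -/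
instance : NoZeroDivisors (QTorus Q) where
  eq_zero_or_eq_zero_of_mul_eq_zero := by
    intro f g hfg
    by_contra! hne
    obtain ⟨s, hs, -, hf⟩ := exists_sum_mono f
    obtain ⟨t, ht, -, hg⟩ := exists_sum_mono g
    have hs0 : s.Nonempty := Finset.nonempty_iff_ne_empty.2 fun h => hne.1 (by simpa [h] using hf)
    have ht0 : t.Nonempty := Finset.nonempty_iff_ne_empty.2 fun h => hne.2 (by simpa [h] using hg)
    obtain ⟨a, ha, b, hb, hu⟩ := UniqueSums.uniqueAdd_of_nonempty hs0 ht0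
    have key : coeff (a + b) (f * g) = coeff a f * (coeff b g * (torusCocycle Q a b : K)) := by
      have e : f * g = mulLin Q f g := rfl
      rw [e]
      conv_lhs => rw [hf, hg]
      simp only [map_sum, map_smul, LinearMap.sum_apply, LinearMap.smul_apply, mulLin_mono,
        coeff_mono, smul_eq_mul]
      rw [Finset.sum_eq_single b, Finset.sum_eq_single a]
      · simp [mul_left_comm]
      · intro a' ha' hne
        rw [if_neg fun h => hne (hu ha' hb h).1]
        simp
      · exact fun h => absurd ha h
      · intro b' hb' hne
        refine mul_eq_zero_of_right _ (Finset.sum_eq_zero fun a' ha' => ?_)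
        rw [if_neg fun h => hne (hu ha' hb' h).2]
        simp
      · exact fun h => absurd hb h
    rw [hfg, map_zero] at key
    exact mul_ne_zero (hs a ha) (mul_ne_zero (ht b hb) (Units.ne_zero _)) key.symm

instance : Nontrivial (QTorus Q) := by
  refine ⟨0, 1, fun h => ?_⟩
  have := congrArg (coeff (Q := Q) 0) h
  rw [map_zero, one_def, coeff_mono, if_pos rfl] at this
  exact zero_ne_one this

theorem isUnit_mono (a : Fin n → ℤ) : IsUnit (mono Q a) := by
  have e1 : mono Q a * ((torusCocycle Q a (-a) : K)⁻¹ • mono Q (-a)) = 1 := by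
    rw [mul_smul_comm, mono_mul_mono, smul_smul, inv_mul_cancel₀ (Units.ne_zero _), one_smul,
      add_neg_cancel, one_def]
  have e2 : ((torusCocycle Q (-a) a : K)⁻¹ • mono Q (-a)) * mono Q a = 1 := by
    rw [smul_mul_assoc, mono_mul_mono, smul_smul, inv_mul_cancel₀ (Units.ne_zero _), one_smul,
      neg_add_cancel, one_def]
  have e3 := left_inv_eq_right_inv e2 e1
  exact ⟨⟨_, _, e1, e3 ▸ e2⟩, rfl⟩

end QTorus

/-! ### Ideals and the rank one subalgebra -/

open Polynomial in
/-- The polynomials `P` with `P(t) w ∈ I`. -/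
noncomputable def TwoSidedIdeal.polyIdeal {K S : Type*} [Field K] [Ring S] [Algebra K S]
    (I : TwoSidedIdeal S) (t w : S) : Ideal K[X] where
  carrier := {P | aeval t P * w ∈ I}
  add_mem' {P Q} hP hQ := by simpa [add_mul] using I.add_mem hP hQ
  zero_mem' := by simp [I.zero_mem]
  smul_mem' P Q hQ := by
    simpa [mul_assoc] using I.mul_mem_left (aeval t P) _ hQ

open Polynomial in
theorem TwoSidedIdeal.mem_polyIdeal {K S : Type*} [Field K] [Ring S] [Algebra K S]
    {I : TwoSidedIdeal S} {t w : S} {P : K[X]} : P ∈ I.polyIdeal t w ↔ aeval t P * w ∈ I :=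
  Iff.rfl

open Polynomial in
theorem aeval_mul_comm_of_central {K S : Type*} [Field K] [Ring S] [Algebra K S] {z : S}
    (hz : ∀ w, z * w = w * z) (P : K[X]) (w : S) : aeval z P * w = w * aeval z P := by
  induction P using Polynomial.induction_on' with
  | add P Q hP hQ => rw [map_add, add_mul, mul_add, hP, hQ]
  | monomial n a =>
    have : Commute (z ^ n) w := (show Commute _ _ from hz w).pow_left n
    rw [aeval_monomial, mul_assoc, this.eq, ← mul_assoc, ← mul_assoc, Algebra.commutes]

/-- The relations between `x`, `y`, the Casimir element `z` and an invertible element `t` in an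
ambiskew polynomial algebra with splitting element `s t⁻¹ + c t`, where `α(t) = q⁻¹ t`.
They are symmetric under the exchange of `x` and `y`, see `RankOneRelations.swap`. -/
structure RankOneRelations {K S : Type*} [Field K] [Ring S] [Algebra K S] (q s c : K)
    (x y z t t' : S) : Prop where
  zpow_ne_one : ∀ k : ℤ, k ≠ 0 → q ^ k ≠ 1
  q_ne_zero : q ≠ 0
  c_ne_zero : c ≠ 0
  t_mul_t' : t * t' = 1
  t'_mul_t : t' * t = 1
  z_mul : ∀ w, z * w = w * z
  y_mul_t : y * t = q⁻¹ • (t * y)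
  x_mul_t : x * t = q • (t * x)
  x_mul_y : x * y = z + s • t' + c • t
  y_mul_x : y * x = z + (q * s) • t' + (q⁻¹ * c) • t

/-- The polynomial with the simple roots `q⁻ˡ μ`, for `l ∈ F`. -/
noncomputable def rootPoly {K : Type*} [Field K] (q μ : K) (F : Finset ℕ) : Polynomial K :=
  ∏ l ∈ F, (Polynomial.X - Polynomial.C (q ^ (-(l : ℤ)) * μ))

namespace RankOneRelations

open Polynomial

variable {K S : Type*} [Field K] [Ring S] [Algebra K S] {q s c : K} {x y z t t' : S}

theorem swap (h : RankOneRelations q s c x y z t t') :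
    RankOneRelations q⁻¹ (q * s) (q⁻¹ * c) y x z t t' where
  zpow_ne_one k hk := by
    rw [inv_zpow']
    exact h.zpow_ne_one _ (neg_ne_zero.2 hk)
  q_ne_zero := inv_ne_zero h.q_ne_zero
  c_ne_zero := mul_ne_zero (inv_ne_zero h.q_ne_zero) h.c_ne_zero
  t_mul_t' := h.t_mul_t'
  t'_mul_t := h.t'_mul_t
  z_mul := h.z_mul
  y_mul_t := by rw [inv_inv, h.x_mul_t]
  x_mul_t := h.y_mul_t
  x_mul_y := h.y_mul_x
  y_mul_x := by
    rw [inv_inv, inv_mul_cancel_left₀ h.q_ne_zero, mul_inv_cancel_left₀ h.q_ne_zero, h.x_mul_y]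

theorem zpow_injective (h : RankOneRelations q s c x y z t t') {i j : ℤ} (hij : q ^ i = q ^ j) :
    i = j := by
  by_contra hne
  refine h.zpow_ne_one (i - j) (sub_ne_zero.2 hne) ?_
  rw [zpow_sub₀ h.q_ne_zero, hij, div_self (zpow_ne_zero _ h.q_ne_zero)]

theorem y_mul_t' (h : RankOneRelations q s c x y z t t') : y * t' = q • (t' * y) := by
  have h1 : y = q⁻¹ • (t * y * t') := by
    rw [← smul_mul_assoc, ← h.y_mul_t, mul_assoc, h.t_mul_t', mul_one]
  have h2 : t' * y = q⁻¹ • (y * t') := by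
    conv_lhs => rw [h1]
    rw [mul_smul_comm, ← mul_assoc, ← mul_assoc, h.t'_mul_t, one_mul]
  rw [h2, smul_smul, mul_inv_cancel₀ h.q_ne_zero, one_smul]

theorem y_mul_aeval (h : RankOneRelations q s c x y z t t') (P : K[X]) :
    y * aeval t P = aeval t (P.comp (C q⁻¹ * X)) * y := by
  induction P using Polynomial.induction_on' with
  | add P Q hP hQ => simp only [map_add, mul_add, add_mul, hP, hQ, add_comp]
  | monomial n a =>
    have hn : y * t ^ n = (q⁻¹ ^ n) • (t ^ n * y) := by
      induction n with
      | zero => simp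
      | succ n ih =>
        rw [pow_succ, ← mul_assoc, ih, smul_mul_assoc, mul_assoc, h.y_mul_t, mul_smul_comm,
          smul_smul, ← mul_assoc, ← pow_succ, ← pow_succ]
    rw [← C_mul_X_pow_eq_monomial]
    simp only [map_mul, aeval_C, map_pow, aeval_X, mul_comp, C_comp, X_pow_comp, mul_pow,
      Algebra.algebraMap_eq_smul_one, _root_.smul_pow, one_pow, smul_mul_assoc, one_mul,
      mul_smul_comm, hn]
    rw [smul_comm]

theorem y_pow_mul_t (h : RankOneRelations q s c x y z t t') (n : ℕ) :
    y ^ n * t = q⁻¹ ^ n • (t * y ^ n) := by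
  induction n with
  | zero => simp
  | succ n ih =>
    rw [pow_succ', mul_assoc, ih, mul_smul_comm, ← mul_assoc, h.y_mul_t, smul_mul_assoc, smul_smul,
      mul_assoc, ← pow_succ, ← pow_succ']

/-- `yⁿ⁺¹ x = (z + αⁿ⁺¹(u)) yⁿ`. -/
theorem y_pow_succ_mul_x (h : RankOneRelations q s c x y z t t') (n : ℕ) :
    y ^ (n + 1) * x = (z + (q ^ (n + 1) * s) • t' + ((q ^ (n + 1))⁻¹ * c) • t) * y ^ n := by
  induction n with
  | zero => simp [h.y_mul_x]
  | succ n ih =>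
    rw [pow_succ', mul_assoc, ih, ← mul_assoc, mul_add, mul_add, ← h.z_mul, mul_smul_comm,
      mul_smul_comm, h.y_mul_t, h.y_mul_t', smul_smul, smul_smul, ← smul_mul_assoc,
      ← smul_mul_assoc, ← add_mul, ← add_mul, mul_assoc, ← pow_succ']
    have e1 : q ^ (n + 1) * s * q = q ^ (n + 1 + 1) * s := by ring
    have e2 : (q ^ (n + 1))⁻¹ * c * q⁻¹ = (q ^ (n + 1 + 1))⁻¹ * c := by
      rw [pow_succ q (n + 1), mul_inv]; ring
    rw [e1, e2]

theorem x_mul_y_pow_succ (h : RankOneRelations q s c x y z t t') (n : ℕ) :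
    x * y ^ (n + 1) = (z + s • t' + c • t) * y ^ n := by
  rw [pow_succ', ← mul_assoc, h.x_mul_y]

/-- Elimination of `t` between `u + z` and `αⁿ⁺¹(u) + z` lowers the power of `y` by one. -/
theorem mul_resultant_mem (h : RankOneRelations q s c x y z t t') {I : TwoSidedIdeal S} {w : S}
    (hw : ∀ r, w * r = r * w) {n : ℕ} (hI : w * y ^ (n + 1) ∈ I) :
    w * (z ^ 2 - algebraMap K S (s * c * (q ^ (n + 1))⁻¹ * (q ^ (n + 1) + 1) ^ 2)) * y ^ n ∈ I := by
  have hQ1 : q ^ (n + 1) - 1 ≠ 0 := sub_ne_zero.2 fun e =>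
    h.zpow_ne_one (n + 1 : ℕ) (by positivity) (by rw [zpow_natCast]; exact e)
  have hQ0 : q ^ (n + 1) ≠ 0 := pow_ne_zero _ h.q_ne_zero
  have m1 : w * ((z + s • t' + c • t) * y ^ n) ∈ I := by
    rw [← h.x_mul_y_pow_succ, ← mul_assoc, hw, mul_assoc]
    exact I.mul_mem_left _ _ hI
  have m2 : w * ((z + (q ^ (n + 1) * s) • t' + ((q ^ (n + 1))⁻¹ * c) • t) * y ^ n) ∈ I := by
    rw [← h.y_pow_succ_mul_x, ← mul_assoc]
    exact I.mul_mem_right _ _ hI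
  generalize q ^ (n + 1) = Q at hQ1 hQ0 m1 m2 ⊢
  generalize hE1 : z + s • t' + c • t = E1 at m1
  generalize hE2 : z + (Q * s) • t' + (Q⁻¹ * c) • t = E2 at m2
  have key : (Q - 1) • (z ^ 2 - algebraMap K S (s * c * Q⁻¹ * (Q + 1) ^ 2)) =
      (z - (c * Q⁻¹ * (Q + 1)) • t) * (Q • E1 - E2) -
        (c * Q⁻¹ * (Q + 1) ^ 2) • (t * (E2 - E1)) := by
    rw [← hE1, ← hE2]
    simp only [mul_add, mul_sub, sub_mul, smul_add, smul_sub, mul_smul_comm, smul_mul_assoc,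
      h.t_mul_t', h.z_mul, Algebra.algebraMap_eq_smul_one, pow_two, smul_smul]
    match_scalars <;> field_simp <;> ring
  rw [← I.smul_mem_iff_of_ne_zero hQ1]
  have e : (Q - 1) • (w * (z ^ 2 - algebraMap K S (s * c * Q⁻¹ * (Q + 1) ^ 2)) * y ^ n) =
      (z - (c * Q⁻¹ * (Q + 1)) • t) * (Q • (w * (E1 * y ^ n)) - w * (E2 * y ^ n)) -
        (c * Q⁻¹ * (Q + 1) ^ 2) • (t * (w * (E2 * y ^ n) - w * (E1 * y ^ n))) := by
    rw [← smul_mul_assoc, ← mul_smul_comm, key, hw, hw, hw]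
    simp only [mul_sub, sub_mul, smul_mul_assoc, mul_assoc, hw, smul_sub, mul_smul_comm]
  rw [e]
  exact I.sub_mem (I.mul_mem_left _ _ (I.sub_mem (I.smul_mem_of_algebra _ m1) m2))
    (I.smul_mem_of_algebra _ (I.mul_mem_left _ _ (I.sub_mem m2 m1)))

/-- If `a` is not a zero of the resultant, then the power of `y` in an ideal over `z - a` may be
lowered. -/
theorem y_pow_mem_of_succ (h : RankOneRelations q s c x y z t t') {I : TwoSidedIdeal S} {a : K}
    (hz : z - algebraMap K S a ∈ I) {n : ℕ}
    (ha : a ^ 2 ≠ s * c * (q ^ (n + 1))⁻¹ * (q ^ (n + 1) + 1) ^ 2) (hI : y ^ (n + 1) ∈ I) :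
    y ^ n ∈ I := by
  have h1 := h.mul_resultant_mem (w := 1) (fun r => by simp) (by simpa using hI)
  rw [one_mul] at h1
  have h2 : (z ^ 2 - algebraMap K S (a ^ 2)) * y ^ n ∈ I := by
    refine I.mul_mem_right _ _ ?_
    have : z ^ 2 - algebraMap K S (a ^ 2) = (z + algebraMap K S a) * (z - algebraMap K S a) := by
      rw [map_pow, mul_sub, add_mul, add_mul, h.z_mul (algebraMap K S a)]
      simp only [pow_two]
      abel
    rw [this]
    exact I.mul_mem_left _ _ hz
  rw [← I.smul_mem_iff_of_ne_zero (sub_ne_zero.2 ha)]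
  have h3 := I.sub_mem h1 h2
  rw [← sub_mul, sub_sub_sub_cancel_left, ← map_sub, ← Algebra.smul_def] at h3
  exact h3

/-! ### The exceptional values of the Casimir element -/

section exceptional

variable {a μ : K} {m : ℕ}

/-- The exceptional value is not exceptional for another exponent. -/
theorem sq_ne_of_ne (h : RankOneRelations q s c x y z t t') (hμ : μ ≠ 0)
    (ha : a = -c * μ * (1 + q ^ (-(m : ℤ)))) (hs : s = c * q ^ (-(m : ℤ)) * μ ^ 2) {n : ℕ}
    (hn : n + 1 ≠ m) : a ^ 2 ≠ s * c * (q ^ (n + 1))⁻¹ * (q ^ (n + 1) + 1) ^ 2 := by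
  intro e
  have hQ0 : q ^ (n + 1) ≠ 0 := pow_ne_zero _ h.q_ne_zero
  have hm0 : q ^ m ≠ 0 := pow_ne_zero _ h.q_ne_zero
  have h1 : q ^ (n + 1) ≠ q ^ m := by
    intro e
    rw [← zpow_natCast, ← zpow_natCast] at e
    exact hn (by exact_mod_cast h.zpow_injective e)
  have h2 : q ^ (n + 1) * q ^ m ≠ 1 := by
    rw [← pow_add, ← zpow_natCast]
    exact h.zpow_ne_one _ (by positivity)
  rw [ha, hs, zpow_neg, zpow_natCast] at e
  generalize q ^ (n + 1) = Q at *
  generalize q ^ m = M at *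
  have hc := h.c_ne_zero
  field_simp at e
  have : (Q - M) * (Q * M - 1) = 0 := by linear_combination -e
  rcases mul_eq_zero.1 this with h | h
  · exact h1 (sub_eq_zero.1 h)
  · exact h2 (sub_eq_zero.1 h)

/-- For an exceptional value with exponent `m`, the descent of the powers of `y` is only obstructed
at `yᵐ`. -/
theorem y_pow_mem_of_pow_mem (h : RankOneRelations q s c x y z t t') (hμ : μ ≠ 0)
    (ha : a = -c * μ * (1 + q ^ (-(m : ℤ)))) (hs : s = c * q ^ (-(m : ℤ)) * μ ^ 2)
    {I : TwoSidedIdeal S} (hz : z - algebraMap K S a ∈ I) (n : ℕ) (hn : y ^ n ∈ I) :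
    y ^ m ∈ I := by
  rcases le_or_gt n m with hnm | hnm
  · rw [← Nat.sub_add_cancel hnm, pow_add]
    exact I.mul_mem_left _ _ hn
  · induction n, hnm using Nat.le_induction with
    | base => exact h.y_pow_mem_of_succ hz (h.sq_ne_of_ne hμ ha hs (by simp)) hn
    | succ n hmn ih =>
      exact ih (h.y_pow_mem_of_succ hz (h.sq_ne_of_ne hμ ha hs (by omega)) hn)

/-- In the exceptional case, `t (z + Q s t⁻¹ + Q⁻¹ c t)` factors modulo `z - a`. -/
theorem mul_factors_mem (h : RankOneRelations q s c x y z t t')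
    (ha : a = -c * μ * (1 + q ^ (-(m : ℤ)))) (hs : s = c * q ^ (-(m : ℤ)) * μ ^ 2)
    {I : TwoSidedIdeal S} (hz : z - algebraMap K S a ∈ I) {Q : K} (hQ : Q ≠ 0) {P : K[X]} {w : S}
    (hP : aeval t P * ((z + (Q * s) • t' + (Q⁻¹ * c) • t) * w) ∈ I) :
    P * ((X - C (Q * μ)) * (X - C (Q * q ^ (-(m : ℤ)) * μ))) ∈ I.polyIdeal t w := by
  have e1 : t * (z + (Q * s) • t' + (Q⁻¹ * c) • t) - t * (z - algebraMap K S a) =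
      (Q⁻¹ * c) • aeval t ((X - C (Q * μ)) * (X - C (Q * q ^ (-(m : ℤ)) * μ))) := by
    simp only [map_mul, map_sub, aeval_X, aeval_C, Algebra.algebraMap_eq_smul_one, mul_sub,
      sub_mul, mul_add, mul_smul_comm, smul_mul_assoc, one_mul, mul_one, h.t_mul_t', smul_sub,
      smul_smul, ha, hs]
    generalize q ^ (-(m : ℤ)) = N
    match_scalars <;> field_simp <;> ring
  have e2 : aeval t P * t = t * aeval t P := by
    have := congrArg (aeval t) (mul_comm P (X : K[X]))
    simpa using this
  have h1 := I.mul_mem_left t _ hP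
  rw [← mul_assoc, ← e2, mul_assoc, ← mul_assoc t] at h1
  have h2 : aeval t P * (t * (z - algebraMap K S a) * w) ∈ I :=
    I.mul_mem_left _ _ (I.mul_mem_right _ _ (I.mul_mem_left _ _ hz))
  have h3 := I.sub_mem h1 h2
  rw [← mul_sub, ← sub_mul, e1, smul_mul_assoc, mul_smul_comm,
    I.smul_mem_iff_of_ne_zero (mul_ne_zero (inv_ne_zero hQ) h.c_ne_zero), ← mul_assoc,
    ← map_mul] at h3
  exact h3

/-- The step from `yⁿ⁺¹` to `yⁿ` given by right multiplication by `x`. -/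
theorem mul_mem_polyIdeal (h : RankOneRelations q s c x y z t t')
    (ha : a = -c * μ * (1 + q ^ (-(m : ℤ)))) (hs : s = c * q ^ (-(m : ℤ)) * μ ^ 2)
    {I : TwoSidedIdeal S} (hz : z - algebraMap K S a ∈ I) {P : K[X]} {n : ℕ}
    (hP : P ∈ I.polyIdeal t (y ^ (n + 1))) :
    P * ((X - C (q ^ (n + 1) * μ)) * (X - C (q ^ (n + 1) * q ^ (-(m : ℤ)) * μ))) ∈
      I.polyIdeal t (y ^ n) := by
  refine h.mul_factors_mem ha hs hz (pow_ne_zero _ h.q_ne_zero) ?_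
  rw [← h.y_pow_succ_mul_x, ← mul_assoc]
  exact I.mul_mem_right _ _ hP

/-- The step from `yⁿ⁺¹` to `yⁿ` given by left multiplication by `x`. -/
theorem comp_mul_mem_polyIdeal (h : RankOneRelations q s c x y z t t')
    (ha : a = -c * μ * (1 + q ^ (-(m : ℤ)))) (hs : s = c * q ^ (-(m : ℤ)) * μ ^ 2)
    {I : TwoSidedIdeal S} (hz : z - algebraMap K S a ∈ I) {P : K[X]} {n : ℕ}
    (hP : P ∈ I.polyIdeal t (y ^ (n + 1))) :
    P.comp (C q * X) * ((X - C μ) * (X - C (q ^ (-(m : ℤ)) * μ))) ∈ I.polyIdeal t (y ^ n) := by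
  have := h.mul_factors_mem (I := I) (w := y ^ n) (P := P.comp (C q * X)) ha hs hz one_ne_zero ?_
  · simpa using this
  · have e := h.swap.y_mul_aeval P
    rw [inv_inv] at e
    rw [one_mul, inv_one, one_mul, ← h.x_mul_y_pow_succ, ← mul_assoc, ← e, mul_assoc]
    exact I.mul_mem_left _ _ hP

theorem rootPoly_succ_comp (hq : q ≠ 0) (j : ℕ) :
    (rootPoly q μ (Finset.range j)).comp (C q * X) * (X - C μ) =
      C (q ^ j) * rootPoly q μ (Finset.range (j + 1)) := by
  have e : (rootPoly q μ (Finset.range j)).comp (C q * X) =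
      C (q ^ j) * ∏ l ∈ Finset.range j, (X - C (q ^ (-((l + 1 : ℕ) : ℤ)) * μ)) := by
    have : C (q ^ j) = ∏ l ∈ Finset.range j, C q := by simp
    rw [rootPoly, prod_comp, this, ← Finset.prod_mul_distrib]
    refine Finset.prod_congr rfl fun l _ => ?_
    rw [sub_comp, X_comp, C_comp, mul_sub, ← C_mul]
    congr 2
    rw [← mul_assoc]
    congr 1
    rw [← zpow_one_add₀ hq]
    congr 1
    push_cast
    ring
  rw [e, rootPoly, Finset.prod_range_succ']
  simp [mul_assoc]

/-- If `yᵐ` lies in an ideal over `z - a`, for the exceptional value `a` with exponent `m`, then so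
does `∏_{l < j} (t - q⁻ˡ μ) yᵐ⁻ʲ`. -/
theorem rootPoly_mem (h : RankOneRelations q s c x y z t t') (hμ : μ ≠ 0)
    (ha : a = -c * μ * (1 + q ^ (-(m : ℤ)))) (hs : s = c * q ^ (-(m : ℤ)) * μ ^ 2)
    {I : TwoSidedIdeal S} (hz : z - algebraMap K S a ∈ I) (hI : y ^ m ∈ I) (j n : ℕ)
    (hj : n + j = m) : rootPoly q μ (Finset.range j) ∈ I.polyIdeal t (y ^ n) := by
  induction j generalizing n with
  | zero =>
    have : n = m := by omega
    subst this
    simpa [rootPoly, TwoSidedIdeal.mem_polyIdeal] using hI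
  | succ j ih =>
    have h0 := ih (n + 1) (by omega)
    have h1 := h.comp_mul_mem_polyIdeal ha hs hz h0
    have h2 := h.mul_mem_polyIdeal ha hs hz h0
    rw [← mul_assoc, rootPoly_succ_comp h.q_ne_zero, mul_assoc] at h1
    have hqj : q ^ j ≠ 0 := pow_ne_zero _ h.q_ne_zero
    have h1' := Ideal.mul_mem_left _ (C (q ^ j)⁻¹) h1
    rw [← mul_assoc, ← C_mul, inv_mul_cancel₀ hqj, C_1, one_mul] at h1'
    have e2 : rootPoly q μ (Finset.range (j + 1)) =
        rootPoly q μ (Finset.range j) * (X - C (q ^ (n + 1) * q ^ (-(m : ℤ)) * μ)) := by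
      rw [rootPoly, Finset.prod_range_succ, rootPoly]
      congr 4
      rw [← zpow_natCast, ← zpow_add₀ h.q_ne_zero]
      congr 1
      rw [← hj]
      push_cast
      ring
    rw [mul_comm (X - C (q ^ (n + 1) * μ)), ← mul_assoc, ← e2] at h2
    -- both steps give the required polynomial times a linear factor, and the roots of the two
    -- linear factors are different
    have h3 := Ideal.sub_mem _ h1' h2
    rw [← mul_sub, sub_sub_sub_cancel_left, ← C_sub] at h3
    have hne : q ^ (n + 1) * μ - q ^ (-(m : ℤ)) * μ ≠ 0 := by
      rw [← sub_mul]
      refine mul_ne_zero (sub_ne_zero.2 fun e => ?_) hμ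
      rw [← zpow_natCast] at e
      have := h.zpow_injective e
      push_cast at this
      omega
    have h4 := Ideal.mul_mem_right (C (q ^ (n + 1) * μ - q ^ (-(m : ℤ)) * μ)⁻¹) _ h3
    rwa [mul_assoc, ← C_mul, mul_inv_cancel₀ hne, C_1, mul_one] at h4

/-- The exchange of `x` and `y` replaces `μ` by `q¹⁻ᵐ μ` in the description of an exceptional
value. -/
theorem swap_exceptional (h : RankOneRelations q s c x y z t t')
    (ha : a = -c * μ * (1 + q ^ (-(m : ℤ)))) (hs : s = c * q ^ (-(m : ℤ)) * μ ^ 2) :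
    a = -(q⁻¹ * c) * (q ^ (1 - (m : ℤ)) * μ) * (1 + q⁻¹ ^ (-(m : ℤ))) ∧
      q * s = q⁻¹ * c * q⁻¹ ^ (-(m : ℤ)) * (q ^ (1 - (m : ℤ)) * μ) ^ 2 := by
  have hq := h.q_ne_zero
  have hm : q ^ m ≠ 0 := pow_ne_zero _ hq
  rw [ha, hs]
  simp only [zpow_neg, zpow_sub₀ hq, zpow_one, zpow_natCast, inv_pow, inv_inv]
  constructor
  · field_simp
    ring
  · field_simp

/-- The roots for the exchanged relations. -/
theorem swap_root (hq : q ≠ 0) {l : ℕ} (hl : l < m) :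
    q⁻¹ ^ (-(l : ℤ)) * (q ^ (1 - (m : ℤ)) * μ) = q ^ (-((m - 1 - l : ℕ) : ℤ)) * μ := by
  rw [inv_zpow', neg_neg, ← mul_assoc, ← zpow_add₀ hq]
  congr 2
  omega

theorem rootPoly_mem_x (h : RankOneRelations q s c x y z t t') (hμ : μ ≠ 0)
    (ha : a = -c * μ * (1 + q ^ (-(m : ℤ)))) (hs : s = c * q ^ (-(m : ℤ)) * μ ^ 2)
    {I : TwoSidedIdeal S} (hz : z - algebraMap K S a ∈ I) (hI : x ^ m ∈ I) {n : ℕ}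
    (hn : n ≤ m) : rootPoly q μ (Finset.Ico n m) ∈ I.polyIdeal t (x ^ n) := by
  obtain ⟨ha', hs'⟩ := h.swap_exceptional ha hs
  have := h.swap.rootPoly_mem (mul_ne_zero (zpow_ne_zero _ h.q_ne_zero) hμ) ha' hs' hz hI (m - n) n
    (by omega)
  convert this using 1
  rw [rootPoly, rootPoly, Finset.range_eq_Ico]
  refine Finset.prod_bij' (fun l _ => m - 1 - l) (fun l _ => m - 1 - l) ?_ ?_ ?_ ?_ ?_
  · intro l hl; rw [Finset.mem_Ico] at *; omega
  · intro l hl; rw [Finset.mem_Ico] at *; omega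
  · intro l hl; rw [Finset.mem_Ico] at *; omega
  · intro l hl; rw [Finset.mem_Ico] at *; omega
  · intro l hl
    rw [Finset.mem_Ico] at hl
    rw [swap_root h.q_ne_zero (by omega)]
    congr 5
    omega

/-- A proper ideal over `z - a` that contains the polynomial with the roots `q⁻ˡ μ`, `l < m`, in `t`
contains no other polynomials in `t` than its multiples: the polynomials in `t` that it contains
have a common zero among the `q⁻ˡ μ`, `l < m`, and multiplications by `x` and `y` on both sides show
that the set of these zeros is stable under `l ↦ l ± 1`. -/
theorem eval_eq_zero (h : RankOneRelations q s c x y z t t') (hμ : μ ≠ 0)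
    (ha : a = -c * μ * (1 + q ^ (-(m : ℤ)))) (hs : s = c * q ^ (-(m : ℤ)) * μ ^ 2)
    {I : TwoSidedIdeal S} (hz : z - algebraMap K S a ∈ I) (hI : I ≠ ⊤)
    (hf : rootPoly q μ (Finset.range m) ∈ I.polyIdeal t 1) {P : K[X]}
    (hP : P ∈ I.polyIdeal t 1) {l : ℕ} (hl : l < m) : P.eval (q ^ (-(l : ℤ)) * μ) = 0 := by
  have hq := h.q_ne_zero
  have hne : I.polyIdeal t 1 ≠ (⊤ : Ideal K[X]) := by
    rw [Ideal.ne_top_iff_one, TwoSidedIdeal.mem_polyIdeal]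
    simpa [TwoSidedIdeal.one_mem_iff] using hI
  have hinj : ∀ {i j : ℤ}, q ^ i * μ - q ^ j * μ = 0 → i = j := fun e =>
    h.zpow_injective (mul_right_cancel₀ hμ (sub_eq_zero.1 e))
  -- one of the roots is a common zero
  have hex : ∃ l < m, ∀ P ∈ I.polyIdeal t 1, P.eval (q ^ (-(l : ℤ)) * μ) = 0 := by
    obtain ⟨M, hM, hIM⟩ := Ideal.exists_le_maximal _ hne
    have hfM := hIM hf
    rw [rootPoly, hM.isPrime.prod_mem_iff] at hfM
    obtain ⟨l, hl, hlM⟩ := hfM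
    refine ⟨l, Finset.mem_range.1 hl, fun P hP => ?_⟩
    by_contra h0
    refine hM.ne_top (Ideal.eq_top_of_isUnit_mem _ ?_ (isUnit_C.2 (isUnit_iff_ne_zero.2 h0)))
    obtain ⟨Q, hQ⟩ := X_sub_C_dvd_sub_C_eval (a := q ^ (-(l : ℤ)) * μ) (p := P)
    have : C (P.eval (q ^ (-(l : ℤ)) * μ)) = P - (X - C (q ^ (-(l : ℤ)) * μ)) * Q := by
      rw [← hQ]; ring
    rw [this]
    exact M.sub_mem (hIM hP) (M.mul_mem_right _ hlM)
  have hup : ∀ l, l + 1 < m → (∀ P ∈ I.polyIdeal t 1, P.eval (q ^ (-(l : ℤ)) * μ) = 0) →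
      ∀ P ∈ I.polyIdeal t 1, P.eval (q ^ (-((l + 1 : ℕ) : ℤ)) * μ) = 0 := by
    intro l hl hv P hP
    have h1 : P.comp (C q⁻¹ * X) ∈ I.polyIdeal t (y ^ (0 + 1)) := by
      rw [TwoSidedIdeal.mem_polyIdeal, zero_add, pow_one, ← h.y_mul_aeval]
      refine I.mul_mem_left _ _ ?_
      simpa [TwoSidedIdeal.mem_polyIdeal] using hP
    have h2 := hv _ (by simpa using h.mul_mem_polyIdeal ha hs hz h1)
    simp only [eval_mul, eval_comp, eval_sub, eval_X, eval_C, mul_eq_zero] at h2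
    rcases h2 with h2 | h2 | h2
    · rw [← h2, ← mul_assoc, ← zpow_neg_one, ← zpow_add₀ hq]
      congr 3
      push_cast
      ring
    · have := hinj (i := -(l : ℤ)) (j := 1) (by simpa using h2)
      omega
    · have := hinj (i := -(l : ℤ)) (j := 1 - m) (by
        rw [zpow_sub₀ hq, zpow_one, zpow_natCast]
        simpa [div_eq_mul_inv] using h2)
      omega
  have hdown : ∀ l, l + 1 < m →
      (∀ P ∈ I.polyIdeal t 1, P.eval (q ^ (-((l + 1 : ℕ) : ℤ)) * μ) = 0) →
      ∀ P ∈ I.polyIdeal t 1, P.eval (q ^ (-(l : ℤ)) * μ) = 0 := by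
    intro l hl hv P hP
    have h1 : P ∈ I.polyIdeal t (y ^ (0 + 1)) := by
      rw [TwoSidedIdeal.mem_polyIdeal]
      refine I.mul_mem_right _ _ ?_
      simpa [TwoSidedIdeal.mem_polyIdeal] using hP
    have h2 := hv _ (by simpa using h.comp_mul_mem_polyIdeal ha hs hz h1)
    simp only [eval_mul, eval_comp, eval_sub, eval_X, eval_C, mul_eq_zero] at h2
    rcases h2 with h2 | h2 | h2
    · rw [← h2, ← mul_assoc, ← zpow_one_add₀ hq]
      congr 3
      push_cast
      ring
    · have := hinj (i := -((l + 1 : ℕ) : ℤ)) (j := 0) (by simpa using h2)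
      omega
    · have := hinj (i := -((l + 1 : ℕ) : ℤ)) (j := -m) (by simpa using h2)
      omega
  obtain ⟨l₀, hl₀, hv⟩ := hex
  have h0 : ∀ P ∈ I.polyIdeal t 1, P.eval (q ^ (-((0 : ℕ) : ℤ)) * μ) = 0 := by
    clear hl
    induction l₀ with
    | zero => exact hv
    | succ l₀ ih => exact ih (by omega) (hdown l₀ hl₀ hv)
  have hall : ∀ P ∈ I.polyIdeal t 1, P.eval (q ^ (-(l : ℤ)) * μ) = 0 := by
    induction l with
    | zero => exact h0
    | succ l ih => exact hup l hl (ih (by omega))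
  exact hall P hP

/-- The case of polynomials times `yⁿ` reduces to `n = 0` by right multiplications by `x`. -/
theorem eval_eq_zero_y (h : RankOneRelations q s c x y z t t') (hμ : μ ≠ 0)
    (ha : a = -c * μ * (1 + q ^ (-(m : ℤ)))) (hs : s = c * q ^ (-(m : ℤ)) * μ ^ 2)
    {I : TwoSidedIdeal S} (hz : z - algebraMap K S a ∈ I) (hI : I ≠ ⊤)
    (hf : rootPoly q μ (Finset.range m) ∈ I.polyIdeal t 1) {P : K[X]} {n : ℕ}
    (hP : P ∈ I.polyIdeal t (y ^ n)) {l : ℕ} (hl : l + n < m) :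
    P.eval (q ^ (-(l : ℤ)) * μ) = 0 := by
  have hinj : ∀ {i j : ℤ}, q ^ i * μ - q ^ j * μ = 0 → i = j := fun e =>
    h.zpow_injective (mul_right_cancel₀ hμ (sub_eq_zero.1 e))
  induction n generalizing P with
  | zero => exact h.eval_eq_zero hμ ha hs hz hI hf (by simpa using hP) (by omega)
  | succ n ih =>
    have h1 := ih (h.mul_mem_polyIdeal ha hs hz hP) (by omega)
    simp only [eval_mul, eval_sub, eval_X, eval_C, mul_eq_zero] at h1
    rcases h1 with h1 | h1 | h1
    · exact h1
    · rw [← zpow_natCast] at h1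
      have := hinj h1
      push_cast at this
      omega
    · rw [← zpow_natCast, ← zpow_add₀ h.q_ne_zero] at h1
      have := hinj h1
      push_cast at this
      omega

theorem eval_eq_zero_x (h : RankOneRelations q s c x y z t t') (hμ : μ ≠ 0)
    (ha : a = -c * μ * (1 + q ^ (-(m : ℤ)))) (hs : s = c * q ^ (-(m : ℤ)) * μ ^ 2)
    {I : TwoSidedIdeal S} (hz : z - algebraMap K S a ∈ I) (hI : I ≠ ⊤)
    (hf : rootPoly q μ (Finset.range m) ∈ I.polyIdeal t 1) {P : K[X]} {n : ℕ}
    (hP : P ∈ I.polyIdeal t (x ^ n)) {l : ℕ} (hn : n ≤ l) (hl : l < m) :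
    P.eval (q ^ (-(l : ℤ)) * μ) = 0 := by
  obtain ⟨ha', hs'⟩ := h.swap_exceptional ha hs
  have e : rootPoly q⁻¹ (q ^ (1 - (m : ℤ)) * μ) (Finset.range m) =
      rootPoly q μ (Finset.range m) := by
    rw [rootPoly, rootPoly, ← Finset.prod_range_reflect _ m]
    refine Finset.prod_congr rfl fun l hl => ?_
    rw [Finset.mem_range] at hl
    rw [swap_root h.q_ne_zero (by omega)]
    congr 5
    omega
  have := h.swap.eval_eq_zero_y (mul_ne_zero (zpow_ne_zero _ h.q_ne_zero) hμ) ha' hs' hz hI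
    (e ▸ hf) hP (l := m - 1 - l) (by omega)
  rw [swap_root h.q_ne_zero (by omega)] at this
  rw [← this]
  congr 4
  omega

end exceptional

end RankOneRelations

/-! ### The quantum torus `A` -/

theorem Finset.prod_zpow_eq_zpow_sum {G ι : Type*} [CommGroup G] (s : Finset ι) (f : ι → ℤ)
    (g : G) : ∏ i ∈ s, g ^ f i = g ^ ∑ i ∈ s, f i := by
  classical
  induction s using Finset.induction_on with
  | empty => simp
  | insert i s hi ih => rw [Finset.prod_insert hi, Finset.sum_insert hi, ih, zpow_add]

namespace QTorus

variable {K : Type*} [Field K] {n : ℕ} {Q : Fin n → Fin n → Kˣ}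

theorem cocycle_single_left (k : Fin n) (a : Fin n → ℤ) :
    torusCocycle Q (Pi.single k 1) a = ∏ j, if j < k then Q k j ^ a j else 1 := by
  rw [torusCocycle, Finset.prod_eq_single k]
  · simp
  · intro i _ hi
    simp [Pi.single_eq_of_ne hi]
  · simp

theorem cocycle_single_right (k : Fin n) (a : Fin n → ℤ) :
    torusCocycle Q a (Pi.single k 1) = ∏ i, if k < i then Q i k ^ a i else 1 := by
  refine Finset.prod_congr rfl fun i _ => ?_
  rw [Finset.prod_eq_single k]
  · simp
  · intro j _ hj
    simp [Pi.single_eq_of_ne hj]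
  · simp

end QTorus

namespace TorusExample

open QTorus

variable {K : Type*} [Field K] {p : ℕ} {hp : Odd p} {q : Kˣ}

/-- The exponent `w` in `z_k z^a = q^w z^a z_k`. -/
def wt (k : Fin p) (a : Fin p → ℤ) : ℤ :=
  if Even (k.val + 1) then -∑ j, (if j < k ∧ Odd (j.val + 1) then a j else 0)
  else ∑ i, (if k < i ∧ Even (i.val + 1) then a i else 0)

/-- The exponent `w` in `z^a = q^w α(z^a)`. -/
def oddSum (a : Fin p → ℤ) : ℤ := ∑ i, if Even (i.val + 1) then 0 else a i

theorem gen_mul_mono (k : Fin p) (a : Fin p → ℤ) :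
    ((gen (qMatrix p q) k : (A p q)ˣ) : A p q) * mono _ a =
      ((q ^ wt k a : Kˣ) : K) • (mono _ a * ((gen (qMatrix p q) k : (A p q)ˣ) : A p q)) := by
  have e : torusCocycle (qMatrix p q) (Pi.single k 1) a =
      q ^ wt k a * torusCocycle (qMatrix p q) a (Pi.single k 1) := by
    rw [cocycle_single_left, cocycle_single_right, wt]
    by_cases hk : Even (k.val + 1)
    · have h2 : ∏ i, (if k < i then qMatrix p q i k ^ a i else 1) = 1 := by
        refine Finset.prod_eq_one fun i _ => ?_
        have : ¬ Odd (k.val + 1) := Nat.not_odd_iff_even.2 hk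
        simp [qMatrix, this]
      rw [h2, mul_one, if_pos hk, ← Finset.sum_neg_distrib, ← Finset.prod_zpow_eq_zpow_sum]
      refine Finset.prod_congr rfl fun j _ => ?_
      by_cases h1 : j < k <;> by_cases h2 : Odd (j.val + 1) <;> simp [qMatrix, hk, h1, h2]
    · have h2 : ∏ j, (if j < k then qMatrix p q k j ^ a j else 1) = 1 := by
        refine Finset.prod_eq_one fun i _ => ?_
        simp [qMatrix, hk]
      rw [h2, if_neg hk, ← Finset.prod_zpow_eq_zpow_sum, ← Finset.prod_mul_distrib]
      symm
      refine Finset.prod_eq_one fun i _ => ?_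
      have hk' : Odd (k.val + 1) := Nat.not_even_iff_odd.1 hk
      by_cases h1 : k < i <;> by_cases h2 : Even (i.val + 1) <;> simp [qMatrix, hk', h1, h2]
  have e1 : ((gen (qMatrix p q) k : (A p q)ˣ) : A p q) = mono _ (Pi.single k 1) := rfl
  rw [e1, mono_mul_mono, mono_mul_mono, smul_smul, ← Units.val_mul, e, add_comm]

theorem α_mono (a : Fin p → ℤ) :
    α p q (mono _ a) = ((q ^ (-oddSum a) : Kˣ) : K) • mono _ a := by
  have h := scaleLin_mono (qMatrix p q) (fun i => if Even (i.val + 1) then 1 else q⁻¹) a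
  have e : (∏ i : Fin p, (if Even (i.val + 1) then 1 else q⁻¹) ^ a i) = q ^ (-oddSum a) := by
    rw [oddSum, ← Finset.sum_neg_distrib, ← Finset.prod_zpow_eq_zpow_sum]
    refine Finset.prod_congr rfl fun i _ => ?_
    split_ifs <;> simp
  rw [e] at h
  exact h

theorem α_symm_mono (a : Fin p → ℤ) :
    (α p q).symm (mono _ a) = ((q ^ oddSum a : Kˣ) : K) • mono _ a := by
  rw [AlgEquiv.symm_apply_eq, map_smul, α_mono, smul_smul, ← Units.val_mul, zpow_neg,
    mul_inv_cancel, Units.val_one, one_smul]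

theorem oddSum_single (k : Fin p) (c : ℤ) :
    oddSum (Pi.single k c) = if Even (k.val + 1) then 0 else c := by
  rw [oddSum, Finset.sum_eq_single k]
  · simp
  · intro i _ hi
    simp [Pi.single_eq_of_ne hi]
  · simp

theorem α_zp : α p q (zp p hp q : A p q) = (q : K)⁻¹ • (zp p hp q : A p q) := by
  have : ¬ Even (p - 1 + 1) := by
    rw [Nat.sub_add_cancel hp.pos]
    exact Nat.not_even_iff_odd.2 hp
  have h := α_mono (p := p) (q := q) (Pi.single ⟨p - 1, by have := hp.pos; omega⟩ 1)
  rw [oddSum_single, if_neg this, zpow_neg_one, Units.val_inv_eq_inv_val] at h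
  exact h

theorem α_zp_inv : α p q (((zp p hp q)⁻¹ : (A p q)ˣ) : A p q) =
    (q : K) • (((zp p hp q)⁻¹ : (A p q)ˣ) : A p q) := by
  have : ¬ Even (p - 1 + 1) := by
    rw [Nat.sub_add_cancel hp.pos]
    exact Nat.not_even_iff_odd.2 hp
  have h := α_mono (p := p) (q := q) (Pi.single ⟨p - 1, by have := hp.pos; omega⟩ (-1))
  rw [oddSum_single, if_neg this, neg_neg, zpow_one] at h
  exact h

/-- The total weight: conjugation by `z_k` multiplies `z^a Y^(n)` by `q` to this power. -/
def totalWt (k : Fin p) (g : (Fin p → ℤ) × ℤ) : ℤ :=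
  wt k g.1 + if Even (k.val + 1) then 0 else g.2

theorem wt_sub (k : Fin p) (a b : Fin p → ℤ) : wt k (a - b) = wt k a - wt k b := by
  have (P : Fin p → Prop) [DecidablePred P] : ∑ j, (if P j then (a - b) j else 0) =
      ∑ j, (if P j then a j else 0) - ∑ j, (if P j then b j else 0) := by
    rw [← Finset.sum_sub_distrib]
    refine Finset.sum_congr rfl fun j _ => ?_
    split_ifs <;> simp
  simp only [wt, this]
  split_ifs
  · ring
  · rfl

theorem eq_zero_of_wt (b : Fin p → ℤ) (hp : Odd p) (h : ∀ k, wt k b = 0) (i : Fin p)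
    (hi : i.val ≠ p - 1) : b i = 0 := by
  obtain ⟨i, hip⟩ := i
  have hp2 : p % 2 = 1 := Nat.odd_iff.1 hp
  simp only at hi
  simp only [wt, Nat.even_iff, Nat.odd_iff] at h
  rcases Nat.mod_two_eq_zero_or_one i with h2 | h2
  · -- the partial sums over the odd generators before `z_{i+1}` and before `z_{i+3}` vanish
    have hS1 : ∑ j : Fin p, (if j.val < i ∧ (j.val + 1) % 2 = 1 then b j else 0) = 0 := by
      rcases Nat.eq_zero_or_pos i with rfl | hpos
      · simp
      · have := h ⟨i - 1, by omega⟩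
        rw [if_pos (by simp only; omega), neg_eq_zero] at this
        refine (Finset.sum_congr rfl fun j _ => ?_).trans this
        refine if_congr ?_ rfl rfl
        simp only [Fin.lt_def]
        omega
    have hS2 : ∑ j : Fin p, (if j.val < i + 1 ∧ (j.val + 1) % 2 = 1 then b j else 0) = 0 := by
      have := h ⟨i + 1, by omega⟩
      rw [if_pos (by simp only; omega), neg_eq_zero] at this
      exact this
    rw [← sub_eq_zero.2 (hS2.trans hS1.symm), ← Finset.sum_sub_distrib,
      Finset.sum_eq_single ⟨i, hip⟩]
    · rw [if_pos (by simp only; omega), if_neg (by simp), sub_zero]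
    · intro j _ hj
      have hj' : j.val ≠ i := fun e => hj (Fin.ext e)
      rw [sub_eq_zero]
      exact if_congr (by omega) rfl rfl
    · simp
  · -- the partial sums over the even generators after `z_i` and after `z_{i+2}` vanish
    have hS1 : ∑ j : Fin p, (if i < j.val ∧ (j.val + 1) % 2 = 0 then b j else 0) = 0 := by
      have := h ⟨i + 1, by omega⟩
      rw [if_neg (by simp only; omega)] at this
      refine (Finset.sum_congr rfl fun j _ => ?_).trans this
      refine if_congr ?_ rfl rfl
      simp only [Fin.lt_def]
      omega
    have hS2 : ∑ j : Fin p, (if i - 1 < j.val ∧ (j.val + 1) % 2 = 0 then b j else 0) = 0 := by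
      have := h ⟨i - 1, by omega⟩
      rw [if_neg (by simp only; omega)] at this
      exact this
    rw [← sub_eq_zero.2 (hS2.trans hS1.symm), ← Finset.sum_sub_distrib,
      Finset.sum_eq_single ⟨i, hip⟩]
    · rw [if_pos (by simp only; omega), if_neg (by simp), sub_zero]
    · intro j _ hj
      have hj' : j.val ≠ i := fun e => hj (Fin.ext e)
      rw [sub_eq_zero]
      exact if_congr (by omega) rfl rfl
    · simp

/-- The weights for conjugation by the `z_k` determine the degree in `Y` and all exponents except
that of the central generator `z_p`. -/
theorem eq_of_totalWt (hp : Odd p) {g g' : (Fin p → ℤ) × ℤ}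
    (h : ∀ k, totalWt k g = totalWt k g') :
    g.2 = g'.2 ∧ ∀ i : Fin p, i.val ≠ p - 1 → g.1 i = g'.1 i := by
  have hp2 : p % 2 = 1 := Nat.odd_iff.1 hp
  have hlast : ∀ a : Fin p → ℤ, wt ⟨p - 1, by omega⟩ a = 0 := by
    intro a
    rw [wt, if_neg (by rw [Nat.even_iff]; simp only; omega)]
    refine Finset.sum_eq_zero fun i _ => if_neg ?_
    rw [Fin.lt_def]
    simp only
    omega
  have h2 : g.2 = g'.2 := by
    have := h ⟨p - 1, by omega⟩
    rw [totalWt, totalWt, hlast, hlast, if_neg (by rw [Nat.even_iff]; simp only; omega),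
      if_neg (by rw [Nat.even_iff]; simp only; omega), zero_add, zero_add] at this
    exact this
  refine ⟨h2, fun i hi => ?_⟩
  have := eq_zero_of_wt (g.1 - g'.1) hp (fun k => ?_) i hi
  · exact sub_eq_zero.1 this
  · have := h k
    rw [totalWt, totalWt, h2] at this
    rw [wt_sub, sub_eq_zero]
    exact add_right_cancel this

theorem oddSum_injective (hp : Odd p) {a b : Fin p → ℤ}
    (h : ∀ i : Fin p, i.val ≠ p - 1 → a i = b i) (hab : oddSum a = oddSum b) : a = b := by
  have hp2 : p % 2 = 1 := Nat.odd_iff.1 hp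
  have hl : p - 1 < p := by omega
  have key : a ⟨p - 1, hl⟩ = b ⟨p - 1, hl⟩ := by
    rw [oddSum, oddSum, ← sub_eq_zero, ← Finset.sum_sub_distrib,
      Finset.sum_eq_single ⟨p - 1, hl⟩] at hab
    · rw [if_neg (by rw [Nat.even_iff]; simp only; omega),
        if_neg (by rw [Nat.even_iff]; simp only; omega)] at hab
      exact sub_eq_zero.1 hab
    · intro i _ hi
      rw [h i fun e => hi (Fin.ext e), sub_self]
    · simp
  funext i
  by_cases hi : i.val = p - 1
  · have : i = ⟨p - 1, hl⟩ := Fin.ext hi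
    rw [this, key]
  · exact h i hi

/-! ### Generators of the ambiskew polynomial algebra -/

variable (p hp q) in
/-- The inclusion of the quantum torus `A` into `R`. -/
noncomputable def incl : A p q →ₐ[K] R p hp q := Ambiskew.ofBase (α p q) (v p hp q) 1

variable (p hp q) in
/-- The generator `x` of `R`. -/
noncomputable def genX : R p hp q := Ambiskew.x (α p q) (v p hp q) 1

variable (p hp q) in
/-- The generator `y` of `R`. -/
noncomputable def genY : R p hp q := Ambiskew.y (α p q) (v p hp q) 1

theorem genY_mul_incl (a : A p q) :
    genY p hp q * incl p hp q a = incl p hp q (α p q a) * genY p hp q :=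
  Ambiskew.y_mul_ofBase _ _ _ a

theorem genX_mul_incl (a : A p q) :
    genX p hp q * incl p hp q a = incl p hp q ((α p q).symm a) * genX p hp q :=
  Ambiskew.x_mul_ofBase _ _ _ a

theorem α_u : α p q (u p hp q) = u p hp q - (v p hp q : A p q) := by
  have hq : (q : K) ≠ 0 := q.ne_zero
  have e : (v p hp q : A p q) = (1 - (q : K)) •
      (((q : K) ^ ((p - 1) / 2)) • (((zp p hp q)⁻¹ : (A p q)ˣ) : A p q) -
        (zp p hp q : A p q)) := rfl
  rw [e, u, map_add, map_smul, map_smul, α_zp, α_zp_inv]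
  match_scalars
  · ring
  · field_simp
    ring

theorem u_mem_center : u p hp q ∈ Subalgebra.center K (A p q) :=
  Subalgebra.add_mem _ (Subalgebra.smul_mem _ (zp_inv_mem_center p hp q) _)
    (Subalgebra.smul_mem _ (zp_mem_center p hp q) _)

theorem genX_mul_genY : genX p hp q * genY p hp q = z p hp q + incl p hp q (u p hp q) :=
  (sub_add_cancel _ _).symm

theorem genY_mul_genX :
    genY p hp q * genX p hp q = z p hp q + incl p hp q (α p q (u p hp q)) := by
  have h := Ambiskew.x_mul_y (α p q) (v p hp q) 1
  rw [one_smul] at h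
  rw [α_u, map_sub, ← add_sub_assoc, ← genX_mul_genY]
  exact eq_sub_of_add_eq h.symm

@[elab_as_elim]
theorem R_induction {P : R p hp q → Prop} (w : R p hp q) (h0 : P 0)
    (hadd : ∀ f g, P f → P g → P (f + g))
    (hm : ∀ a i j, P (incl p hp q a * genY p hp q ^ i * genX p hp q ^ j)) : P w :=
  Ambiskew.induction_on w h0 hadd hm

theorem z_mul (w : R p hp q) : z p hp q * w = w * z p hp q := by
  have hz : z p hp q = genX p hp q * genY p hp q - incl p hp q (u p hp q) := rfl
  have ha : ∀ a, Commute (z p hp q) (incl p hp q a) := by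
    intro a
    have hu := Subalgebra.mem_center_iff.1 (u_mem_center (hp := hp) (q := q)) a
    rw [Commute, SemiconjBy, hz, sub_mul, mul_sub, mul_assoc, genY_mul_incl, ← mul_assoc,
      genX_mul_incl, AlgEquiv.symm_apply_apply, mul_assoc, ← map_mul, ← map_mul, hu]
  have hy : Commute (z p hp q) (genY p hp q) := by
    have h1 : genY p hp q * genX p hp q = genX p hp q * genY p hp q -
        incl p hp q (u p hp q) + incl p hp q (α p q (u p hp q)) := genY_mul_genX
    rw [Commute, SemiconjBy, hz, sub_mul, mul_sub, genY_mul_incl, ← mul_assoc, h1]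
    noncomm_ring
  have hx : Commute (z p hp q) (genX p hp q) := by
    have h1 : genY p hp q * genX p hp q = genX p hp q * genY p hp q -
        incl p hp q (u p hp q) + incl p hp q (α p q (u p hp q)) := genY_mul_genX
    have h2 := genX_mul_incl (hp := hp) (α p q (u p hp q))
    rw [AlgEquiv.symm_apply_apply] at h2
    rw [Commute, SemiconjBy, hz, sub_mul, mul_sub, mul_assoc, h1, mul_add, mul_sub, h2]
    abel
  refine R_induction w (by simp) (fun f g hf hg => by rw [mul_add, add_mul, hf, hg])
    fun a i j => ?_
  exact ((ha a).mul_right (hy.pow_right i)).mul_right (hx.pow_right j)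

/-- The subalgebra generated by `x`, `y` and `z_p^{±1}` is an ambiskew polynomial algebra over the
Laurent polynomials. -/
theorem rankOne (hq : ∀ n : ℕ, 0 < n → q ^ n ≠ 1) :
    RankOneRelations (q : K) ((q : K) ^ ((p - 1) / 2)) (q : K) (genX p hp q) (genY p hp q)
      (z p hp q) (incl p hp q (zp p hp q)) (incl p hp q (((zp p hp q)⁻¹ : (A p q)ˣ) : A p q)) where
  zpow_ne_one k hk := by
    rw [← Units.val_zpow_eq_zpow_val, Ne, Units.val_eq_one]
    intro h
    rcases Int.natAbs_eq k with e | e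
    · rw [e, zpow_natCast] at h
      exact hq _ (Int.natAbs_pos.2 hk) h
    · rw [e, zpow_neg, inv_eq_one, zpow_natCast] at h
      exact hq _ (Int.natAbs_pos.2 hk) h
  q_ne_zero := q.ne_zero
  c_ne_zero := q.ne_zero
  t_mul_t' := by rw [← map_mul, Units.mul_inv, map_one]
  t'_mul_t := by rw [← map_mul, Units.inv_mul, map_one]
  z_mul := z_mul
  y_mul_t := by rw [genY_mul_incl, α_zp, map_smul, smul_mul_assoc]
  x_mul_t := by
    have : (α p q).symm (zp p hp q : A p q) = (q : K) • (zp p hp q : A p q) := by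
      rw [AlgEquiv.symm_apply_eq, map_smul, α_zp, smul_smul, mul_inv_cancel₀ q.ne_zero, one_smul]
    rw [genX_mul_incl, this, map_smul, smul_mul_assoc]
  x_mul_y := by rw [genX_mul_genY, u, map_add, map_smul, map_smul, add_assoc]
  y_mul_x := by
    rw [genY_mul_genX, u, map_add, map_smul, map_smul, α_zp, α_zp_inv, smul_smul, smul_smul,
      map_add, map_smul, map_smul, add_assoc, mul_comm (q : K), mul_comm (q : K)]

end TorusExample

/-! ### The basis of `R` over the polynomials in the Casimir element -/

namespace TorusExample

open QTorus Polynomial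

variable {K : Type*} [Field K] {p : ℕ} {hp : Odd p} {q : Kˣ}

variable (p hp q) in
/-- `Y^(n)`, that is, `yⁿ` for `n ≥ 0` and `x⁻ⁿ` for `n < 0`. -/
noncomputable def genPow (n : ℤ) : R p hp q :=
  if 0 ≤ n then genY p hp q ^ n.toNat else genX p hp q ^ (-n).toNat

theorem genPow_natCast (n : ℕ) : genPow p hp q n = genY p hp q ^ n := by simp [genPow]

theorem genPow_neg_natCast (n : ℕ) : genPow p hp q (-n) = genX p hp q ^ n := by
  rcases Nat.eq_zero_or_pos n with rfl | hn
  · simp [genPow]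
  · rw [genPow, if_neg (by omega)]
    simp

variable (p hp q) in
/-- The basis elements `z^a Y^(n)` of `R` over `K[z]`. -/
noncomputable def basisElt (g : (Fin p → ℤ) × ℤ) : R p hp q :=
  incl p hp q (mono _ g.1) * genPow p hp q g.2

variable (p hp q) in
/-- The combination of the basis elements with coefficients from `K[z]`. -/
noncomputable def comb : ((Fin p → ℤ) × ℤ →₀ K[X]) →ₗ[K] R p hp q :=
  Finsupp.lsum K fun g => LinearMap.mulRight K (basisElt p hp q g) ∘ₗ
    (aeval (z p hp q) : K[X] →ₐ[K] R p hp q).toLinearMap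

theorem comb_apply (c : (Fin p → ℤ) × ℤ →₀ K[X]) :
    comb p hp q c = ∑ g ∈ c.support, aeval (z p hp q) (c g) * basisElt p hp q g := rfl

theorem comb_single (g : (Fin p → ℤ) × ℤ) (P : K[X]) :
    comb p hp q (Finsupp.single g P) = aeval (z p hp q) P * basisElt p hp q g := by
  simp [comb]

theorem aeval_z_mul (P : K[X]) (w : R p hp q) :
    aeval (z p hp q) P * w = w * aeval (z p hp q) P :=
  aeval_mul_comm_of_central z_mul P w

theorem mul_mem_range_comb (T : R p hp q)
    (hT : ∀ g, T * basisElt p hp q g ∈ LinearMap.range (comb p hp q)) {w : R p hp q}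
    (hw : w ∈ LinearMap.range (comb p hp q)) : T * w ∈ LinearMap.range (comb p hp q) := by
  have haev : ∀ (P : K[X]) {w : R p hp q}, w ∈ LinearMap.range (comb p hp q) →
      aeval (z p hp q) P * w ∈ LinearMap.range (comb p hp q) := by
    rintro P _ ⟨c, rfl⟩
    rw [comb_apply, Finset.mul_sum]
    refine Submodule.sum_mem _ fun g _ => ⟨Finsupp.single g (P * c g), ?_⟩
    rw [comb_single, map_mul, mul_assoc]
  obtain ⟨c, rfl⟩ := hw
  rw [comb_apply, Finset.mul_sum]
  refine Submodule.sum_mem _ fun g _ => ?_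
  rw [← mul_assoc, ← aeval_z_mul, mul_assoc]
  exact haev _ (hT g)

theorem comb_surjective : Function.Surjective (comb p hp q) := by
  rw [← LinearMap.range_eq_top, Submodule.eq_top_iff']
  have hb : ∀ g, basisElt p hp q g ∈ LinearMap.range (comb p hp q) := fun g =>
    ⟨Finsupp.single g 1, by rw [comb_single, map_one, one_mul]⟩
  have hgen : ∀ n, genPow p hp q n ∈ LinearMap.range (comb p hp q) := fun n => by
    have := hb (0, n)
    rwa [basisElt, ← one_def, map_one, one_mul] at this
  have hz : ∀ n, z p hp q * genPow p hp q n ∈ LinearMap.range (comb p hp q) := fun n =>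
    ⟨Finsupp.single (0, n) X, by rw [comb_single, aeval_X, basisElt, ← one_def, map_one, one_mul]⟩
  have ha : ∀ (a : A p q) {w : R p hp q}, w ∈ LinearMap.range (comb p hp q) →
      incl p hp q a * w ∈ LinearMap.range (comb p hp q) := by
    intro a w hw
    refine QTorus.induction_on (P := fun a => incl p hp q a * w ∈ LinearMap.range (comb p hp q)) a
      (by simp) (fun f g hf hg => ?_) (fun c b => mul_mem_range_comb _ (fun g => ?_) hw)
    · rw [map_add, add_mul]
      exact Submodule.add_mem _ hf hg
    · rw [basisElt, ← mul_assoc, ← map_mul, smul_mul_assoc, mono_mul_mono, map_smul, map_smul,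
        smul_mul_assoc, smul_mul_assoc]
      exact Submodule.smul_mem _ _ (Submodule.smul_mem _ _ (hb (b + g.1, g.2)))
  have hy : ∀ {w : R p hp q}, w ∈ LinearMap.range (comb p hp q) →
      genY p hp q * w ∈ LinearMap.range (comb p hp q) := by
    refine mul_mem_range_comb _ fun g => ?_
    rw [basisElt, ← mul_assoc, genY_mul_incl, mul_assoc]
    refine ha _ ?_
    obtain ⟨n, hn | hn⟩ := Int.eq_nat_or_neg g.2
    · have := hgen (n + 1 : ℕ)
      rw [genPow_natCast] at this
      rwa [hn, genPow_natCast, ← pow_succ']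
    · rw [hn, genPow_neg_natCast]
      rcases n with _ | n
      · have := hgen (1 : ℕ)
        rw [genPow_natCast] at this
        simpa using this
      · rw [pow_succ', ← mul_assoc, genY_mul_genX, add_mul, ← genPow_neg_natCast]
        exact Submodule.add_mem _ (hz _) (ha _ (hgen _))
  have hx : ∀ {w : R p hp q}, w ∈ LinearMap.range (comb p hp q) →
      genX p hp q * w ∈ LinearMap.range (comb p hp q) := by
    refine mul_mem_range_comb _ fun g => ?_
    rw [basisElt, ← mul_assoc, genX_mul_incl, mul_assoc]
    refine ha _ ?_
    obtain ⟨n, hn | hn⟩ := Int.eq_nat_or_neg g.2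
    · rw [hn, genPow_natCast]
      rcases n with _ | n
      · have := hgen (-(1 : ℕ))
        rw [genPow_neg_natCast] at this
        simpa using this
      · rw [pow_succ', ← mul_assoc, genX_mul_genY, add_mul, ← genPow_natCast]
        exact Submodule.add_mem _ (hz _) (ha _ (hgen _))
    · have := hgen (-(n + 1 : ℕ))
      rw [genPow_neg_natCast] at this
      rwa [hn, genPow_neg_natCast, ← pow_succ']
  intro w
  refine R_induction w (Submodule.zero_mem _) (fun f g => Submodule.add_mem _) fun a i j => ?_
  have hpow : ∀ j, genX p hp q ^ j ∈ LinearMap.range (comb p hp q) := fun j =>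
    genPow_neg_natCast (hp := hp) (q := q) j ▸ hgen _
  rw [mul_assoc]
  refine ha _ ?_
  induction i with
  | zero => simpa using hpow j
  | succ i ih =>
    rw [pow_succ', mul_assoc]
    exact hy ih

/-! ### Two-sided ideals are graded -/

theorem gen_mul_basisElt (k : Fin p) (g : (Fin p → ℤ) × ℤ) :
    incl p hp q ((gen (qMatrix p q) k : (A p q)ˣ) : A p q) * basisElt p hp q g =
      ((q ^ totalWt k g : Kˣ) : K) •
        (basisElt p hp q g * incl p hp q ((gen (qMatrix p q) k : (A p q)ˣ) : A p q)) := by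
  have hy : ∀ n : ℕ, genY p hp q ^ n * incl p hp q ((gen (qMatrix p q) k : (A p q)ˣ) : A p q) =
      ((q ^ (-oddSum (Pi.single k 1) * n) : Kˣ) : K) •
        (incl p hp q ((gen (qMatrix p q) k : (A p q)ˣ) : A p q) * genY p hp q ^ n) := by
    intro n
    induction n with
    | zero => simp
    | succ n ih =>
      rw [pow_succ', mul_assoc, ih, mul_smul_comm, ← mul_assoc, genY_mul_incl]
      have : α p q ((gen (qMatrix p q) k : (A p q)ˣ) : A p q) =
        ((q ^ (-oddSum (Pi.single k 1)) : Kˣ) : K) •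
          ((gen (qMatrix p q) k : (A p q)ˣ) : A p q) := α_mono _
      rw [this, map_smul, smul_mul_assoc, smul_mul_assoc, smul_smul, ← Units.val_mul, ← zpow_add,
        mul_assoc]
      congr 3
      push_cast
      ring
  have hx : ∀ n : ℕ, genX p hp q ^ n * incl p hp q ((gen (qMatrix p q) k : (A p q)ˣ) : A p q) =
      ((q ^ (oddSum (Pi.single k 1) * n) : Kˣ) : K) •
        (incl p hp q ((gen (qMatrix p q) k : (A p q)ˣ) : A p q) * genX p hp q ^ n) := by
    intro n
    induction n with
    | zero => simp
    | succ n ih =>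
      rw [pow_succ', mul_assoc, ih, mul_smul_comm, ← mul_assoc, genX_mul_incl]
      have : (α p q).symm ((gen (qMatrix p q) k : (A p q)ˣ) : A p q) =
        ((q ^ (oddSum (Pi.single k 1)) : Kˣ) : K) •
          ((gen (qMatrix p q) k : (A p q)ˣ) : A p q) := α_symm_mono _
      rw [this, map_smul, smul_mul_assoc, smul_mul_assoc, smul_smul, ← Units.val_mul, ← zpow_add,
        mul_assoc]
      congr 3
      push_cast
      ring
  have hpow : ∀ n : ℤ,
      genPow p hp q n * incl p hp q ((gen (qMatrix p q) k : (A p q)ˣ) : A p q) =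
      ((q ^ (-oddSum (Pi.single k 1) * n) : Kˣ) : K) •
        (incl p hp q ((gen (qMatrix p q) k : (A p q)ˣ) : A p q) * genPow p hp q n) := by
    intro n
    obtain ⟨n, rfl | rfl⟩ := Int.eq_nat_or_neg n
    · rw [genPow_natCast, hy]
    · rw [genPow_neg_natCast, hx, neg_mul_neg]
  rw [basisElt, ← mul_assoc, ← map_mul, gen_mul_mono, map_smul, smul_mul_assoc, map_mul, mul_assoc,
    mul_assoc _ (genPow p hp q g.2), hpow, mul_smul_comm, smul_smul, ← Units.val_mul, ← zpow_add,
    totalWt, oddSum_single]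
  congr 3
  split_ifs <;> ring

/-- Two-sided ideals are homogeneous for the weights of the conjugations by the `z_k`. -/
theorem comb_filter_mem (I : TwoSidedIdeal (R p hp q)) {c : (Fin p → ℤ) × ℤ →₀ K[X]}
    (hc : comb p hp q c ∈ I) (g₀ : (Fin p → ℤ) × ℤ) (hq : ∀ k : ℤ, k ≠ 0 → (q : K) ^ k ≠ 1) :
    comb p hp q (c.filter fun g => ∀ k, totalWt k g = totalWt k g₀) ∈ I := by
  classical
  let N : Submodule K ((Fin p → ℤ) × ℤ → K) :=
    { carrier := {d | ∑ g ∈ c.support,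
        d g • (aeval (z p hp q) (c g) * basisElt p hp q g) ∈ I}
      add_mem' := fun {d d'} h h' => by
        simpa only [Set.mem_ofPred_eq, Pi.add_apply, add_smul, Finset.sum_add_distrib] using
          I.add_mem h h'
      zero_mem' := by
        simp only [Set.mem_ofPred_eq, Pi.zero_apply, zero_smul, Finset.sum_const_zero]
        exact I.zero_mem
      smul_mem' := fun a d h => by
        simpa only [Set.mem_ofPred_eq, Pi.smul_apply, smul_eq_mul, mul_smul, ← Finset.smul_sum]
          using I.smul_mem_of_algebra a h }
  have hinj : ∀ {i j : ℤ}, ((q ^ i : Kˣ) : K) = ((q ^ j : Kˣ) : K) → i = j := by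
    intro i j hij
    by_contra hne
    refine hq (i - j) (sub_ne_zero.2 hne) ?_
    rw [Units.val_zpow_eq_zpow_val, Units.val_zpow_eq_zpow_val] at hij
    rw [zpow_sub₀ q.ne_zero, hij, div_self (zpow_ne_zero _ q.ne_zero)]
  have h1 : (1 : (Fin p → ℤ) × ℤ → K) ∈ N := by
    change ∑ g ∈ c.support, (1 : (Fin p → ℤ) × ℤ → K) g •
      (aeval (z p hp q) (c g) * basisElt p hp q g) ∈ I
    rw [comb_apply] at hc
    simpa only [Pi.one_apply, one_smul] using hc
  obtain ⟨d, hd, hd1, hd0⟩ := N.exists_mem_restrict_of_mul_mem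
    (Set.range fun (k : Fin p) (g : (Fin p → ℤ) × ℤ) => ((q ^ totalWt k g : Kˣ) : K)) (by
      rintro _ ⟨k, rfl⟩ d hd
      have := I.mul_mem_right _ (incl p hp q (((gen (qMatrix p q) k)⁻¹ : (A p q)ˣ) : A p q))
        (I.mul_mem_left (incl p hp q ((gen (qMatrix p q) k : (A p q)ˣ) : A p q)) _ hd)
      rw [Finset.mul_sum, Finset.sum_mul] at this
      change ∑ g ∈ c.support, _ ∈ I
      refine Set.mem_of_eq_of_mem (Finset.sum_congr rfl fun g _ => ?_) this
      rw [mul_smul_comm, ← mul_assoc, ← aeval_z_mul, mul_assoc, gen_mul_basisElt, mul_smul_comm,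
        smul_smul, smul_mul_assoc, mul_assoc, mul_assoc, ← map_mul, Units.mul_inv, map_one,
        mul_one, Pi.mul_apply, mul_comm (d g)]) g₀ h1 c.support
  refine Set.mem_of_eq_of_mem ?_ hd
  rw [comb_apply, Finsupp.support_filter, Finset.sum_filter]
  refine Finset.sum_congr rfl fun g hg => ?_
  have hiff : (∀ d ∈ Set.range fun (k : Fin p) (g : (Fin p → ℤ) × ℤ) =>
      ((q ^ totalWt k g : Kˣ) : K), d g = d g₀) ↔ ∀ k, totalWt k g = totalWt k g₀ := by
    rw [Set.forall_mem_range]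
    exact ⟨fun h k => hinj (h k), fun h k => by simp only [h k]⟩
  split_ifs with h
  · rw [Finsupp.filter_apply_pos _ _ h, hd1 g (hiff.2 h), Pi.one_apply, one_smul]
  · rw [hd0 g hg (mt hiff.1 h), zero_smul]

/-- Multiplication by an element `V` on which the powers of `z_p` have different weights, such as
`y` and `x`, separates the coefficients that have the same degree. -/
theorem exists_aeval_mul_pow_mem (I : TwoSidedIdeal (R p hp q)) {c : (Fin p → ℤ) × ℤ →₀ K[X]}
    (hc : comb p hp q c ∈ I) (g₀ : (Fin p → ℤ) × ℤ) (hq : ∀ k : ℤ, k ≠ 0 → (q : K) ^ k ≠ 1)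
    (V : R p hp q) (χ : ℤ → K) (hχ : Function.Injective χ)
    (hV : ∀ a, V * incl p hp q (mono _ a) = χ (oddSum a) • (incl p hp q (mono _ a) * V))
    (n : ℕ) (hn : genPow p hp q g₀.2 = V ^ n) :
    ∃ N, aeval (z p hp q) (c g₀) * V ^ N ∈ I := by
  classical
  have hc' := comb_filter_mem I hc g₀ hq
  set c' := c.filter fun g => ∀ k, totalWt k g = totalWt k g₀ with hc'def
  have hcg : c' g₀ = c g₀ := Finsupp.filter_apply_pos _ _ fun _ => rfl
  by_cases h0 : c g₀ = 0
  · exact ⟨0, by rw [h0, map_zero, zero_mul]; exact I.zero_mem⟩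
  have hsupp : ∀ g ∈ c'.support, g.2 = g₀.2 ∧ ∀ i : Fin p, i.val ≠ p - 1 → g.1 i = g₀.1 i := by
    intro g hg
    rw [hc'def, Finsupp.support_filter, Finset.mem_filter] at hg
    exact eq_of_totalWt hp hg.2
  let f : (Fin p → ℤ) × ℤ → R p hp q := fun g =>
    aeval (z p hp q) (c' g) * incl p hp q (mono _ g.1)
  let N : Submodule K ((Fin p → ℤ) × ℤ → K) :=
    { carrier := {d | ∃ M : ℕ, (∑ g ∈ c'.support, d g • f g) * V ^ M ∈ I}
      add_mem' := by
        rintro d d' ⟨M, h⟩ ⟨M', h'⟩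
        refine ⟨M + M', ?_⟩
        simp only [Pi.add_apply, add_smul, Finset.sum_add_distrib, add_mul]
        refine I.add_mem ?_ ?_
        · rw [pow_add, ← mul_assoc]
          exact I.mul_mem_right _ _ h
        · rw [add_comm M, pow_add, ← mul_assoc]
          exact I.mul_mem_right _ _ h'
      zero_mem' := ⟨0, by
        simp only [Pi.zero_apply, zero_smul, Finset.sum_const_zero, zero_mul]
        exact I.zero_mem⟩
      smul_mem' := by
        rintro a d ⟨M, h⟩
        refine ⟨M, ?_⟩
        simp only [Pi.smul_apply, smul_eq_mul, mul_smul, ← Finset.smul_sum, smul_mul_assoc]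
        exact I.smul_mem_of_algebra a h }
  have h1 : (1 : (Fin p → ℤ) × ℤ → K) ∈ N := by
    refine ⟨n, ?_⟩
    refine Set.mem_of_eq_of_mem ?_ hc'
    rw [comb_apply, Finset.sum_mul]
    refine Finset.sum_congr rfl fun g hg => ?_
    rw [Pi.one_apply, one_smul, basisElt, (hsupp g hg).1, hn, mul_assoc]
  obtain ⟨d, ⟨M, hd⟩, hd1, hd0⟩ := N.exists_mem_restrict_of_mul_mem
    {fun g : (Fin p → ℤ) × ℤ => χ (oddSum g.1)} (by
      rintro _ rfl d ⟨M, hd⟩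
      refine ⟨M + 1, ?_⟩
      have := I.mul_mem_left V _ hd
      rw [← mul_assoc, Finset.mul_sum] at this
      have e : ∑ g ∈ c'.support, V * d g • f g =
          (∑ g ∈ c'.support, ((fun g : (Fin p → ℤ) × ℤ => χ (oddSum g.1)) * d) g • f g) * V := by
        rw [Finset.sum_mul]
        refine Finset.sum_congr rfl fun g _ => ?_
        rw [mul_smul_comm, ← mul_assoc, ← aeval_z_mul, mul_assoc, hV, mul_smul_comm, smul_smul,
          smul_mul_assoc, mul_assoc, Pi.mul_apply, mul_comm (d g)]
      rwa [e, mul_assoc, ← pow_succ'] at this) g₀ h1 c'.support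
  have hg₀ : g₀ ∈ c'.support := by rwa [Finsupp.mem_support_iff, hcg]
  rw [Finset.sum_eq_single g₀, hd1 g₀ fun _ _ => rfl, Pi.one_apply, one_smul] at hd
  · obtain ⟨b, hb⟩ := (isUnit_mono (Q := qMatrix p q) g₀.1)
    have h2 := I.mul_mem_left (incl p hp q ((b⁻¹ : (A p q)ˣ) : A p q)) _ hd
    rw [← mul_assoc, ← mul_assoc, ← aeval_z_mul, mul_assoc (aeval (z p hp q) (c' g₀)), ← map_mul,
      ← hb, Units.inv_mul, map_one, mul_one, hcg] at h2
    exact ⟨M, h2⟩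
  · intro g hg hne
    rw [hd0 g hg, zero_smul]
    intro h
    have h3 := hχ (h _ rfl)
    have h4 := hsupp g hg
    exact hne (Prod.ext (oddSum_injective hp h4.2 h3) h4.1)
  · exact fun h => absurd hg₀ h

theorem genY_mul_mono (a : Fin p → ℤ) : genY p hp q * incl p hp q (mono _ a) =
    ((q ^ (-oddSum a) : Kˣ) : K) • (incl p hp q (mono _ a) * genY p hp q) := by
  rw [genY_mul_incl, α_mono, map_smul, smul_mul_assoc]

theorem genX_mul_mono (a : Fin p → ℤ) : genX p hp q * incl p hp q (mono _ a) =
    ((q ^ (oddSum a) : Kˣ) : K) • (incl p hp q (mono _ a) * genX p hp q) := by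
  rw [genX_mul_incl, α_symm_mono, map_smul, smul_mul_assoc]

/-- Each coefficient of an element of an ideal, times a power of `y` or `x`, lies in the ideal. -/
theorem exists_mul_pow_mem (hq : ∀ n : ℕ, 0 < n → q ^ n ≠ 1) (I : TwoSidedIdeal (R p hp q))
    {c : (Fin p → ℤ) × ℤ →₀ K[X]} (hc : comb p hp q c ∈ I) (g₀ : (Fin p → ℤ) × ℤ) :
    (0 ≤ g₀.2 → ∃ N, aeval (z p hp q) (c g₀) * genY p hp q ^ N ∈ I) ∧
    (g₀.2 ≤ 0 → ∃ N, aeval (z p hp q) (c g₀) * genX p hp q ^ N ∈ I) := by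
  have h := rankOne (hp := hp) hq
  have hinj : ∀ {i j : ℤ}, ((q ^ i : Kˣ) : K) = ((q ^ j : Kˣ) : K) → i = j := by
    intro i j hij
    rw [Units.val_zpow_eq_zpow_val, Units.val_zpow_eq_zpow_val] at hij
    exact h.zpow_injective hij
  constructor
  · intro hg
    refine exists_aeval_mul_pow_mem I hc g₀ h.zpow_ne_one (genY p hp q)
      (fun i => ((q ^ (-i) : Kˣ) : K)) (fun i j hij => neg_injective (hinj hij)) genY_mul_mono
      g₀.2.toNat ?_
    rw [← genPow_natCast, Int.toNat_of_nonneg hg]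
  · intro hg
    refine exists_aeval_mul_pow_mem I hc g₀ h.zpow_ne_one (genX p hp q)
      (fun i => ((q ^ i : Kˣ) : K)) (fun i j hij => hinj hij) genX_mul_mono
      (-g₀.2).toNat ?_
    rw [← genPow_neg_natCast, Int.toNat_of_nonneg (by omega), neg_neg]

end TorusExample

/-! ### Representations in a larger quantum torus -/

namespace TorusExample

open QTorus Polynomial

variable {K : Type*} [Field K] {p : ℕ} {hp : Odd p} {q : Kˣ}

theorem cocycle_snoc (a b : Fin p → ℤ) :
    torusCocycle (qMatrix (p + 1) q) (Fin.snoc a 0 : Fin (p + 1) → ℤ) (Fin.snoc b 0) =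
      torusCocycle (qMatrix p q) a b := by
  simp [torusCocycle, Fin.prod_univ_castSucc, qMatrix]

variable (p q) in
/-- The inclusion of the quantum torus `A` into the one with one more generator. -/
noncomputable def snocHom : A p q →ₐ[K] A (p + 1) q :=
  AlgHom.ofLinearMap (liftLin _ fun a => mono _ (Fin.snoc a 0 : Fin (p + 1) → ℤ)) (by
    rw [one_def, liftLin_mono, one_def]
    congr 1
    funext i
    refine Fin.lastCases ?_ (fun i => ?_) i <;> simp) (by
    intro f g
    have : (mulLin (qMatrix p q)).compr₂
          (liftLin _ fun a => mono (qMatrix (p + 1) q) (Fin.snoc a 0 : Fin (p + 1) → ℤ)) =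
        (mulLin (qMatrix (p + 1) q)).compl₁₂
          (liftLin _ fun a => mono _ (Fin.snoc a 0 : Fin (p + 1) → ℤ))
          (liftLin _ fun a => mono _ (Fin.snoc a 0 : Fin (p + 1) → ℤ)) := by
      refine hom_ext fun a => hom_ext fun b => ?_
      have e : (Fin.snoc (a + b) 0 : Fin (p + 1) → ℤ) =
          (Fin.snoc a 0 : Fin (p + 1) → ℤ) + (Fin.snoc b 0 : Fin (p + 1) → ℤ) := by
        funext i
        refine Fin.lastCases ?_ (fun i => ?_) i <;> simp
      simp only [LinearMap.compr₂_apply, LinearMap.compl₁₂_apply, mulLin_mono, map_smul,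
        liftLin_mono, cocycle_snoc, e]
    exact LinearMap.congr_fun₂ this f g)

theorem snocHom_mono (a : Fin p → ℤ) :
    snocHom p q (mono _ a) = mono _ (Fin.snoc a 0 : Fin (p + 1) → ℤ) :=
  liftLin_mono _ _

theorem coeff_snocHom (a : Fin p → ℤ) (f : A p q) :
    QTorus.coeff (Fin.snoc a 0 : Fin (p + 1) → ℤ) (snocHom p q f) = QTorus.coeff a f := by
  have : QTorus.coeff (Fin.snoc a 0 : Fin (p + 1) → ℤ) ∘ₗ (snocHom p q).toLinearMap =
      QTorus.coeff a := by
    refine hom_ext fun b => ?_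
    rw [LinearMap.comp_apply, AlgHom.toLinearMap_apply, snocHom_mono, coeff_mono, coeff_mono]
    refine if_congr ⟨fun h => ?_, fun h => by rw [h]⟩ rfl rfl
    have := congrArg Fin.init h
    rwa [Fin.init_snoc, Fin.init_snoc] at this
  exact LinearMap.congr_fun this f

variable (p q) in
/-- The additional generator of the larger quantum torus, which is the image of `y`. -/
noncomputable def lastGen : (A (p + 1) q)ˣ := gen _ (Fin.last p)

theorem lastGen_mul_snocHom (hp : Odd p) (a : A p q) :
    (lastGen p q : A (p + 1) q) * snocHom p q a = snocHom p q (α p q a) * lastGen p q := by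
  refine QTorus.induction_on (P := fun a => (lastGen p q : A (p + 1) q) * snocHom p q a =
    snocHom p q (α p q a) * lastGen p q) a (by simp)
    (fun f g hf hg => by simp only [map_add, mul_add, add_mul, hf, hg]) fun c b => ?_
  have e : wt (Fin.last p) (Fin.snoc b 0 : Fin (p + 1) → ℤ) = -oddSum b := by
    have : Even (p + 1) := hp.add_one
    rw [wt, if_pos (by simpa using this), oddSum, Fin.sum_univ_castSucc]
    simp only [Fin.castSucc_lt_last, true_and, Fin.val_castSucc, Fin.snoc_castSucc, lt_irrefl,
      false_and, if_false, add_zero, ← Nat.not_even_iff_odd, ite_not]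
  have h := gen_mul_mono (q := q) (Fin.last p) (Fin.snoc b 0 : Fin (p + 1) → ℤ)
  rw [e] at h
  rw [map_smul, map_smul, map_smul, mul_smul_comm, smul_mul_assoc, snocHom_mono, α_mono, map_smul,
    snocHom_mono, smul_mul_assoc]
  exact congrArg _ h

/-- The value `a` of the Casimir element determines a representation of `R` in a quantum torus. -/
theorem exists_phi (a : K) : ∃ φ : R p hp q →ₐ[K] A (p + 1) q,
    (∀ b, φ (incl p hp q b) = snocHom p q b) ∧ φ (genY p hp q) = lastGen p q ∧
      φ (z p hp q) = algebraMap K _ a := by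
  set W : A (p + 1) q := snocHom p q (u p hp q) + algebraMap K _ a with hW
  set Y := lastGen p q with hY
  have hYs : ∀ b, ((Y⁻¹ : (A (p + 1) q)ˣ) : A (p + 1) q) * snocHom p q b =
      snocHom p q ((α p q).symm b) * ((Y⁻¹ : (A (p + 1) q)ˣ) : A (p + 1) q) := by
    intro b
    rw [Units.inv_mul_eq_iff_eq_mul, ← mul_assoc, lastGen_mul_snocHom hp,
      AlgEquiv.apply_symm_apply, mul_assoc, Units.mul_inv, mul_one]
  have hWs : ∀ b, W * snocHom p q b = snocHom p q b * W := by
    intro b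
    rw [hW, add_mul, mul_add, ← map_mul, ← map_mul,
      Subalgebra.mem_center_iff.1 (u_mem_center (hp := hp) (q := q)) b, Algebra.commutes]
  obtain ⟨φ, h1, h2, h3⟩ := Ambiskew.exists_lift (α := α p q) (v := v p hp q) (ρ := 1)
    (snocHom p q) (W * ((Y⁻¹ : (A (p + 1) q)ˣ) : A (p + 1) q)) Y (lastGen_mul_snocHom hp)
    (fun b => by rw [mul_assoc, hYs, ← mul_assoc, hWs, mul_assoc]) (by
      rw [mul_assoc, Units.inv_mul, mul_one, one_smul, ← mul_assoc, hW, mul_add,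
        lastGen_mul_snocHom hp, α_u, ← Algebra.commutes, ← add_mul, mul_assoc, Units.mul_inv,
        mul_one, map_sub]
      abel)
  refine ⟨φ, h1, h3, ?_⟩
  have e : φ (z p hp q) = φ (Ambiskew.x _ _ _) * φ (Ambiskew.y _ _ _) -
      φ (Ambiskew.ofBase _ _ _ (u p hp q)) := by
    rw [← map_mul, ← map_sub]
    rfl
  rw [e, h1, h2, h3, mul_assoc, Units.inv_mul, mul_one, hW, add_sub_cancel_left]

variable (p hp q) in
/-- The representation of `R` in a quantum torus in which the Casimir element acts as `a`. -/
noncomputable def phi (a : K) : R p hp q →ₐ[K] A (p + 1) q := (exists_phi a).choose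

theorem phi_incl (a : K) (b : A p q) : phi p hp q a (incl p hp q b) = snocHom p q b :=
  (exists_phi a).choose_spec.1 b

theorem phi_genY (a : K) : phi p hp q a (genY p hp q) = lastGen p q :=
  (exists_phi a).choose_spec.2.1

theorem phi_z (a : K) : phi p hp q a (z p hp q) = algebraMap K _ a :=
  (exists_phi a).choose_spec.2.2

theorem phi_aeval_z (a : K) (P : K[X]) :
    phi p hp q a (aeval (z p hp q) P) = algebraMap K _ (P.eval a) := by
  rw [← aeval_algHom_apply, phi_z, aeval_algebraMap_apply, coe_aeval_eq_eval]

theorem phi_genY_ne_zero (a : K) : phi p hp q a (genY p hp q) ≠ 0 := by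
  rw [phi_genY]
  exact Units.ne_zero _

theorem phi_genX_ne_zero (a : K) : phi p hp q a (genX p hp q) ≠ 0 := by
  intro h
  have h1 := congrArg (phi p hp q a) (genX_mul_genY (hp := hp) (q := q))
  rw [map_mul, h, zero_mul, map_add, phi_z, phi_incl, ← (snocHom p q).commutes, ← map_add] at h1
  have h2 := congrArg (QTorus.coeff (Fin.snoc (Pi.single ⟨p - 1, by have := hp.pos; omega⟩ 1) 0 :
    Fin (p + 1) → ℤ)) h1
  rw [map_zero, coeff_snocHom, map_add, Algebra.algebraMap_eq_smul_one, map_smul, one_def, u,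
    map_add, map_smul, map_smul] at h2
  have e1 : (zp p hp q : A p q) = mono _ (Pi.single ⟨p - 1, by have := hp.pos; omega⟩ 1) := rfl
  have e2 : (((zp p hp q)⁻¹ : (A p q)ˣ) : A p q) =
    mono _ (Pi.single ⟨p - 1, by have := hp.pos; omega⟩ (-1)) := rfl
  rw [e1, e2, coeff_mono, coeff_mono, coeff_mono, if_pos rfl, if_neg, if_neg] at h2
  · exact q.ne_zero (by simpa using h2.symm)
  · rw [Pi.single_inj]
    decide
  · intro e
    simpa using congrFun e ⟨p - 1, by have := hp.pos; omega⟩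

/-! ### The ideals generated by `z - a` -/

theorem eval_eq_zero_of_phi_comb (hq : ∀ n : ℕ, 0 < n → q ^ n ≠ 1) {a : K}
    {c : (Fin p → ℤ) × ℤ →₀ K[X]} (h : phi p hp q a (comb p hp q c) = 0)
    (g : (Fin p → ℤ) × ℤ) : (c g).eval a = 0 := by
  have hI := exists_mul_pow_mem hq (TwoSidedIdeal.ker (phi p hp q a))
    ((TwoSidedIdeal.mem_ker _).2 h) g
  by_contra hne
  have hne' : algebraMap K (A (p + 1) q) ((c g).eval a) ≠ 0 := by
    rw [Algebra.algebraMap_eq_smul_one]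
    exact smul_ne_zero hne one_ne_zero
  rcases le_total 0 g.2 with hg | hg
  · obtain ⟨N, hN⟩ := hI.1 hg
    rw [TwoSidedIdeal.mem_ker, map_mul, map_pow, phi_aeval_z] at hN
    exact mul_ne_zero hne' (pow_ne_zero _ (phi_genY_ne_zero a)) hN
  · obtain ⟨N, hN⟩ := hI.2 hg
    rw [TwoSidedIdeal.mem_ker, map_mul, map_pow, phi_aeval_z] at hN
    exact mul_ne_zero hne' (pow_ne_zero _ (phi_genX_ne_zero a)) hN

theorem exists_eq_mul_of_eval_eq_zero {a : K} {c : (Fin p → ℤ) × ℤ →₀ K[X]}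
    (h : ∀ g, (c g).eval a = 0) :
    ∃ t, comb p hp q c = (z p hp q - algebraMap K _ a) * t := by
  refine ⟨∑ g ∈ c.support, aeval (z p hp q) (c g /ₘ (X - C a)) * basisElt p hp q g, ?_⟩
  rw [comb_apply, Finset.mul_sum]
  refine Finset.sum_congr rfl fun g _ => ?_
  conv_lhs => rw [← mul_divByMonic_eq_iff_isRoot.2 (h g)]
  rw [map_mul, map_sub, aeval_X, aeval_C, mul_assoc]

theorem phi_eq_zero_iff (hq : ∀ n : ℕ, 0 < n → q ^ n ≠ 1) {a : K} {w : R p hp q} :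
    phi p hp q a w = 0 ↔ ∃ t, w = (z p hp q - algebraMap K _ a) * t := by
  constructor
  · intro h
    obtain ⟨c, rfl⟩ := comb_surjective w
    exact exists_eq_mul_of_eval_eq_zero (eval_eq_zero_of_phi_comb hq h)
  · rintro ⟨t, rfl⟩
    rw [map_mul, map_sub, phi_z, AlgHom.commutes, sub_self, zero_mul]

theorem mem_zIdeal_iff_exists (a : K) (w : R p hp q) :
    w ∈ zIdeal p hp q a ↔ ∃ t, w = (z p hp q - algebraMap K _ a) * t :=
  TwoSidedIdeal.mem_span_singleton_of_central fun r => by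
    rw [sub_mul, mul_sub, z_mul, Algebra.commutes]

theorem mem_zIdeal_iff (hq : ∀ n : ℕ, 0 < n → q ^ n ≠ 1) {a : K} {w : R p hp q} :
    w ∈ zIdeal p hp q a ↔ phi p hp q a w = 0 := by
  rw [mem_zIdeal_iff_exists, phi_eq_zero_iff hq]

theorem sub_mem_zIdeal (a : K) : z p hp q - algebraMap K _ a ∈ zIdeal p hp q a :=
  TwoSidedIdeal.subset_span rfl

theorem zIdeal_le_iff {a : K} {I : TwoSidedIdeal (R p hp q)} :
    zIdeal p hp q a ≤ I ↔ z p hp q - algebraMap K _ a ∈ I := by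
  rw [zIdeal, TwoSidedIdeal.span_le, Set.singleton_subset_iff, SetLike.mem_coe]

theorem aeval_z_sub_mem_zIdeal (a : K) (P : K[X]) :
    aeval (z p hp q) P - algebraMap K _ (P.eval a) ∈ zIdeal p hp q a := by
  obtain ⟨Q, hQ⟩ := X_sub_C_dvd_sub_C_eval (a := a) (p := P)
  have := congrArg (aeval (z p hp q)) hQ
  rw [map_sub, map_mul, map_sub, aeval_C, aeval_C, aeval_X] at this
  rw [this]
  exact (zIdeal p hp q a).mul_mem_right _ _ (sub_mem_zIdeal a)

/-- The quotient by `z - a` embeds in a quantum torus, so it is a domain. -/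
theorem zIdeal_isPrime (hq : ∀ n : ℕ, 0 < n → q ^ n ≠ 1) (a : K) :
    (zIdeal p hp q a).IsPrimeIdeal := by
  refine ⟨fun h => ?_, fun b c h => ?_⟩
  · rw [← TwoSidedIdeal.one_mem_iff, mem_zIdeal_iff hq, map_one] at h
    exact one_ne_zero h
  · have := h 1
    rw [mul_one, mem_zIdeal_iff hq, map_mul, mul_eq_zero] at this
    rwa [mem_zIdeal_iff hq, mem_zIdeal_iff hq]

/-- A proper ideal contains `z - a` for at most one scalar `a`. -/
theorem eq_of_sub_mem {I : TwoSidedIdeal (R p hp q)} (hI : I ≠ ⊤) {a b : K}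
    (ha : z p hp q - algebraMap K _ a ∈ I) (hb : z p hp q - algebraMap K _ b ∈ I) : a = b := by
  by_contra hne
  refine hI (I.one_mem_iff.1 ?_)
  have := I.sub_mem hb ha
  rwa [sub_sub_sub_cancel_left, ← map_sub, Algebra.algebraMap_eq_smul_one,
    I.smul_mem_iff_of_ne_zero (sub_ne_zero.2 hne)] at this

/-- A non-zero element of `R` is non-zero in all but finitely many of the domains `R/(z - a)R`. -/
theorem bot_isPrime [Infinite K] (hq : ∀ n : ℕ, 0 < n → q ^ n ≠ 1) :
    (⊥ : TwoSidedIdeal (R p hp q)).IsPrimeIdeal := by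
  have key : ∀ w : R p hp q, w ≠ 0 → ∃ P : K[X], P ≠ 0 ∧
      ∀ a, P.eval a ≠ 0 → phi p hp q a w ≠ 0 := by
    intro w hw
    obtain ⟨c, rfl⟩ := comb_surjective w
    have hc : c ≠ 0 := by
      rintro rfl
      exact hw (map_zero _)
    obtain ⟨g, hg⟩ := Finsupp.ne_iff.1 hc
    exact ⟨c g, hg, fun a ha h => ha (eval_eq_zero_of_phi_comb hq h g)⟩
  refine ⟨fun h => ?_, fun b c h => ?_⟩
  · have : (1 : R p hp q) ∈ (⊥ : TwoSidedIdeal (R p hp q)) := h ▸ trivial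
    rw [TwoSidedIdeal.mem_bot] at this
    have := congrArg (phi p hp q (0 : K)) this
    rw [map_one, map_zero] at this
    exact one_ne_zero this
  · have h1 := h 1
    rw [mul_one, TwoSidedIdeal.mem_bot] at h1
    rw [TwoSidedIdeal.mem_bot, TwoSidedIdeal.mem_bot]
    by_contra! hne
    obtain ⟨P, hP, hP'⟩ := key b hne.1
    obtain ⟨Q, hQ, hQ'⟩ := key c hne.2
    obtain ⟨a, ha⟩ : ∃ a, (P * Q).eval a ≠ 0 := by
      by_contra! h0
      exact mul_ne_zero hP hQ (Polynomial.funext fun a => by rw [h0, eval_zero])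
    rw [eval_mul] at ha
    refine mul_ne_zero (hP' a (left_ne_zero_of_mul ha)) (hQ' a (right_ne_zero_of_mul ha)) ?_
    rw [← map_mul, h1, map_zero]

/-! ### Ideals that meet the polynomials in the Casimir element -/

/-- The zeros of the resultants are symmetric under the exchange of `x` and `y`. -/
theorem resultant_swap {q s c : K} (hq : q ≠ 0) (n : ℕ) :
    q * s * (q⁻¹ * c) * (q⁻¹ ^ (n + 1))⁻¹ * (q⁻¹ ^ (n + 1) + 1) ^ 2 =
      s * c * (q ^ (n + 1))⁻¹ * (q ^ (n + 1) + 1) ^ 2 := by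
  rw [inv_pow, inv_inv]
  have : q ^ (n + 1) ≠ 0 := pow_ne_zero _ hq
  field_simp
  ring

theorem exists_aeval_mem_of_mul_pow {S : Type*} [Ring S] [Algebra K S] {q s c : K}
    {x y z t t' : S} (h : RankOneRelations q s c x y z t t') {I : TwoSidedIdeal S} {P : K[X]}
    (hP : P ≠ 0) (n : ℕ) (hI : aeval z P * y ^ n ∈ I) : ∃ Q : K[X], Q ≠ 0 ∧ aeval z Q ∈ I := by
  induction n generalizing P with
  | zero => exact ⟨P, hP, by simpa using hI⟩
  | succ n ih =>
    have hc : ∀ r, aeval z P * r = r * aeval z P := aeval_mul_comm_of_central h.z_mul P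
    have := h.mul_resultant_mem hc hI
    refine ih (P := P * (X ^ 2 - C (s * c * (q ^ (n + 1))⁻¹ * (q ^ (n + 1) + 1) ^ 2)))
      (mul_ne_zero hP (monic_X_pow_sub_C _ two_ne_zero).ne_zero) ?_
    simpa using this

/-- A non-zero ideal contains a non-zero polynomial in the Casimir element. -/
theorem exists_aeval_mem (hq : ∀ n : ℕ, 0 < n → q ^ n ≠ 1) {I : TwoSidedIdeal (R p hp q)}
    (hI : I ≠ ⊥) : ∃ P : K[X], P ≠ 0 ∧ aeval (z p hp q) P ∈ I := by
  obtain ⟨w, hw, hw0⟩ : ∃ w ∈ I, w ≠ 0 := by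
    by_contra! h
    exact hI (le_bot_iff.1 fun w hw => (TwoSidedIdeal.mem_bot _).2 (h w hw))
  obtain ⟨c, rfl⟩ := comb_surjective w
  have hc : c ≠ 0 := by
    rintro rfl
    exact hw0 (map_zero _)
  obtain ⟨g, hg⟩ := Finsupp.ne_iff.1 hc
  have hN := exists_mul_pow_mem hq I hw g
  rcases le_total 0 g.2 with h | h
  · obtain ⟨N, hN⟩ := hN.1 h
    exact exists_aeval_mem_of_mul_pow (rankOne hq) hg N hN
  · obtain ⟨N, hN⟩ := hN.2 h
    exact exists_aeval_mem_of_mul_pow (rankOne hq).swap hg N hN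

/-- A non-zero prime ideal contains `z - a` for some scalar `a`. -/
theorem exists_sub_mem_of_isPrime [IsAlgClosed K] (hq : ∀ n : ℕ, 0 < n → q ^ n ≠ 1)
    {I : TwoSidedIdeal (R p hp q)} (hI : I.IsPrimeIdeal) (h0 : I ≠ ⊥) :
    ∃ a : K, zIdeal p hp q a ≤ I := by
  have key : ∀ (n : ℕ) (P : K[X]), P.natDegree = n → P ≠ 0 → aeval (z p hp q) P ∈ I →
      ∃ a : K, zIdeal p hp q a ≤ I := by
    intro n
    induction n with
    | zero =>
      intro P hn hP hPI
      rw [eq_C_of_natDegree_eq_zero hn, aeval_C, Algebra.algebraMap_eq_smul_one,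
        I.smul_mem_iff_of_ne_zero] at hPI
      · exact absurd (I.one_mem_iff.1 hPI) hI.1
      · intro h
        rw [eq_C_of_natDegree_eq_zero hn, h, C_0] at hP
        exact hP rfl
    | succ n ih =>
      intro P hn hP hPI
      obtain ⟨a, ha⟩ := IsAlgClosed.exists_root P (by
        intro h
        rw [natDegree_eq_zero_iff_degree_le_zero.2 h.le] at hn
        omega)
      obtain ⟨Q, rfl⟩ := dvd_iff_isRoot.2 ha
      have hQ : Q ≠ 0 := right_ne_zero_of_mul hP
      rcases hI.2 (z p hp q - algebraMap K _ a) (aeval (z p hp q) Q) (fun r => by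
          rw [mul_assoc, ← aeval_z_mul, ← mul_assoc]
          refine I.mul_mem_right _ _ ?_
          simpa using hPI) with h | h
      · exact ⟨a, zIdeal_le_iff.2 h⟩
      · refine ih Q ?_ hQ h
        rw [natDegree_mul (X_sub_C_ne_zero a) hQ, natDegree_X_sub_C] at hn
        omega
  obtain ⟨P, hP, hPI⟩ := exists_aeval_mem hq h0
  exact key _ P rfl hP hPI

/-- An ideal strictly above `z - a` contains a power of `x` or of `y`. -/
theorem exists_pow_mem_of_lt (hq : ∀ n : ℕ, 0 < n → q ^ n ≠ 1) {I : TwoSidedIdeal (R p hp q)}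
    {a : K} (hI : zIdeal p hp q a < I) :
    (∃ N, genY p hp q ^ N ∈ I) ∨ ∃ N, genX p hp q ^ N ∈ I := by
  obtain ⟨w, hw, hwz⟩ := SetLike.exists_of_lt hI
  obtain ⟨c, rfl⟩ := comb_surjective w
  obtain ⟨g, hg⟩ : ∃ g, (c g).eval a ≠ 0 := by
    by_contra! h
    exact hwz ((mem_zIdeal_iff_exists a _).2 (exists_eq_mul_of_eval_eq_zero h))
  have hev : aeval (z p hp q) (c g) - algebraMap K _ ((c g).eval a) ∈ I :=
    hI.le (aeval_z_sub_mem_zIdeal a _)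
  have hred : ∀ w : R p hp q, aeval (z p hp q) (c g) * w ∈ I → w ∈ I := by
    intro w hw
    have := I.sub_mem hw (I.mul_mem_right _ w hev)
    rwa [← sub_mul, sub_sub_cancel, ← Algebra.smul_def, I.smul_mem_iff_of_ne_zero hg] at this
  have hN := exists_mul_pow_mem hq I hw g
  rcases le_total 0 g.2 with h | h
  · obtain ⟨N, hN⟩ := hN.1 h
    exact Or.inl ⟨N, hred _ hN⟩
  · obtain ⟨N, hN⟩ := hN.2 h
    exact Or.inr ⟨N, hred _ hN⟩

/-- If no resultant vanishes at `a`, then `(z - a)R` is maximal. -/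
theorem eq_top_of_lt (hq : ∀ n : ℕ, 0 < n → q ^ n ≠ 1) {I : TwoSidedIdeal (R p hp q)} {a : K}
    (hI : zIdeal p hp q a < I)
    (ha : ∀ n : ℕ, a ^ 2 ≠ (q : K) ^ ((p - 1) / 2) * q * ((q : K) ^ (n + 1))⁻¹ *
      ((q : K) ^ (n + 1) + 1) ^ 2) : I = ⊤ := by
  have hz := zIdeal_le_iff.1 hI.le
  rw [← I.one_mem_iff]
  rcases exists_pow_mem_of_lt hq hI with ⟨N, hN⟩ | ⟨N, hN⟩
  · induction N with
    | zero => simpa using hN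
    | succ N ih => exact ih ((rankOne hq).y_pow_mem_of_succ hz (ha N) hN)
  · induction N with
    | zero => simpa using hN
    | succ N ih =>
      refine ih ((rankOne hq).swap.y_pow_mem_of_succ hz ?_ hN)
      rw [resultant_swap q.ne_zero]
      exact ha N

end TorusExample

/-! ### The ideal `J(I)` of a generalized Weyl algebra -/

namespace Ambiskew

variable {K A W : Type*} [Field K] [Ring A] [Algebra K A] [Ring W] {α : A ≃ₐ[K] A} {ι : A →+* W}
  {X Y : W} {m : ℕ} {I : TwoSidedIdeal A}

theorem mul_Y_pow_mem_gradedJ {i : ℕ} {a : A} (h : ∀ l, l + i < m → α^[l] a ∈ I) :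
    ι a * Y ^ i ∈ gradedJ α ι X Y m I :=
  AddSubgroup.subset_closure (Or.inl ⟨i, a, h, rfl⟩)

theorem mul_X_pow_mem_gradedJ {i : ℕ} {a : A} (h : ∀ l, i ≤ l → l < m → α^[l] a ∈ I) :
    ι a * X ^ i ∈ gradedJ α ι X Y m I :=
  AddSubgroup.subset_closure (Or.inr ⟨i, a, h, rfl⟩)

/-- To show that an additive map takes `J(I)` into a subgroup, it suffices to consider the
homogeneous elements. -/
theorem gradedJ_le_comap {V : Type*} [AddGroup V] {f : W →+ V} {H : AddSubgroup V}
    (hY : ∀ i a, (∀ l, l + i < m → α^[l] a ∈ I) → f (ι a * Y ^ i) ∈ H)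
    (hX : ∀ i a, (∀ l, i ≤ l → l < m → α^[l] a ∈ I) → f (ι a * X ^ i) ∈ H) {w : W}
    (hw : w ∈ gradedJ α ι X Y m I) : f w ∈ H := by
  have : gradedJ α ι X Y m I ≤ H.comap f := by
    rw [gradedJ, AddSubgroup.closure_le]
    rintro _ (⟨i, a, h, rfl⟩ | ⟨i, a, h, rfl⟩)
    · exact hY i a h
    · exact hX i a h
  exact this hw

theorem iterate_intertwine {β : A → A} {V : W} (hV : ∀ a, V * ι a = ι (β a) * V) (i : ℕ) (a : A) :
    V ^ i * ι a = ι (β^[i] a) * V ^ i := by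
  induction i with
  | zero => simp
  | succ i ih =>
    rw [pow_succ', mul_assoc, ih, ← mul_assoc, hV, mul_assoc, Function.iterate_succ_apply']

/-- In a generalized Weyl algebra with `XY = b`, the subgroup `J(I)` is a left ideal if `b ∈ I` and
`αᵐ(b) ∈ I`. -/
theorem mul_left_mem_gradedJ (hY : ∀ a, Y * ι a = ι (α a) * Y)
    (hX : ∀ a, X * ι a = ι (α.symm a) * X) {b : A} (hXY : X * Y = ι b) (hYX : Y * X = ι (α b))
    (hb : b ∈ I) (hb' : α^[m] b ∈ I) {w : W} (hw : w ∈ gradedJ α ι X Y m I) :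
    (∀ a, ι a * w ∈ gradedJ α ι X Y m I) ∧ Y * w ∈ gradedJ α ι X Y m I ∧
      X * w ∈ gradedJ α ι X Y m I := by
  refine ⟨fun c => ?_, ?_, ?_⟩
  · refine gradedJ_le_comap (f := AddMonoidHom.mulLeft (ι c)) (fun i a h => ?_) (fun i a h => ?_) hw
    · rw [AddMonoidHom.coe_mulLeft, ← mul_assoc, ← map_mul]
      refine mul_Y_pow_mem_gradedJ fun l hl => ?_
      rw [iterate_map_mul]
      exact I.mul_mem_left _ _ (h l hl)
    · rw [AddMonoidHom.coe_mulLeft, ← mul_assoc, ← map_mul]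
      refine mul_X_pow_mem_gradedJ fun l hl hl' => ?_
      rw [iterate_map_mul]
      exact I.mul_mem_left _ _ (h l hl hl')
  · refine gradedJ_le_comap (f := AddMonoidHom.mulLeft Y) (fun i a h => ?_) (fun i a h => ?_) hw
    · rw [AddMonoidHom.coe_mulLeft, ← mul_assoc, hY, mul_assoc, ← pow_succ']
      refine mul_Y_pow_mem_gradedJ fun l hl => ?_
      rw [← Function.iterate_succ_apply]
      exact h (l + 1) (by omega)
    · rw [AddMonoidHom.coe_mulLeft, ← mul_assoc, hY, mul_assoc]
      rcases i with _ | i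
      · have := mul_Y_pow_mem_gradedJ (α := α) (ι := ι) (X := X) (Y := Y) (m := m) (I := I)
          (i := 1) (a := α a) fun l hl => by
            rw [← Function.iterate_succ_apply]
            exact h (l + 1) (by omega) (by omega)
        simpa using this
      · rw [pow_succ', ← mul_assoc Y, hYX, ← mul_assoc, ← map_mul]
        refine mul_X_pow_mem_gradedJ fun l hl hl' => ?_
        rw [← map_mul, ← Function.iterate_succ_apply, iterate_map_mul]
        rcases Nat.lt_or_ge (l + 1) m with h1 | h1
        · exact I.mul_mem_right _ _ (h (l + 1) (by omega) h1)
        · have : l + 1 = m := by omega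
          subst this
          exact I.mul_mem_left _ _ hb'
  · refine gradedJ_le_comap (f := AddMonoidHom.mulLeft X) (fun i a h => ?_) (fun i a h => ?_) hw
    · rw [AddMonoidHom.coe_mulLeft, ← mul_assoc, hX, mul_assoc]
      rcases i with _ | i
      · have := mul_X_pow_mem_gradedJ (α := α) (ι := ι) (X := X) (Y := Y) (m := m) (I := I)
          (i := 1) (a := α.symm a) fun l hl hl' => by
            obtain ⟨l, rfl⟩ : ∃ k, l = k + 1 := ⟨l - 1, by omega⟩
            rw [Function.iterate_succ_apply, AlgEquiv.apply_symm_apply]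
            exact h l (by omega)
        simpa using this
      · rw [pow_succ', ← mul_assoc X, hXY, ← mul_assoc, ← map_mul]
        refine mul_Y_pow_mem_gradedJ fun l hl => ?_
        rw [iterate_map_mul]
        rcases l with _ | l
        · exact I.mul_mem_left _ _ hb
        · rw [Function.iterate_succ_apply, AlgEquiv.apply_symm_apply]
          exact I.mul_mem_right _ _ (h l (by omega))
    · rw [AddMonoidHom.coe_mulLeft, ← mul_assoc, hX, mul_assoc, ← pow_succ']
      refine mul_X_pow_mem_gradedJ fun l hl hl' => ?_
      obtain ⟨l, rfl⟩ : ∃ k, l = k + 1 := ⟨l - 1, by omega⟩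
      rw [Function.iterate_succ_apply, AlgEquiv.apply_symm_apply]
      exact h l (by omega) (by omega)

theorem mul_right_mem_gradedJ (hY : ∀ a, Y * ι a = ι (α a) * Y)
    (hX : ∀ a, X * ι a = ι (α.symm a) * X) {b : A} (hXY : X * Y = ι b) (hYX : Y * X = ι (α b))
    (hb : b ∈ I) (hb' : α^[m] b ∈ I) {w : W} (hw : w ∈ gradedJ α ι X Y m I) :
    (∀ a, w * ι a ∈ gradedJ α ι X Y m I) ∧ w * Y ∈ gradedJ α ι X Y m I ∧
      w * X ∈ gradedJ α ι X Y m I := by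
  refine ⟨fun c => ?_, ?_, ?_⟩
  · refine gradedJ_le_comap (f := AddMonoidHom.mulRight (ι c)) (fun i a h => ?_)
      (fun i a h => ?_) hw
    · rw [AddMonoidHom.mulRight_apply, mul_assoc, iterate_intertwine hY, ← mul_assoc, ← map_mul]
      refine mul_Y_pow_mem_gradedJ fun l hl => ?_
      rw [iterate_map_mul]
      exact I.mul_mem_right _ _ (h l hl)
    · rw [AddMonoidHom.mulRight_apply, mul_assoc, iterate_intertwine hX, ← mul_assoc, ← map_mul]
      refine mul_X_pow_mem_gradedJ fun l hl hl' => ?_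
      rw [iterate_map_mul]
      exact I.mul_mem_right _ _ (h l hl hl')
  · refine gradedJ_le_comap (f := AddMonoidHom.mulRight Y) (fun i a h => ?_) (fun i a h => ?_) hw
    · rw [AddMonoidHom.mulRight_apply, mul_assoc, ← pow_succ]
      exact mul_Y_pow_mem_gradedJ fun l hl => h l (by omega)
    · rw [AddMonoidHom.mulRight_apply, mul_assoc]
      rcases i with _ | i
      · have := mul_Y_pow_mem_gradedJ (α := α) (ι := ι) (X := X) (Y := Y) (m := m) (I := I)
          (i := 1) (a := a) fun l hl => h l (by omega) (by omega)
        simpa using this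
      · rw [pow_succ, mul_assoc, hXY, iterate_intertwine hX, ← mul_assoc, ← map_mul]
        refine mul_X_pow_mem_gradedJ fun l hl hl' => ?_
        rw [iterate_map_mul]
        rcases Nat.eq_or_lt_of_le hl with rfl | h1
        · have hinv : Function.LeftInverse α α.symm := α.apply_symm_apply
          rw [hinv.iterate i b]
          exact I.mul_mem_left _ _ hb
        · exact I.mul_mem_right _ _ (h l h1 hl')
  · refine gradedJ_le_comap (f := AddMonoidHom.mulRight X) (fun i a h => ?_) (fun i a h => ?_) hw
    · rw [AddMonoidHom.mulRight_apply, mul_assoc]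
      rcases i with _ | i
      · have := mul_X_pow_mem_gradedJ (α := α) (ι := ι) (X := X) (Y := Y) (m := m) (I := I)
          (i := 1) (a := a) fun l hl hl' => h l (by omega)
        simpa using this
      · rw [pow_succ, mul_assoc, hYX, iterate_intertwine hY, ← mul_assoc, ← map_mul]
        refine mul_Y_pow_mem_gradedJ fun l hl => ?_
        rw [iterate_map_mul]
        rcases Nat.lt_or_ge (l + (i + 1)) m with h1 | h1
        · exact I.mul_mem_right _ _ (h l h1)
        · refine I.mul_mem_left _ _ ?_
          rw [← Function.iterate_succ_apply, ← Function.iterate_add_apply]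
          have : l + (i + 1) = m := by omega
          subst this
          exact hb'
    · rw [AddMonoidHom.mulRight_apply, mul_assoc, ← pow_succ]
      exact mul_X_pow_mem_gradedJ fun l hl hl' => h l (by omega) hl'

end Ambiskew

/-! ### The exceptional ideals -/

namespace TorusExample

open QTorus Polynomial

variable {K : Type*} [Field K] {p : ℕ} {hp : Odd p} {q : Kˣ}

variable (p hp q) in
/-- The maximal ideal `(z_p - μ)A` of `A`. -/
noncomputable def maxIdeal (μ : K) : TwoSidedIdeal (A p q) :=
  TwoSidedIdeal.span {(zp p hp q : A p q) - algebraMap K _ μ}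

variable (p hp q) in
/-- The subgroup `J((z_p - μ)A)` of `R/(z - a)R`. -/
noncomputable def quotJ (a μ : K) (m : ℕ) : AddSubgroup (zIdeal p hp q a).ringCon.Quotient :=
  Ambiskew.gradedJ (α p q) ((proj p hp q a).comp (incl p hp q).toRingHom)
    (proj p hp q a (genX p hp q)) (proj p hp q a (genY p hp q)) m (maxIdeal p hp q μ)

theorem zp_mul (b : A p q) : (zp p hp q : A p q) * b = b * zp p hp q :=
  (Subalgebra.mem_center_iff.1 (zp_mem_center p hp q) b).symm

theorem mem_maxIdeal_iff {μ : K} {b : A p q} :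
    b ∈ maxIdeal p hp q μ ↔ ∃ t, b = ((zp p hp q : A p q) - algebraMap K _ μ) * t :=
  TwoSidedIdeal.mem_span_singleton_of_central fun r => by
    rw [sub_mul, mul_sub, zp_mul, Algebra.commutes]

theorem aeval_mul_sub_mem_maxIdeal (μ : K) (P : K[X]) (b : A p q) :
    aeval (zp p hp q : A p q) P * b - P.eval μ • b ∈ maxIdeal p hp q μ := by
  obtain ⟨Q, hQ⟩ := X_sub_C_dvd_sub_C_eval (a := μ) (p := P)
  have h2 := congrArg (aeval (zp p hp q : A p q)) hQ
  rw [map_sub, map_mul, map_sub, aeval_X, aeval_C, aeval_C] at h2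
  rw [Algebra.smul_def, ← sub_mul, h2, mul_assoc]
  exact mem_maxIdeal_iff.2 ⟨_, rfl⟩

theorem mem_maxIdeal_of_aeval_mul {μ : K} {P : K[X]} {b : A p q} (hP : P.eval μ ≠ 0)
    (h : aeval (zp p hp q : A p q) P * b ∈ maxIdeal p hp q μ) : b ∈ maxIdeal p hp q μ := by
  have := TwoSidedIdeal.sub_mem _ h (aeval_mul_sub_mem_maxIdeal μ P b)
  rwa [sub_sub_cancel, TwoSidedIdeal.smul_mem_iff_of_ne_zero _ hP] at this

theorem aeval_mem_maxIdeal {μ : K} {P : K[X]} (hP : P.eval μ = 0) :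
    aeval (zp p hp q : A p q) P ∈ maxIdeal p hp q μ := by
  simpa [hP] using aeval_mul_sub_mem_maxIdeal (hp := hp) (q := q) μ P 1

theorem α_iterate_aeval (l : ℕ) (P : K[X]) :
    (α p q)^[l] (aeval (zp p hp q : A p q) P) =
      aeval (zp p hp q : A p q) (P.comp (C ((q : K) ^ (-(l : ℤ))) * X)) := by
  induction l generalizing P with
  | zero => simp
  | succ l ih =>
    have h : α p q (aeval (zp p hp q : A p q) P) =
        aeval (zp p hp q : A p q) (P.comp (C (q : K)⁻¹ * X)) := by
      have := aeval_algHom_apply (α p q).toAlgHom (zp p hp q : A p q) P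
      rw [aeval_comp, map_mul, aeval_C, aeval_X, ← Algebra.smul_def, ← α_zp]
      exact this.symm
    rw [Function.iterate_succ_apply, h, ih, comp_assoc]
    congr 2
    rw [mul_comp, C_comp, X_comp, ← mul_assoc, ← C_mul, ← zpow_neg_one, ← zpow_add₀ q.ne_zero]
    congr 3
    push_cast
    ring

theorem α_iterate_injective (l : ℕ) : Function.Injective (α p q)^[l] :=
  (α p q).injective.iterate l

theorem α_iterate_surjective (l : ℕ) : Function.Surjective (α p q)^[l] :=
  (α p q).surjective.iterate l

/-- The ideals `α⁻ˡ((z_p - μ)A)` are generated by the linear factors of `rootPoly`. -/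
theorem exists_eq_mul_rootPoly (hq : ∀ k : ℤ, k ≠ 0 → (q : K) ^ k ≠ 1) {μ : K} (hμ : μ ≠ 0)
    (F : Finset ℕ) {b : A p q} (h : ∀ l ∈ F, (α p q)^[l] b ∈ maxIdeal p hp q μ) :
    ∃ b', b = b' * aeval (zp p hp q : A p q) (rootPoly (q : K) μ F) := by
  classical
  induction F using Finset.induction_on with
  | empty => exact ⟨b, by simp [rootPoly]⟩
  | insert l F hl ih =>
    obtain ⟨b', hb'⟩ := ih fun l hl => h l (Finset.mem_insert_of_mem hl)
    have h1 := h l (Finset.mem_insert_self _ _)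
    have hc : ∀ (P : K[X]) (b : A p q), aeval (zp p hp q : A p q) P * b =
      b * aeval (zp p hp q : A p q) P := fun P b => aeval_mul_comm_of_central zp_mul P b
    rw [hb', ← hc, iterate_map_mul, α_iterate_aeval] at h1
    have h2 := mem_maxIdeal_of_aeval_mul (by
      rw [eval_comp, eval_mul, eval_C, eval_X, rootPoly, eval_prod, Finset.prod_ne_zero_iff]
      intro k hk
      rw [eval_sub, eval_X, eval_C, ← sub_mul]
      refine mul_ne_zero (sub_ne_zero.2 fun e => ?_) hμ
      have hkl : k ≠ l := fun e => hl (e ▸ hk)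
      refine hq (-(l : ℤ) - -(k : ℤ)) (by omega) ?_
      rw [zpow_sub₀ q.ne_zero, e, div_self (zpow_ne_zero _ q.ne_zero)]) h1
    obtain ⟨t, ht⟩ := mem_maxIdeal_iff.1 h2
    obtain ⟨t', rfl⟩ := α_iterate_surjective l t
    have hql : (q : K) ^ (-(l : ℤ)) ≠ 0 := zpow_ne_zero _ q.ne_zero
    have h3 : b' = ((q : K) ^ (-(l : ℤ)))⁻¹ •
        (t' * aeval (zp p hp q : A p q) (X - C ((q : K) ^ (-(l : ℤ)) * μ))) := by
      refine α_iterate_injective l ?_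
      have e : (q : K) ^ (-(l : ℤ)) • ((zp p hp q : A p q) - algebraMap K _ μ) =
          (α p q)^[l] (aeval (zp p hp q : A p q) (X - C ((q : K) ^ (-(l : ℤ)) * μ))) := by
        rw [α_iterate_aeval, sub_comp, X_comp, C_comp, map_sub, map_mul, aeval_C, aeval_X, aeval_C,
          smul_sub, Algebra.smul_def, map_mul, Algebra.smul_def]
      rw [ht, ← hc, Ambiskew.iterate_smul, iterate_map_mul, ← e, smul_mul_assoc, smul_smul,
        inv_mul_cancel₀ hql, one_smul]
    refine ⟨((q : K) ^ (-(l : ℤ)))⁻¹ • t', ?_⟩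
    conv_lhs => rw [hb', h3]
    have e : rootPoly (q : K) μ (insert l F) =
      (X - C ((q : K) ^ (-(l : ℤ)) * μ)) * rootPoly (q : K) μ F := Finset.prod_insert hl
    rw [e, map_mul (aeval (zp p hp q : A p q)), smul_mul_assoc, smul_mul_assoc, mul_assoc]

theorem proj_surjective (a : K) : Function.Surjective (proj p hp q a) :=
  RingCon.mk'_surjective _

theorem proj_eq_zero_iff {a : K} {w : R p hp q} :
    proj p hp q a w = 0 ↔ w ∈ zIdeal p hp q a := by
  rw [proj, ← TwoSidedIdeal.mem_ker, TwoSidedIdeal.ker_ringCon_mk']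

theorem proj_eq_proj_iff {a : K} {w w' : R p hp q} :
    proj p hp q a w = proj p hp q a w' ↔ w - w' ∈ zIdeal p hp q a := by
  rw [← proj_eq_zero_iff, map_sub, sub_eq_zero]

/-- The assumption that `a` is the exceptional scalar with exponent `m` and that
`z_p (u + a) = q (z_p - μ) (z_p - q⁻ᵐ μ)`. -/
structure IsExceptional (p : ℕ) (q : Kˣ) (a μ : K) (m : ℕ) : Prop where
  one_le : 1 ≤ m
  ne_zero : μ ≠ 0
  value : a = -(q : K) * μ * (1 + (q : K) ^ (-(m : ℤ)))
  pow : (q : K) ^ ((p - 1) / 2) = q * (q : K) ^ (-(m : ℤ)) * μ ^ 2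

section exceptional

variable {a μ : K} {m : ℕ}

/-- The element `αˡ(u) + a`, where `Q = qˡ`, lies in `(z_p - μ)A` if `Q = 1` or `Q = qᵐ`. -/
theorem u_add_mem_maxIdeal (h : IsExceptional p q a μ m) {Q : K} (hQ : Q ≠ 0)
    (hQm : μ = Q * μ ∨ μ = Q * (q : K) ^ (-(m : ℤ)) * μ) :
    (Q * (q : K) ^ ((p - 1) / 2)) • (((zp p hp q)⁻¹ : (A p q)ˣ) : A p q) +
      (Q⁻¹ * q) • (zp p hp q : A p q) + algebraMap K _ a ∈ maxIdeal p hp q μ := by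
  have hz : (zp p hp q : A p q) * (((zp p hp q)⁻¹ : (A p q)ˣ) : A p q) = 1 := Units.mul_inv _
  have hz' : (((zp p hp q)⁻¹ : (A p q)ˣ) : A p q) * (zp p hp q : A p q) = 1 := Units.inv_mul _
  have e : (Q * (q : K) ^ ((p - 1) / 2)) • (((zp p hp q)⁻¹ : (A p q)ˣ) : A p q) +
      (Q⁻¹ * q) • (zp p hp q : A p q) + algebraMap K _ a =
      (((zp p hp q)⁻¹ : (A p q)ˣ) : A p q) * aeval (zp p hp q : A p q)
        (C (Q⁻¹ * q) * ((X - C (Q * μ)) * (X - C (Q * (q : K) ^ (-(m : ℤ)) * μ)))) := by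
    simp only [map_mul, map_sub, aeval_X, aeval_C, Algebra.algebraMap_eq_smul_one, mul_sub,
      sub_mul, mul_smul_comm, smul_mul_assoc, one_mul, mul_one, smul_smul, ← mul_assoc, hz',
      h.value, h.pow]
    have hq := q.ne_zero
    generalize (q : K) ^ (-(m : ℤ)) = N
    match_scalars <;> (field_simp; try ring)
  rw [e]
  refine TwoSidedIdeal.mul_mem_left _ _ _ (aeval_mem_maxIdeal ?_)
  rw [eval_mul, eval_mul, eval_sub, eval_sub, eval_X, eval_C, eval_C, eval_C]
  rcases hQm with h1 | h1
  · rw [← h1, sub_self, zero_mul, mul_zero]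
  · rw [← h1, sub_self, mul_zero, mul_zero]

theorem α_iterate_u (l : ℕ) : (α p q)^[l] (u p hp q) =
    ((q : K) ^ l * (q : K) ^ ((p - 1) / 2)) • (((zp p hp q)⁻¹ : (A p q)ˣ) : A p q) +
      (((q : K) ^ l)⁻¹ * q) • (zp p hp q : A p q) := by
  induction l with
  | zero => simp [u]
  | succ l ih =>
    rw [Function.iterate_succ_apply', ih, map_add, map_smul, map_smul, α_zp, α_zp_inv, smul_smul,
      smul_smul, pow_succ, mul_inv]
    congr 2 <;> ring

theorem α_iterate_algebraMap (l : ℕ) (a : K) :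
    (α p q)^[l] (algebraMap K _ a) = algebraMap K _ a := by
  induction l with
  | zero => rfl
  | succ l ih => rw [Function.iterate_succ_apply', ih, AlgEquiv.commutes]

/-- `J((z_p - μ)A)` is a two-sided ideal. -/
theorem mul_mem_quotJ (h : IsExceptional p q a μ m) {w}
    (hw : w ∈ quotJ p hp q a μ m) (r : (zIdeal p hp q a).ringCon.Quotient) :
    r * w ∈ quotJ p hp q a μ m ∧ w * r ∈ quotJ p hp q a μ m := by
  have hz : proj p hp q a (z p hp q) = proj p hp q a (incl p hp q (algebraMap K _ a)) := by
    rw [proj_eq_proj_iff, AlgHom.commutes]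
    exact sub_mem_zIdeal a
  have hY : ∀ b, proj p hp q a (genY p hp q) * ((proj p hp q a).comp (incl p hp q).toRingHom) b =
      ((proj p hp q a).comp (incl p hp q).toRingHom) (α p q b) * proj p hp q a (genY p hp q) :=
    fun b => by
      have := congrArg (proj p hp q a) (genY_mul_incl (hp := hp) b)
      rwa [map_mul, map_mul] at this
  have hX : ∀ b, proj p hp q a (genX p hp q) * ((proj p hp q a).comp (incl p hp q).toRingHom) b =
      ((proj p hp q a).comp (incl p hp q).toRingHom) ((α p q).symm b) *
        proj p hp q a (genX p hp q) :=
    fun b => by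
      have := congrArg (proj p hp q a) (genX_mul_incl (hp := hp) b)
      rwa [map_mul, map_mul] at this
  have hXY : proj p hp q a (genX p hp q) * proj p hp q a (genY p hp q) =
      ((proj p hp q a).comp (incl p hp q).toRingHom) (u p hp q + algebraMap K _ a) := by
    rw [← map_mul, genX_mul_genY, map_add, hz, ← map_add, ← map_add, add_comm]
    rfl
  have hYX : proj p hp q a (genY p hp q) * proj p hp q a (genX p hp q) =
      ((proj p hp q a).comp (incl p hp q).toRingHom) (α p q (u p hp q + algebraMap K _ a)) := by
    rw [map_add (α p q), AlgEquiv.commutes, ← map_mul, genY_mul_genX, map_add, hz, ← map_add,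
      ← map_add, add_comm]
    rfl
  have hb : u p hp q + algebraMap K _ a ∈ maxIdeal p hp q μ := by
    have := u_add_mem_maxIdeal (hp := hp) h one_ne_zero (Or.inl (one_mul μ).symm)
    rwa [one_mul, inv_one, one_mul] at this
  have hb' : (α p q)^[m] (u p hp q + algebraMap K _ a) ∈ maxIdeal p hp q μ := by
    have e : (α p q)^[m] (u p hp q + algebraMap K _ a) =
        (α p q)^[m] (u p hp q) + (α p q)^[m] (algebraMap K _ a) := iterate_map_add _ _ _ _
    rw [e, α_iterate_u, α_iterate_algebraMap]
    refine u_add_mem_maxIdeal (hp := hp) h (pow_ne_zero _ q.ne_zero) (Or.inr ?_)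
    rw [zpow_neg, zpow_natCast, mul_inv_cancel₀ (pow_ne_zero _ q.ne_zero), one_mul]
  have hl : ∀ {w}, w ∈ quotJ p hp q a μ m → _ := fun hw =>
    Ambiskew.mul_left_mem_gradedJ hY hX hXY hYX hb hb' hw
  have hr : ∀ {w}, w ∈ quotJ p hp q a μ m → _ := fun hw =>
    Ambiskew.mul_right_mem_gradedJ hY hX hXY hYX hb hb' hw
  have hlp : ∀ {T : (zIdeal p hp q a).ringCon.Quotient},
      (∀ w ∈ quotJ p hp q a μ m, T * w ∈ quotJ p hp q a μ m) → ∀ (n : ℕ),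
      ∀ w ∈ quotJ p hp q a μ m, T ^ n * w ∈ quotJ p hp q a μ m := by
    intro T hT n
    induction n with
    | zero => simp
    | succ n ih =>
      intro w hw
      rw [pow_succ', mul_assoc]
      exact hT _ (ih w hw)
  have hrp : ∀ {T : (zIdeal p hp q a).ringCon.Quotient},
      (∀ w ∈ quotJ p hp q a μ m, w * T ∈ quotJ p hp q a μ m) → ∀ (n : ℕ),
      ∀ w ∈ quotJ p hp q a μ m, w * T ^ n ∈ quotJ p hp q a μ m := by
    intro T hT n
    induction n with
    | zero => simp
    | succ n ih =>
      intro w hw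
      rw [pow_succ, ← mul_assoc]
      exact hT _ (ih w hw)
  obtain ⟨r, rfl⟩ := proj_surjective a r
  refine R_induction r ?_ (fun f g hf hg => ?_) fun b i j => ?_
  · rw [map_zero, zero_mul, mul_zero]
    exact ⟨zero_mem _, zero_mem _⟩
  · rw [map_add, add_mul, mul_add]
    exact ⟨add_mem hf.1 hg.1, add_mem hf.2 hg.2⟩
  · rw [map_mul, map_mul, map_pow, map_pow, mul_assoc, mul_assoc, ← mul_assoc w,
      ← mul_assoc w]
    exact ⟨(hl (hlp (fun w hw => (hl hw).2.1) i _
        (hlp (fun w hw => (hl hw).2.2) j _ hw))).1 b,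
      hrp (fun w hw => (hr hw).2.2) j _ (hrp (fun w hw => (hr hw).2.1) i _ ((hr hw).1 b))⟩

variable (p hp q) in
/-- The ideal `J((z_p - μ)A)` of `R/(z - a)R`. -/
noncomputable def quotIdeal (h : IsExceptional p q a μ m) :
    TwoSidedIdeal (zIdeal p hp q a).ringCon.Quotient :=
  TwoSidedIdeal.mk' (quotJ p hp q a μ m) (zero_mem _) add_mem neg_mem
    (fun hw => (mul_mem_quotJ h hw _).1) (fun hw => (mul_mem_quotJ h hw _).2)

theorem mem_quotIdeal (h : IsExceptional p q a μ m) {w} :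
    w ∈ quotIdeal p hp q h ↔ w ∈ quotJ p hp q a μ m :=
  TwoSidedIdeal.mem_mk' ..

variable (p hp q) in
/-- The preimage in `R` of the ideal `J((z_p - μ)A)` of `R/(z - a)R`. -/
noncomputable def expIdeal (h : IsExceptional p q a μ m) : TwoSidedIdeal (R p hp q) :=
  (quotIdeal p hp q h).comap (proj p hp q a)

theorem mem_expIdeal (h : IsExceptional p q a μ m) {w} :
    w ∈ expIdeal p hp q h ↔ proj p hp q a w ∈ quotJ p hp q a μ m := by
  rw [expIdeal, TwoSidedIdeal.mem_comap, mem_quotIdeal]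

end exceptional

end TorusExample

namespace TorusExample

open QTorus Polynomial

variable {K : Type*} [Field K] {p : ℕ} {hp : Odd p} {q : Kˣ} {a μ : K} {m : ℕ}

theorem sub_mem_expIdeal (h : IsExceptional p q a μ m) :
    z p hp q - algebraMap K _ a ∈ expIdeal p hp q h := by
  rw [mem_expIdeal, proj_eq_zero_iff.2 (sub_mem_zIdeal a)]
  exact zero_mem _

theorem incl_mul_genY_pow_mem (h : IsExceptional p q a μ m) {i : ℕ} {b : A p q}
    (hb : ∀ l, l + i < m → (α p q)^[l] b ∈ maxIdeal p hp q μ) :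
    incl p hp q b * genY p hp q ^ i ∈ expIdeal p hp q h := by
  rw [mem_expIdeal, map_mul, map_pow]
  exact Ambiskew.mul_Y_pow_mem_gradedJ hb

theorem incl_mul_genX_pow_mem (h : IsExceptional p q a μ m) {i : ℕ} {b : A p q}
    (hb : ∀ l, i ≤ l → l < m → (α p q)^[l] b ∈ maxIdeal p hp q μ) :
    incl p hp q b * genX p hp q ^ i ∈ expIdeal p hp q h := by
  rw [mem_expIdeal, map_mul, map_pow]
  exact Ambiskew.mul_X_pow_mem_gradedJ hb

theorem genY_pow_mem (h : IsExceptional p q a μ m) : genY p hp q ^ m ∈ expIdeal p hp q h := by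
  have := incl_mul_genY_pow_mem (hp := hp) h (i := m) (b := 1) fun l hl => by omega
  rwa [map_one, one_mul] at this

theorem zIdeal_lt_expIdeal (hq : ∀ n : ℕ, 0 < n → q ^ n ≠ 1) (h : IsExceptional p q a μ m) :
    zIdeal p hp q a < expIdeal p hp q h := by
  refine lt_of_le_of_ne (zIdeal_le_iff.2 (sub_mem_expIdeal h)) fun e => ?_
  have := genY_pow_mem (hp := hp) h
  rw [← e, mem_zIdeal_iff hq, map_pow] at this
  exact pow_ne_zero _ (phi_genY_ne_zero a) this

/-! ### The exceptional ideals are proper -/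

variable (p q) in
/-- The linear functional on the larger quantum torus that sends `z_pᵏ` to `μᵏ` and the monomials
that involve other generators to `0`. -/
noncomputable def functional (μ : K) : A (p + 1) q →ₗ[K] K :=
  liftLin _ fun g => if ∀ i : Fin (p + 1), i.val ≠ p - 1 → g i = 0 then
    μ ^ g ⟨p - 1, by omega⟩ else 0

theorem snocHom_zp : snocHom p q (zp p hp q : A p q) =
    mono _ (Pi.single ⟨p - 1, by omega⟩ 1 : Fin (p + 1) → ℤ) := by
  have e : (zp p hp q : A p q) = mono _ (Pi.single ⟨p - 1, by have := hp.pos; omega⟩ 1) := rfl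
  rw [e, snocHom_mono]
  congr 1
  have := hp.pos
  funext i
  refine Fin.lastCases ?_ (fun i => ?_) i
  · rw [Fin.snoc_last, Pi.single_eq_of_ne]
    intro h
    have := congrArg Fin.val h
    simp only [Fin.val_last] at this
    omega
  · rw [Fin.snoc_castSucc, Pi.single_apply, Pi.single_apply]
    refine if_congr ?_ rfl rfl
    simp [Fin.ext_iff]

/-- The functional takes the multiplication by `z_p` on either side to the multiplication by `μ`. -/
theorem functional_zp_mul (hp : Odd p) (hμ : μ ≠ 0) (w : A (p + 1) q) :
    functional p q μ (snocHom p q (zp p hp q : A p q) * w) = μ * functional p q μ w ∧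
      functional p q μ (w * snocHom p q (zp p hp q : A p q)) = μ * functional p q μ w := by
  have hp2 : p % 2 = 1 := Nat.odd_iff.1 hp
  have key : ∀ g : Fin (p + 1) → ℤ,
      (if ∀ i : Fin (p + 1), i.val ≠ p - 1 →
          (Pi.single (⟨p - 1, by omega⟩ : Fin (p + 1)) (1 : ℤ) + g : Fin (p + 1) → ℤ) i = 0 then
        μ ^ (Pi.single (⟨p - 1, by omega⟩ : Fin (p + 1)) (1 : ℤ) + g : Fin (p + 1) → ℤ)
          ⟨p - 1, by omega⟩ else 0) =
      μ * (if ∀ i : Fin (p + 1), i.val ≠ p - 1 → g i = 0 then μ ^ g ⟨p - 1, by omega⟩ else 0) := by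
    intro g
    have hiff : (∀ i : Fin (p + 1), i.val ≠ p - 1 →
        (Pi.single (⟨p - 1, by omega⟩ : Fin (p + 1)) (1 : ℤ) + g : Fin (p + 1) → ℤ) i = 0) ↔
        ∀ i : Fin (p + 1), i.val ≠ p - 1 → g i = 0 := by
      refine forall_congr' fun i => imp_congr_right fun hi => ?_
      rw [Pi.add_apply, Pi.single_eq_of_ne (fun e => hi (by rw [e])), zero_add]
    rw [if_congr hiff rfl rfl]
    split_ifs
    · rw [Pi.add_apply, Pi.single_eq_same, zpow_add₀ hμ, zpow_one]
    · rw [mul_zero]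
  rw [snocHom_zp]
  constructor
  · refine QTorus.induction_on (P := fun w => functional p q μ (mono _ _ * w) =
      μ * functional p q μ w) w (by simp)
      (fun f g hf hg => by rw [mul_add, map_add, hf, hg, map_add, mul_add]) fun c g => ?_
    have e : torusCocycle (qMatrix (p + 1) q) (Pi.single ⟨p - 1, by omega⟩ 1) g = 1 := by
      rw [cocycle_single_left]
      refine Finset.prod_eq_one fun j _ => ?_
      have hQ : qMatrix (p + 1) q ⟨p - 1, by omega⟩ j = 1 := by
        rw [qMatrix, if_neg]
        intro h
        have := Nat.even_iff.1 h.1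
        simp only at this
        omega
      rw [hQ, one_zpow, ite_self]
    rw [mul_smul_comm, map_smul, map_smul, mono_mul_mono, e, Units.val_one, one_smul, functional,
      liftLin_mono, liftLin_mono, key, smul_eq_mul, smul_eq_mul, mul_left_comm]
  · refine QTorus.induction_on (P := fun w => functional p q μ (w * mono _ _) =
      μ * functional p q μ w) w (by simp)
      (fun f g hf hg => by rw [add_mul, map_add, hf, hg, map_add, mul_add]) fun c g => ?_
    rw [smul_mul_assoc, map_smul, map_smul, mono_mul_mono, map_smul, functional,
      add_comm g (Pi.single _ _ : Fin (p + 1) → ℤ),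
      liftLin_mono, liftLin_mono, key, smul_eq_mul, smul_eq_mul, smul_eq_mul]
    by_cases hg : ∀ i : Fin (p + 1), i.val ≠ p - 1 → g i = 0
    · have e : torusCocycle (qMatrix (p + 1) q) g (Pi.single ⟨p - 1, by omega⟩ 1) = 1 := by
        rw [cocycle_single_right]
        refine Finset.prod_eq_one fun i _ => ?_
        split_ifs with hi
        · rw [hg i (by rw [Fin.lt_def] at hi; simp only at hi; omega), zpow_zero]
        · rfl
      rw [e, Units.val_one, one_mul]
      ring
    · rw [if_neg hg]
      ring

/-- A functional with `1 ↦ 1` vanishes on the exceptional ideal. -/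
theorem expIdeal_ne_top (hq : ∀ n : ℕ, 0 < n → q ^ n ≠ 1) (h : IsExceptional p q a μ m) :
    expIdeal p hp q h ≠ ⊤ := by
  have hr := rankOne (hp := hp) hq
  have hm := h.one_le
  -- elements of non-zero degree are eigenvectors for the conjugation by `z_p`
  have hzero : ∀ (w : R p hp q) (k : ℤ), k ≠ 0 →
      w * incl p hp q (zp p hp q) = (q : K) ^ k • (incl p hp q (zp p hp q) * w) →
      functional p q μ (phi p hp q a w) = 0 := by
    intro w k hk hw
    have h1 := congrArg (fun w => functional p q μ (phi p hp q a w)) hw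
    simp only [map_mul, map_smul, phi_incl, (functional_zp_mul hp h.ne_zero _).1,
      (functional_zp_mul hp h.ne_zero _).2, smul_eq_mul] at h1
    have h2 : ((q : K) ^ k - 1) * (μ * functional p q μ (phi p hp q a w)) = 0 := by
      rw [sub_mul, one_mul, ← h1, sub_self]
    rcases mul_eq_zero.1 h2 with h3 | h3
    · exact absurd (sub_eq_zero.1 h3) (hr.zpow_ne_one k hk)
    · exact (mul_eq_zero.1 h3).resolve_left h.ne_zero
  have hbase : ∀ b ∈ maxIdeal p hp q μ,
      functional p q μ (phi p hp q a (incl p hp q b)) = 0 := by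
    intro b hb
    obtain ⟨t, rfl⟩ := mem_maxIdeal_iff.1 hb
    rw [phi_incl, map_mul, map_sub, AlgHom.commutes, sub_mul, map_sub,
      (functional_zp_mul hp h.ne_zero _).1, ← Algebra.smul_def, map_smul, smul_eq_mul, sub_self]
  let H : AddSubgroup (R p hp q) :=
    (((functional p q μ) ∘ₗ (phi p hp q a).toLinearMap).toAddMonoidHom).ker
  have hH : ∀ w, w ∈ H ↔ functional p q μ (phi p hp q a w) = 0 := fun w => AddMonoidHom.mem_ker
  have key : ∀ v ∈ quotJ p hp q a μ m, v ∈ H.map (proj p hp q a).toAddMonoidHom := by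
    intro v hv
    refine Ambiskew.gradedJ_le_comap (f := AddMonoidHom.id _) (fun i b hb => ?_)
      (fun i b hb => ?_) hv
    · refine ⟨incl p hp q b * genY p hp q ^ i, ?_, by
        simp only [RingHom.toAddMonoidHom_eq_coe, AddMonoidHom.coe_coe, map_mul, map_pow]; rfl⟩
      rw [SetLike.mem_coe, hH]
      rcases i with _ | i
      · rw [pow_zero, mul_one]
        exact hbase b (hb 0 (by omega))
      · refine hzero _ (-(i + 1 : ℕ)) (by omega) ?_
        rw [mul_assoc, hr.y_pow_mul_t, mul_smul_comm, ← mul_assoc, ← mul_assoc, ← map_mul,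
          ← map_mul, zp_mul, zpow_neg, zpow_natCast, inv_pow]
    · refine ⟨incl p hp q b * genX p hp q ^ i, ?_, by
        simp only [RingHom.toAddMonoidHom_eq_coe, AddMonoidHom.coe_coe, map_mul, map_pow]; rfl⟩
      rw [SetLike.mem_coe, hH]
      rcases i with _ | i
      · rw [pow_zero, mul_one]
        exact hbase b (hb 0 le_rfl (by omega))
      · refine hzero _ (i + 1 : ℕ) (by omega) ?_
        rw [mul_assoc, hr.swap.y_pow_mul_t, mul_smul_comm, ← mul_assoc, ← mul_assoc, ← map_mul,
          ← map_mul, zp_mul, zpow_natCast, inv_inv]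
  rw [Ne, ← TwoSidedIdeal.one_mem_iff, mem_expIdeal]
  intro h1
  obtain ⟨w, hw, hw1⟩ := key _ h1
  have h2 : phi p hp q a w = phi p hp q a 1 := by
    rw [← sub_eq_zero, ← map_sub, ← mem_zIdeal_iff hq, ← proj_eq_proj_iff]
    exact hw1
  rw [SetLike.mem_coe, hH, h2, map_one, one_def, functional, liftLin_mono, if_pos (by simp)] at hw
  simp at hw

/-! ### The exceptional ideals lie in all ideals above `z - a` -/

theorem mono_single_natCast (hp : Odd p) (n : ℕ) :
    mono (qMatrix p q) (Pi.single ⟨p - 1, by have := hp.pos; omega⟩ (n : ℤ)) =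
      (zp p hp q : A p q) ^ n := by
  induction n with
  | zero => simp [one_def]
  | succ n ih =>
    have e : (zp p hp q : A p q) = mono _ (Pi.single ⟨p - 1, by have := hp.pos; omega⟩ 1) := rfl
    rw [pow_succ, ← ih, e, mono_mul_mono, cocycle_single_single, if_neg (lt_irrefl _),
      Units.val_one, one_smul, ← Pi.single_add]
    push_cast
    rfl

/-- An ideal that contains a polynomial in `z_p` contains powers of `x` and of `y`. -/
theorem exists_pow_mem_of_aeval_mem (hq : ∀ n : ℕ, 0 < n → q ^ n ≠ 1) {I : TwoSidedIdeal (R p hp q)}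
    {P : K[X]} (hP : P ≠ 0) (hI : aeval (incl p hp q (zp p hp q)) P ∈ I) :
    (∃ N, genY p hp q ^ N ∈ I) ∧ ∃ N, genX p hp q ^ N ∈ I := by
  classical
  let e : ℕ → (Fin p → ℤ) × ℤ := fun n =>
    (Pi.single ⟨p - 1, by have := hp.pos; omega⟩ (n : ℤ), 0)
  have he : Function.Injective e := by
    intro i j hij
    have := Pi.single_injective _ (congrArg Prod.fst hij)
    exact_mod_cast this
  let c : (Fin p → ℤ) × ℤ →₀ K[X] :=
    ∑ n ∈ P.support, Finsupp.single (e n) (C (P.coeff n))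
  have hc : comb p hp q c = aeval (incl p hp q (zp p hp q)) P := by
    rw [map_sum, aeval_eq_sum_range' (Nat.lt_succ_self _), ← Finset.sum_subset
      (supp_subset_range (Nat.lt_succ_self _)) (fun n _ hn => by
        rw [notMem_support_iff.1 hn, zero_smul])]
    refine Finset.sum_congr rfl fun n _ => ?_
    rw [comb_single, aeval_C, basisElt, mono_single_natCast, ← Algebra.smul_def, map_pow]
    have := genPow_natCast (hp := hp) (q := q) 0
    rw [Nat.cast_zero, pow_zero] at this
    rw [this, mul_one]
  have hcg : c (e P.natDegree) = C P.leadingCoeff := by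
    rw [Finsupp.finsetSum_apply, Finset.sum_eq_single P.natDegree]
    · rw [Finsupp.single_eq_same, leadingCoeff]
    · intro n _ hn
      rw [Finsupp.single_eq_of_ne]
      exact fun h => hn (he h.symm)
    · intro h
      rw [notMem_support_iff.1 h, C_0, Finsupp.single_zero, Finsupp.zero_apply]
  obtain ⟨h1, h2⟩ := exists_mul_pow_mem hq I (hc ▸ hI) (e P.natDegree)
  have hl : P.leadingCoeff ≠ 0 := leadingCoeff_ne_zero.2 hP
  obtain ⟨N, hN⟩ := h1 le_rfl
  obtain ⟨N', hN'⟩ := h2 le_rfl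
  rw [hcg, aeval_C, ← Algebra.smul_def, I.smul_mem_iff_of_ne_zero hl] at hN hN'
  exact ⟨⟨N, hN⟩, ⟨N', hN'⟩⟩

theorem rootPoly_ne_zero {q μ : K} (F : Finset ℕ) : rootPoly q μ F ≠ 0 :=
  Finset.prod_ne_zero_iff.2 fun _ _ => X_sub_C_ne_zero _

/-- One of `yᵐ` and `xᵐ` lies in `I` by the descent of powers. Then so does a non-zero polynomial in
`z_p`, and that gives the other one. -/
theorem pow_mem_of_lt (hq : ∀ n : ℕ, 0 < n → q ^ n ≠ 1) (h : IsExceptional p q a μ m)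
    {I : TwoSidedIdeal (R p hp q)} (hI : zIdeal p hp q a < I) :
    genY p hp q ^ m ∈ I ∧ genX p hp q ^ m ∈ I := by
  have hr := rankOne (hp := hp) hq
  have hz := zIdeal_le_iff.1 hI.le
  obtain ⟨ha', hs'⟩ := hr.swap_exceptional h.value h.pow
  have hμ' : (q : K) ^ (1 - (m : ℤ)) * μ ≠ 0 := mul_ne_zero (zpow_ne_zero _ q.ne_zero) h.ne_zero
  have hroot : rootPoly (q : K) μ (Finset.range m) ∈ I.polyIdeal (incl p hp q (zp p hp q)) 1 := by
    rcases exists_pow_mem_of_lt hq hI with ⟨N, hN⟩ | ⟨N, hN⟩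
    · have := hr.rootPoly_mem h.ne_zero h.value h.pow hz
        (hr.y_pow_mem_of_pow_mem h.ne_zero h.value h.pow hz N hN) m 0 (by omega)
      rwa [pow_zero] at this
    · have := hr.rootPoly_mem_x h.ne_zero h.value h.pow hz
        (hr.swap.y_pow_mem_of_pow_mem hμ' ha' hs' hz N hN) (Nat.zero_le m)
      rwa [pow_zero, ← Finset.range_eq_Ico] at this
  rw [TwoSidedIdeal.mem_polyIdeal, mul_one] at hroot
  obtain ⟨⟨N, hN⟩, ⟨N', hN'⟩⟩ := exists_pow_mem_of_aeval_mem hq (rootPoly_ne_zero _) hroot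
  exact ⟨hr.y_pow_mem_of_pow_mem h.ne_zero h.value h.pow hz N hN,
    hr.swap.y_pow_mem_of_pow_mem hμ' ha' hs' hz N' hN'⟩

theorem incl_aeval (P : K[X]) : incl p hp q (aeval (zp p hp q : A p q) P) =
    aeval (incl p hp q (zp p hp q)) P :=
  (aeval_algHom_apply (incl p hp q) _ P).symm

/-- The exceptional ideal is the smallest ideal strictly above `(z - a)R`. -/
theorem expIdeal_le_of_lt (hq : ∀ n : ℕ, 0 < n → q ^ n ≠ 1) (h : IsExceptional p q a μ m)
    {I : TwoSidedIdeal (R p hp q)} (hI : zIdeal p hp q a < I) : expIdeal p hp q h ≤ I := by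
  have hr := rankOne (hp := hp) hq
  have hz := zIdeal_le_iff.1 hI.le
  obtain ⟨hy, hx⟩ := pow_mem_of_lt hq h hI
  have hmem : ∀ {F : Finset ℕ} {b : A p q} {w : R p hp q},
      (∀ l ∈ F, (α p q)^[l] b ∈ maxIdeal p hp q μ) →
      rootPoly (q : K) μ F ∈ I.polyIdeal (incl p hp q (zp p hp q)) w → incl p hp q b * w ∈ I := by
    intro F b w hb hF
    obtain ⟨b', rfl⟩ := exists_eq_mul_rootPoly hr.zpow_ne_one h.ne_zero F hb
    rw [map_mul, mul_assoc, incl_aeval]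
    exact I.mul_mem_left _ _ hF
  have hIm : ∀ w, w ∈ (AddSubgroup.closure (I : Set (R p hp q))).map
      (proj p hp q a).toAddMonoidHom ↔ ∃ w' ∈ I, proj p hp q a w' = w := by
    intro w
    have : (AddSubgroup.closure (I : Set (R p hp q)) : Set (R p hp q)) = I :=
      congrArg _ (AddSubgroup.closure_eq (AddSubgroup.ofClass I))
    constructor
    · rintro ⟨w', hw', e⟩
      rw [this] at hw'
      exact ⟨w', hw', e⟩
    · rintro ⟨w', hw', e⟩
      exact ⟨w', AddSubgroup.subset_closure hw', e⟩
  intro w hw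
  rw [mem_expIdeal] at hw
  have key := Ambiskew.gradedJ_le_comap (f := AddMonoidHom.id _)
    (H := (AddSubgroup.closure (I : Set (R p hp q))).map (proj p hp q a).toAddMonoidHom)
    (fun i b hb => (hIm _).2 ⟨incl p hp q b * genY p hp q ^ i, ?_, by
      rw [map_mul, map_pow]; rfl⟩)
    (fun i b hb => (hIm _).2 ⟨incl p hp q b * genX p hp q ^ i, ?_, by
      rw [map_mul, map_pow]; rfl⟩) hw
  · obtain ⟨w', hw', e⟩ := (hIm _).1 key
    have h1 := hI.le (proj_eq_proj_iff.1 e)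
    have := I.sub_mem hw' h1
    rwa [sub_sub_cancel] at this
  · rcases le_or_gt i m with him | him
    · refine hmem (F := Finset.range (m - i)) (fun l hl => hb l ?_)
        (hr.rootPoly_mem h.ne_zero h.value h.pow hz hy _ _ (by omega))
      rw [Finset.mem_range] at hl
      omega
    · rw [← Nat.sub_add_cancel him.le, pow_add, ← mul_assoc]
      exact I.mul_mem_left _ _ hy
  · rcases le_or_gt i m with him | him
    · refine hmem (F := Finset.Ico i m) (fun l hl => ?_)
        (hr.rootPoly_mem_x h.ne_zero h.value h.pow hz hx him)
      rw [Finset.mem_Ico] at hl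
      exact hb l hl.1 hl.2
    · rw [← Nat.sub_add_cancel him.le, pow_add, ← mul_assoc]
      exact I.mul_mem_left _ _ hx

end TorusExample

/-! ### The exceptional ideals are maximal -/

namespace TorusExample

open QTorus Polynomial

variable {K : Type*} [Field K] {p : ℕ} {hp : Odd p} {q : Kˣ} {a μ : K} {m : ℕ}

/-- Modulo `z - a`, an element of a single weight is a unit of the quantum torus times a polynomial
in `z_p` times a power of `y` or `x`. -/
theorem exists_comb_sub_mem (a : K) {c : (Fin p → ℤ) × ℤ →₀ K[X]} (g₀ : (Fin p → ℤ) × ℤ)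
    (hc : ∀ g ∈ c.support, ∀ k, totalWt k g = totalWt k g₀) :
    ∃ (b : (A p q)ˣ) (P : K[X]), comb p hp q c -
      incl p hp q (b : A p q) * (aeval (incl p hp q (zp p hp q)) P * genPow p hp q g₀.2) ∈
        zIdeal p hp q a := by
  classical
  let i₀ : Fin p := ⟨p - 1, by have := hp.pos; omega⟩
  -- large enough to make all exponents of `z_p` non-negative
  let N : ℕ := ∑ g ∈ c.support, (g.1 i₀).natAbs
  have hN : ∀ g ∈ c.support, 0 ≤ g.1 i₀ + N := by
    intro g hg
    have := Finset.single_le_sum (f := fun g : (Fin p → ℤ) × ℤ => (g.1 i₀).natAbs)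
      (fun _ _ => Nat.zero_le _) hg
    change (g.1 i₀).natAbs ≤ N at this
    omega
  let e : Fin p → ℤ := Function.update g₀.1 i₀ (-N)
  obtain ⟨b, hb⟩ := isUnit_mono (Q := qMatrix p q) e
  have key : ∀ g ∈ c.support, ∃ κ : K, mono (qMatrix p q) g.1 =
      κ • ((b : A p q) * (zp p hp q : A p q) ^ (g.1 i₀ + N).toNat) := by
    intro g hg
    have hg1 : g.1 = e + Pi.single i₀ (((g.1 i₀ + N).toNat : ℕ) : ℤ) := by
      rw [Int.toNat_of_nonneg (hN g hg)]
      funext i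
      by_cases hi : i = i₀
      · subst hi
        simp [e]
      · rw [Pi.add_apply, Pi.single_eq_of_ne hi, add_zero]
        have he : e i = g₀.1 i := Function.update_of_ne hi _ _
        rw [he]
        exact (eq_of_totalWt hp (hc g hg)).2 i fun h => hi (Fin.ext h)
    refine ⟨((torusCocycle (qMatrix p q) e (Pi.single i₀ (((g.1 i₀ + N).toNat : ℕ) : ℤ)) : Kˣ) :
      K)⁻¹, ?_⟩
    rw [hb, ← mono_single_natCast hp, mono_mul_mono, smul_smul, inv_mul_cancel₀ (Units.ne_zero _),
      one_smul, ← hg1]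
  choose! κ hκ using key
  refine ⟨b, ∑ g ∈ c.support, C (κ g * (c g).eval a) * X ^ (g.1 i₀ + N).toNat, ?_⟩
  rw [map_sum, Finset.sum_mul, Finset.mul_sum, comb_apply, ← Finset.sum_sub_distrib]
  refine sum_mem fun g hg => ?_
  have h1 : incl p hp q (b : A p q) * (aeval (incl p hp q (zp p hp q))
      (C (κ g * (c g).eval a) * X ^ (g.1 i₀ + N).toNat) * genPow p hp q g₀.2) =
      algebraMap K _ ((c g).eval a) * basisElt p hp q g := by
    rw [basisElt, hκ g hg, (eq_of_totalWt hp (hc g hg)).1, map_mul (aeval _), aeval_C, map_pow,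
      aeval_X, ← Algebra.smul_def, ← Algebra.smul_def, map_smul, map_mul, map_pow, smul_mul_assoc,
      smul_mul_assoc, mul_smul_comm, smul_smul, mul_comm (κ g), mul_assoc]
  rw [h1, ← sub_mul]
  exact (zIdeal p hp q a).mul_mem_right _ _ (aeval_z_sub_mem_zIdeal a _)

theorem incl_aeval_mul_genPow_mem (hq : ∀ n : ℕ, 0 < n → q ^ n ≠ 1) (h : IsExceptional p q a μ m)
    {I : TwoSidedIdeal (R p hp q)} (hI : expIdeal p hp q h ≤ I) (htop : I ≠ ⊤) {P : K[X]} {n : ℤ}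
    (hP : P ∈ I.polyIdeal (incl p hp q (zp p hp q)) (genPow p hp q n)) :
    aeval (incl p hp q (zp p hp q)) P * genPow p hp q n ∈ expIdeal p hp q h := by
  have hr := rankOne (hp := hp) hq
  have hz := hI (sub_mem_expIdeal h)
  have hf : rootPoly (q : K) μ (Finset.range m) ∈ I.polyIdeal (incl p hp q (zp p hp q)) 1 := by
    have := hr.rootPoly_mem h.ne_zero h.value h.pow hz (hI (genY_pow_mem h)) m 0 (by omega)
    rwa [pow_zero] at this
  have hroot : ∀ l : ℕ, P.eval ((q : K) ^ (-(l : ℤ)) * μ) = 0 →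
      (α p q)^[l] (aeval (zp p hp q : A p q) P) ∈ maxIdeal p hp q μ := by
    intro l hl
    rw [α_iterate_aeval]
    refine aeval_mem_maxIdeal ?_
    rwa [eval_comp, eval_mul, eval_C, eval_X]
  rw [← incl_aeval]
  obtain ⟨n, rfl | rfl⟩ := Int.eq_nat_or_neg n
  · rw [genPow_natCast] at hP ⊢
    exact incl_mul_genY_pow_mem h fun l hl =>
      hroot l (hr.eval_eq_zero_y h.ne_zero h.value h.pow hz htop hf hP hl)
  · rw [genPow_neg_natCast] at hP ⊢
    exact incl_mul_genX_pow_mem h fun l hn hl =>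
      hroot l (hr.eval_eq_zero_x h.ne_zero h.value h.pow hz htop hf hP hn hl)

/-- A proper ideal `I` above the exceptional ideal is graded, and its homogeneous elements are,
modulo `z - a`, units times polynomials in `z_p` times powers of `y` or `x`. As `I` is proper, these
polynomials have the zeros that put the elements into the exceptional ideal. -/
theorem expIdeal_isCoatom (hq : ∀ n : ℕ, 0 < n → q ^ n ≠ 1) (h : IsExceptional p q a μ m) :
    IsCoatom (expIdeal p hp q h) := by
  classical
  refine ⟨expIdeal_ne_top hq h, fun I hI => by_contra fun htop => hI.not_ge ?_⟩
  have hzle : zIdeal p hp q a ≤ expIdeal p hp q h := (zIdeal_lt_expIdeal hq h).le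
  have key : ∀ (n : ℕ) (c : (Fin p → ℤ) × ℤ →₀ K[X]), c.support.card = n → comb p hp q c ∈ I →
      comb p hp q c ∈ expIdeal p hp q h := by
    intro n
    induction n using Nat.strong_induction_on with
    | _ n ih =>
      intro c hn hc
      rcases c.support.eq_empty_or_nonempty with h0 | ⟨g₀, hg₀⟩
      · rw [Finsupp.support_eq_empty.1 h0, map_zero]
        exact zero_mem _
      -- split off the part of the weight of `g₀`
      set T : (Fin p → ℤ) × ℤ → Prop := fun g => ∀ k, totalWt k g = totalWt k g₀ with hT
      have hsplit : c.filter T + c.filter (fun g => ¬ T g) = c := Finsupp.filter_add_filter_not c T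
      have h1 : comb p hp q (c.filter T) ∈ I :=
        comb_filter_mem I hc g₀ (rankOne (hp := hp) hq).zpow_ne_one
      have h2 : comb p hp q (c.filter fun g => ¬ T g) ∈ I := by
        have := I.sub_mem hc h1
        rwa [← map_sub, sub_eq_of_eq_add' hsplit.symm] at this
      rw [← hsplit, map_add]
      refine add_mem ?_ (ih _ ?_ _ rfl h2)
      · obtain ⟨b, P, hbP⟩ := exists_comb_sub_mem (hp := hp) (q := q) a (c := c.filter T) g₀
          fun g hg => by
            rw [Finsupp.support_filter, Finset.mem_filter] at hg
            exact hg.2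
        have h3 := I.sub_mem h1 (hI.le (hzle hbP))
        rw [sub_sub_cancel] at h3
        have h4 := I.mul_mem_left (incl p hp q ((b⁻¹ : (A p q)ˣ) : A p q)) _ h3
        rw [← mul_assoc, ← map_mul, Units.inv_mul, map_one, one_mul] at h4
        have h5 := (expIdeal p hp q h).mul_mem_left (incl p hp q (b : A p q)) _
          (incl_aeval_mul_genPow_mem hq h hI.le htop (P := P) h4)
        have h6 := add_mem (hzle hbP) h5
        rwa [sub_add_cancel] at h6
      · rw [← hn, Finsupp.support_filter]
        refine Finset.card_lt_card (Finset.filter_ssubset.2 ⟨g₀, hg₀, ?_⟩)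
        exact not_not.2 fun _ => rfl
  intro w hw
  obtain ⟨c, rfl⟩ := comb_surjective w
  exact key _ c rfl hw

theorem _root_.TwoSidedIdeal.isPrimeIdeal_of_isCoatom {S : Type*} [Ring S] {I : TwoSidedIdeal S}
    (hI : IsCoatom I) : I.IsPrimeIdeal := by
  refine ⟨hI.1, fun a b hab => or_iff_not_imp_left.2 fun ha => ?_⟩
  let J : TwoSidedIdeal S := TwoSidedIdeal.mk' {w | ∀ r, w * r * b ∈ I}
    (fun r => by rw [zero_mul, zero_mul]; exact I.zero_mem)
    (fun {w w'} h h' r => by rw [add_mul, add_mul]; exact I.add_mem (h r) (h' r))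
    (fun {w} h r => by rw [neg_mul, neg_mul]; exact I.neg_mem (h r))
    (fun {s w} h r => by rw [mul_assoc, mul_assoc, ← mul_assoc w]; exact I.mul_mem_left _ _ (h r))
    (fun {w s} h r => by rw [mul_assoc w]; exact h (s * r))
  have hJ : ∀ w, w ∈ J ↔ ∀ r, w * r * b ∈ I := fun w => TwoSidedIdeal.mem_mk' ..
  have hlt : I < J := by
    refine lt_of_le_of_ne (fun w hw => (hJ w).2 fun r => ?_) fun e => ha (e ▸ (hJ a).2 hab)
    rw [mul_assoc]
    exact I.mul_mem_right _ _ hw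
  have h1 : (1 : S) ∈ J := by
    rw [hI.2 J hlt]
    trivial
  simpa using (hJ 1).1 h1 1

end TorusExample

/-! ### The exceptional scalars -/

namespace TorusExample

open QTorus Polynomial

variable {K : Type*} [Field K] {p : ℕ} {hp : Odd p} {q r : Kˣ} {a μ : K} {m : ℕ}

theorem isExceptional_lam (hp : Odd p) (hr : r ^ 4 = q) (hm : 1 ≤ m) (ε : ℤˣ) :
    IsExceptional p q (lam p q r m ε)
      (((ε : ℤ) : K) * ((r ^ ((p : ℤ) + 2 * m - 3) : Kˣ) : K)) m := by
  have hε : ((ε : ℤ) : K) ^ 2 = 1 := by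
    rw [← Int.cast_pow, ← Units.val_pow_eq_pow_val, Int.units_sq, Units.val_one, Int.cast_one]
  have hz : ∀ k : ℤ, q ^ k = r ^ (4 * k) := fun k => by
    rw [← hr, ← zpow_natCast, ← zpow_mul]
    norm_num
  have e1 : r ^ ((p : ℤ) - 2 * m + 1) =
      q ^ (1 : ℤ) * q ^ (-(m : ℤ)) * r ^ ((p : ℤ) + 2 * m - 3) := by
    rw [hz, hz, ← zpow_add, ← zpow_add]
    congr 1
    ring
  have e2 : q ^ ((p - 1) / 2) = q ^ (1 : ℤ) * q ^ (-(m : ℤ)) * (r ^ ((p : ℤ) + 2 * m - 3)) ^ 2 := by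
    obtain ⟨k, rfl⟩ := hp
    rw [← zpow_natCast, hz, hz, hz, ← zpow_natCast (r ^ _), ← zpow_mul, ← zpow_add, ← zpow_add]
    congr 1
    have : (2 * k + 1 - 1) / 2 = k := by omega
    rw [this]
    push_cast
    ring
  have e3 := congrArg (Units.val : Kˣ → K) e1
  have e4 := congrArg (Units.val : Kˣ → K) e2
  rw [zpow_one] at e3 e4
  simp only [Units.val_mul, Units.val_pow_eq_pow_val] at e3 e4
  refine ⟨hm, ?_, ?_, ?_⟩
  · refine mul_ne_zero (fun h => ?_) (Units.ne_zero _)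
    rw [h] at hε
    simp at hε
  · have hqm : (q : K) ^ (-(m : ℤ)) * (q : K) ^ m = 1 := by
      rw [zpow_neg, zpow_natCast, inv_mul_cancel₀ (pow_ne_zero _ q.ne_zero)]
    rw [lam, e3, Units.val_zpow_eq_zpow_val q]
    linear_combination (-((ε : ℤ) : K) * q * ((r ^ ((p : ℤ) + 2 * m - 3) : Kˣ) : K)) * hqm
  · rw [mul_pow, hε, one_mul, e4, Units.val_zpow_eq_zpow_val q]

theorem IsExceptional.sq_eq (h : IsExceptional p q a μ m) :
    a ^ 2 = (q : K) ^ ((p - 1) / 2) * q * ((q : K) ^ m)⁻¹ * ((q : K) ^ m + 1) ^ 2 := by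
  have hqm : (q : K) ^ (-(m : ℤ)) * (q : K) ^ m = 1 := by
    rw [zpow_neg, zpow_natCast, inv_mul_cancel₀ (pow_ne_zero _ q.ne_zero)]
  have hinv : ((q : K) ^ m)⁻¹ = (q : K) ^ (-(m : ℤ)) := by rw [zpow_neg, zpow_natCast]
  rw [h.value, h.pow, hinv]
  linear_combination (-(q : K) ^ 2 * μ ^ 2 * (2 * (q : K) ^ (-(m : ℤ)) + 1 +
    (q : K) ^ (-(m : ℤ)) * (q : K) ^ m)) * hqm

theorem lam_neg (ε : ℤˣ) : lam p q r m (-ε) = -lam p q r m ε := by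
  rw [lam, lam, Units.val_neg, Int.cast_neg]
  ring

theorem exists_eq_lam (hp : Odd p) (hr : r ^ 4 = q) (hm : 1 ≤ m)
    (ha : a ^ 2 = (q : K) ^ ((p - 1) / 2) * q * ((q : K) ^ m)⁻¹ * ((q : K) ^ m + 1) ^ 2) :
    ∃ ε : ℤˣ, a = lam p q r m ε := by
  rw [← (isExceptional_lam hp hr hm 1).sq_eq] at ha
  rcases sq_eq_sq_iff_eq_or_eq_neg.1 ha with h | h
  · exact ⟨1, h⟩
  · exact ⟨-1, by rw [h, lam_neg]⟩

theorem lam_inj (hp : Odd p) (hq : ∀ n : ℕ, 0 < n → q ^ n ≠ 1) (hr : r ^ 4 = q) {m' : ℕ}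
    (hm : 1 ≤ m) (hm' : 1 ≤ m') {ε ε' : ℤˣ} (h : lam p q r m ε = lam p q r m' ε') :
    m = m' ∧ ((ε : ℤ) : K) = ((ε' : ℤ) : K) := by
  have hR := rankOne (hp := hp) hq
  have h' := isExceptional_lam hp hr hm' ε'
  have hmm : m = m' := by
    by_contra hne
    obtain ⟨n, rfl⟩ := Nat.exists_eq_add_of_le' hm
    refine hR.sq_ne_of_ne h'.ne_zero h'.value h'.pow hne ?_
    rw [← h]
    exact (isExceptional_lam hp hr hm ε).sq_eq
  subst hmm
  refine ⟨rfl, ?_⟩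
  have h1 : (q : K) ^ m + 1 ≠ 0 := by
    intro e
    refine hR.zpow_ne_one (2 * m : ℕ) (by omega) ?_
    rw [zpow_natCast, mul_comm, pow_mul, eq_neg_of_add_eq_zero_left e]
    ring
  exact neg_injective (mul_right_cancel₀ (Units.ne_zero _) (mul_right_cancel₀ h1 h))

/-! ### The prime spectrum -/

theorem zIdeal_injective (hq : ∀ n : ℕ, 0 < n → q ^ n ≠ 1) :
    Function.Injective (zIdeal p hp q) := fun c c' h =>
  eq_of_sub_mem (zIdeal_isPrime hq c').1 (h ▸ sub_mem_zIdeal c) (sub_mem_zIdeal c')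

theorem zIdeal_le_zIdeal_iff (hq : ∀ n : ℕ, 0 < n → q ^ n ≠ 1) {c c' : K} :
    zIdeal p hp q c ≤ zIdeal p hp q c' ↔ c = c' :=
  ⟨fun h => eq_of_sub_mem (zIdeal_isPrime hq c').1 (zIdeal_le_iff.1 h) (sub_mem_zIdeal c'),
    fun h => h ▸ le_rfl⟩

theorem bot_lt_zIdeal (c : K) : ⊥ < zIdeal p hp q c := by
  refine bot_lt_iff_ne_bot.2 fun h => ?_
  -- otherwise `z` would be a scalar, whereas `phi` takes it to any given scalar
  have h1 := sub_mem_zIdeal (hp := hp) (q := q) c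
  rw [h, TwoSidedIdeal.mem_bot, sub_eq_zero] at h1
  have h2 := congrArg (phi p hp q (c + 1)) h1
  rw [phi_z, AlgHom.commutes] at h2
  have := (algebraMap K (A (p + 1) q)).injective h2
  simp at this

theorem coe_expIdeal (hr : r ^ 4 = q) (hm : 1 ≤ m) (ε : ℤˣ) :
    (expIdeal p hp q (isExceptional_lam hp hr hm ε) : Set (R p hp q)) = F p hp q r m ε :=
  Set.ext fun _ => mem_expIdeal _

theorem expIdeal_congr {a' μ' : K} (h : IsExceptional p q a μ m) (h' : IsExceptional p q a' μ' m)
    (ha : a = a') (hμ : μ = μ') : expIdeal p hp q h = expIdeal p hp q h' := by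
  subst ha hμ
  rfl

theorem coe_eq_F_iff (hr : r ^ 4 = q) (hm : 1 ≤ m) (ε : ℤˣ) {P : TwoSidedIdeal (R p hp q)} :
    (P : Set (R p hp q)) = F p hp q r m ε ↔
      P = expIdeal p hp q (isExceptional_lam hp hr hm ε) := by
  rw [← coe_expIdeal hr hm, SetLike.coe_set_eq]

theorem F_eq_F_iff (hq : ∀ n : ℕ, 0 < n → q ^ n ≠ 1) (hr : r ^ 4 = q) {m' : ℕ}
    (hm : 1 ≤ m) (hm' : 1 ≤ m') {ε ε' : ℤˣ} :
    F p hp q r m ε = F p hp q r m' ε' ↔ m = m' ∧ ((ε : ℤ) : K) = ((ε' : ℤ) : K) := by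
  rw [← coe_expIdeal hr hm, coe_eq_F_iff hr hm']
  constructor
  · intro h
    refine lam_inj hp hq hr hm hm' (eq_of_sub_mem (expIdeal_ne_top hq
      (isExceptional_lam hp hr hm' ε')) (h ▸ sub_mem_expIdeal _) (sub_mem_expIdeal _))
  · rintro ⟨rfl, hε⟩
    exact expIdeal_congr _ _ (by rw [lam, lam, hε]) (by rw [hε])

/-- There are proper ideals strictly above `(z - a)R` only if `a` is exceptional, and then the
exceptional ideal is the only one. -/
theorem exists_eq_expIdeal_of_lt (hq : ∀ n : ℕ, 0 < n → q ^ n ≠ 1) (hr : r ^ 4 = q)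
    {P : TwoSidedIdeal (R p hp q)} (hP : P ≠ ⊤) (h : zIdeal p hp q a < P) :
    ∃ (m : ℕ) (hm : 1 ≤ m) (ε : ℤˣ), a = lam p q r m ε ∧
      P = expIdeal p hp q (isExceptional_lam hp hr hm ε) := by
  have h1 : ∃ (m : ℕ) (ε : ℤˣ), 1 ≤ m ∧ a = lam p q r m ε := by
    by_contra! hne
    refine hP (eq_top_of_lt hq h fun n hn => ?_)
    obtain ⟨ε, hε⟩ := exists_eq_lam hp hr (Nat.le_add_left 1 n) hn
    exact hne _ ε (Nat.le_add_left 1 n) hε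
  obtain ⟨m, ε, hm, rfl⟩ := h1
  have h2 := isExceptional_lam hp hr hm ε
  exact ⟨m, hm, ε, rfl,
    (((expIdeal_isCoatom hq h2).le_iff.1 (expIdeal_le_of_lt hq h2 h)).resolve_left hP)⟩

theorem isCoatom_zIdeal_iff (hq : ∀ n : ℕ, 0 < n → q ^ n ≠ 1) (hr : r ^ 4 = q) (c : K) :
    IsCoatom (zIdeal p hp q c) ↔ ¬ ∃ (m : ℕ) (ε : ℤˣ), 1 ≤ m ∧ c = lam p q r m ε := by
  constructor
  · rintro h ⟨m, ε, hm, rfl⟩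
    have h1 := isExceptional_lam hp hr hm ε
    exact expIdeal_ne_top hq h1 (h.2 _ (zIdeal_lt_expIdeal hq h1))
  · refine fun h => ⟨(zIdeal_isPrime hq c).1, fun P hP => by_contra fun htop => h ?_⟩
    obtain ⟨m, hm, ε, h1, -⟩ := exists_eq_expIdeal_of_lt hq hr htop hP
    exact ⟨m, ε, hm, h1⟩

theorem isPrimeIdeal_iff [IsAlgClosed K] (hq : ∀ n : ℕ, 0 < n → q ^ n ≠ 1) (hr : r ^ 4 = q)
    (P : TwoSidedIdeal (R p hp q)) : P.IsPrimeIdeal ↔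
      P = ⊥ ∨ (∃ c : K, P = zIdeal p hp q c) ∨
      ∃ (m : ℕ) (ε : ℤˣ), 1 ≤ m ∧ (P : Set (R p hp q)) = F p hp q r m ε := by
  have : Infinite K := IsAlgClosed.instInfinite
  constructor
  · intro hP
    refine or_iff_not_imp_left.2 fun h0 => ?_
    obtain ⟨a, ha⟩ := exists_sub_mem_of_isPrime hq hP h0
    rcases ha.eq_or_lt with h | h
    · exact Or.inl ⟨a, h.symm⟩
    · obtain ⟨m, hm, ε, -, h1⟩ := exists_eq_expIdeal_of_lt hq hr hP.1 h
      exact Or.inr ⟨m, ε, hm, (coe_eq_F_iff hr hm ε).2 h1⟩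
  · rintro (rfl | ⟨c, rfl⟩ | ⟨m, ε, hm, h⟩)
    · exact bot_isPrime hq
    · exact zIdeal_isPrime hq c
    · rw [(coe_eq_F_iff hr hm ε).1 h]
      exact TwoSidedIdeal.isPrimeIdeal_of_isCoatom (expIdeal_isCoatom hq _)

theorem height_bot (h : (⊥ : TwoSidedIdeal (R p hp q)).IsPrimeIdeal) :
    Order.height (⟨⊥, h⟩ : PrimeSpec (R p hp q)) = 0 :=
  Order.height_eq_zero.2 fun _ _ => Subtype.coe_le_coe.1 bot_le

theorem height_zIdeal [IsAlgClosed K] (hq : ∀ n : ℕ, 0 < n → q ^ n ≠ 1) (hr : r ^ 4 = q) (c : K)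
    (h : (zIdeal p hp q c).IsPrimeIdeal) :
    Order.height (⟨zIdeal p hp q c, h⟩ : PrimeSpec (R p hp q)) = 1 := by
  refine le_antisymm ?_ (Order.one_le_iff_pos.2 (pos_iff_ne_zero.2 fun h0 => ?_))
  · refine (Order.height_le_coe_iff (n := 1)).2 fun ⟨P, hP⟩ hlt => ?_
    have hlt' : P < zIdeal p hp q c := hlt
    rcases (isPrimeIdeal_iff hq hr P).1 hP with rfl | ⟨c', rfl⟩ | ⟨m, ε, hm, h1⟩
    · rw [height_bot]
      exact zero_lt_one
    · exact absurd (congrArg _ ((zIdeal_le_zIdeal_iff hq).1 hlt'.le)) hlt'.ne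
    · rw [coe_eq_F_iff hr hm] at h1
      subst h1
      exact absurd ((expIdeal_isCoatom hq _).2 _ hlt') h.1
  · have : Infinite K := IsAlgClosed.instInfinite
    have h1 : (⟨⊥, bot_isPrime hq⟩ : PrimeSpec (R p hp q)) ≤ ⟨zIdeal p hp q c, h⟩ :=
      Subtype.coe_le_coe.1 bot_le
    exact (bot_lt_zIdeal c).not_ge (Order.height_eq_zero.1 h0 h1)

theorem height_expIdeal [IsAlgClosed K] (hq : ∀ n : ℕ, 0 < n → q ^ n ≠ 1) (hr : r ^ 4 = q)
    (h : IsExceptional p q a μ m) (hP : (expIdeal p hp q h).IsPrimeIdeal) :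
    Order.height (⟨expIdeal p hp q h, hP⟩ : PrimeSpec (R p hp q)) = 2 := by
  refine le_antisymm ?_ ?_
  · refine (Order.height_le_coe_iff (n := 2)).2 fun ⟨P, hP'⟩ hlt => ?_
    have hlt' : P < expIdeal p hp q h := hlt
    rcases (isPrimeIdeal_iff hq hr P).1 hP' with rfl | ⟨c', rfl⟩ | ⟨m, ε, hm, h1⟩
    · rw [height_bot]
      exact zero_lt_two
    · rw [height_zIdeal hq hr]
      decide
    · rw [coe_eq_F_iff hr hm] at h1
      subst h1
      exact absurd ((expIdeal_isCoatom hq _).2 _ hlt') hP.1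
  · have h1 := height_zIdeal (hp := hp) hq hr a (zIdeal_isPrime hq a)
    have hlt : (⟨zIdeal p hp q a, zIdeal_isPrime hq a⟩ : PrimeSpec (R p hp q)) <
      ⟨expIdeal p hp q h, hP⟩ := zIdeal_lt_expIdeal hq h
    have h2 := Order.height_strictMono hlt (by rw [h1]; exact ENat.one_lt_top)
    rw [h1] at h2
    exact Order.add_one_le_of_lt h2

theorem isPrimeOfHeight_one_iff [IsAlgClosed K] (hq : ∀ n : ℕ, 0 < n → q ^ n ≠ 1)
    (hr : r ^ 4 = q) (P : TwoSidedIdeal (R p hp q)) :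
    P.IsPrimeOfHeight 1 ↔ ∃ c : K, P = zIdeal p hp q c := by
  constructor
  · rintro ⟨hP, h⟩
    rcases (isPrimeIdeal_iff hq hr P).1 hP with rfl | h1 | ⟨m, ε, hm, h1⟩
    · rw [height_bot] at h
      exact absurd h zero_ne_one
    · exact h1
    · rw [coe_eq_F_iff hr hm] at h1
      subst h1
      rw [height_expIdeal hq hr] at h
      exact absurd h (by decide)
  · rintro ⟨c, rfl⟩
    exact ⟨zIdeal_isPrime hq c, height_zIdeal hq hr c _⟩

theorem isPrimeOfHeight_two_iff [IsAlgClosed K] (hq : ∀ n : ℕ, 0 < n → q ^ n ≠ 1)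
    (hr : r ^ 4 = q) (P : TwoSidedIdeal (R p hp q)) :
    P.IsPrimeOfHeight 2 ↔
      ∃ (m : ℕ) (ε : ℤˣ), 1 ≤ m ∧ (P : Set (R p hp q)) = F p hp q r m ε := by
  constructor
  · rintro ⟨hP, h⟩
    rcases (isPrimeIdeal_iff hq hr P).1 hP with rfl | ⟨c, rfl⟩ | h1
    · rw [height_bot] at h
      exact absurd h (by decide)
    · rw [height_zIdeal hq hr] at h
      exact absurd h (by decide)
    · exact h1
  · intro h
    have hP := (isPrimeIdeal_iff hq hr P).2 (Or.inr (Or.inr h))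
    obtain ⟨m, ε, hm, h⟩ := h
    rw [coe_eq_F_iff hr hm] at h
    subst h
    exact ⟨hP, height_expIdeal hq hr _ hP⟩

/-- The ring `R/(z - a)R`, for an exceptional scalar `a`, has a single proper non-zero ideal. -/
theorem isPrimeIdeal_quot_iff (hq : ∀ n : ℕ, 0 < n → q ^ n ≠ 1) (h : IsExceptional p q a μ m)
    (Q : TwoSidedIdeal (zIdeal p hp q a).ringCon.Quotient) :
    (Q.IsPrimeIdeal ∧ Q ≠ ⊥) ↔ Q = quotIdeal p hp q h := by
  have hinj : ∀ {Q Q' : TwoSidedIdeal (zIdeal p hp q a).ringCon.Quotient},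
      Q.comap (proj p hp q a) = Q'.comap (proj p hp q a) → Q = Q' := by
    intro Q Q' e
    refine TwoSidedIdeal.ext fun w => ?_
    obtain ⟨w, rfl⟩ := proj_surjective a w
    rw [← TwoSidedIdeal.mem_comap, e, TwoSidedIdeal.mem_comap]
  have hbot : (⊥ : TwoSidedIdeal (zIdeal p hp q a).ringCon.Quotient).comap (proj p hp q a) =
      zIdeal p hp q a := TwoSidedIdeal.ext fun w => by
    rw [TwoSidedIdeal.mem_comap, TwoSidedIdeal.mem_bot, proj_eq_zero_iff]
  constructor
  · rintro ⟨hQ, h0⟩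
    refine hinj (((expIdeal_isCoatom hq h).le_iff.1 (expIdeal_le_of_lt hq h
      (lt_of_le_of_ne (fun w hw => ?_) fun e => h0 (hinj (hbot.trans e)).symm))).resolve_left
        fun e => hQ.1 ?_)
    · rw [TwoSidedIdeal.mem_comap, proj_eq_zero_iff.2 hw]
      exact zero_mem _
    · have h1 : (1 : R p hp q) ∈ Q.comap (proj p hp q a) := e ▸ trivial
      rwa [TwoSidedIdeal.mem_comap, map_one, TwoSidedIdeal.one_mem_iff] at h1
  · rintro rfl
    have hprime := TwoSidedIdeal.isPrimeIdeal_of_isCoatom (expIdeal_isCoatom (hp := hp) hq h)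
    refine ⟨⟨fun e => hprime.1 ?_, fun w w' hw => ?_⟩, fun e => ?_⟩
    · rw [← TwoSidedIdeal.one_mem_iff, expIdeal, e]
      trivial
    · obtain ⟨w, rfl⟩ := proj_surjective a w
      obtain ⟨w', rfl⟩ := proj_surjective a w'
      exact hprime.2 w w' fun s => by
        rw [expIdeal, TwoSidedIdeal.mem_comap, map_mul, map_mul]
        exact hw _
    · refine (zIdeal_lt_expIdeal (hp := hp) hq h).ne ?_
      rw [expIdeal, e, hbot]

end TorusExample

theorem mainTheorem5 {K : Type*} [Field K] [IsAlgClosed K] (p : ℕ) (hp : Odd p) (q r : Kˣ)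
    (hq : ∀ n : ℕ, 0 < n → q ^ n ≠ 1) (hr : r ^ 4 = q) :
    -- the zero ideal is prime
    (⊥ : TwoSidedIdeal (TorusExample.R p hp q)).IsPrimeIdeal ∧
    -- `(z - c)R` is a two-sided ideal, different scalars `c` give different ideals
    (∀ c : K, (TorusExample.zIdeal p hp q c : Set (TorusExample.R p hp q)) =
      {s | ∃ t, s = (TorusExample.z p hp q - algebraMap K (TorusExample.R p hp q) c) * t}) ∧
    Function.Injective (TorusExample.zIdeal p hp q) ∧
    -- the height one primes are the ideals `(z - c)R`
    (∀ P : TwoSidedIdeal (TorusExample.R p hp q),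
      P.IsPrimeOfHeight 1 ↔ ∃ c : K, P = TorusExample.zIdeal p hp q c) ∧
    -- `(z - c)R` is maximal unless `c` is one of the exceptional values
    (∀ c : K, IsCoatom (TorusExample.zIdeal p hp q c) ↔
      ¬ ∃ (m : ℕ) (ε : ℤˣ), 1 ≤ m ∧ c = TorusExample.lam p q r m ε) ∧
    -- for an exceptional value `c`, the ring `R/(z - c)R` has a unique non-zero prime ideal,
    -- namely `J((z_p - ε q^{(p+2m-3)/4})A)`
    (∀ (m : ℕ) (ε : ℤˣ), 1 ≤ m →
      (∃ Q : TwoSidedIdeal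
          (TorusExample.zIdeal p hp q (TorusExample.lam p q r m ε)).ringCon.Quotient,
        ∀ w, w ∈ Q ↔ w ∈ TorusExample.J p hp q r m ε) ∧
      (∀ Q : TwoSidedIdeal
          (TorusExample.zIdeal p hp q (TorusExample.lam p q r m ε)).ringCon.Quotient,
        (Q.IsPrimeIdeal ∧ Q ≠ ⊥) ↔ ∀ w, w ∈ Q ↔ w ∈ TorusExample.J p hp q r m ε)) ∧
    -- each `F_{m,ε}` is a two-sided ideal, and the height two primes are the ideals `F_{m,ε}`
    (∀ (m : ℕ) (ε : ℤˣ), 1 ≤ m → ∃ P : TwoSidedIdeal (TorusExample.R p hp q),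
      (P : Set (TorusExample.R p hp q)) = TorusExample.F p hp q r m ε) ∧
    (∀ P : TwoSidedIdeal (TorusExample.R p hp q), P.IsPrimeOfHeight 2 ↔
      ∃ (m : ℕ) (ε : ℤˣ), 1 ≤ m ∧
        (P : Set (TorusExample.R p hp q)) = TorusExample.F p hp q r m ε) ∧
    -- they are pairwise distinct, except that the two signs agree in characteristic two
    (∀ (m m' : ℕ) (ε ε' : ℤˣ), 1 ≤ m → 1 ≤ m' →
      (TorusExample.F p hp q r m ε = TorusExample.F p hp q r m' ε' ↔
        m = m' ∧ ((ε : ℤ) : K) = ((ε' : ℤ) : K))) ∧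
    -- the whole prime spectrum
    (∀ P : TwoSidedIdeal (TorusExample.R p hp q), P.IsPrimeIdeal ↔
      P = ⊥ ∨ (∃ c : K, P = TorusExample.zIdeal p hp q c) ∨
      ∃ (m : ℕ) (ε : ℤˣ), 1 ≤ m ∧
        (P : Set (TorusExample.R p hp q)) = TorusExample.F p hp q r m ε) := by
  have : Infinite K := IsAlgClosed.instInfinite
  refine ⟨TorusExample.bot_isPrime hq,
    fun c => Set.ext fun w => TorusExample.mem_zIdeal_iff_exists c w,
    TorusExample.zIdeal_injective hq, TorusExample.isPrimeOfHeight_one_iff hq hr,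
    TorusExample.isCoatom_zIdeal_iff hq hr, fun m ε hm => ?_,
    fun m ε hm => ⟨_, TorusExample.coe_expIdeal hr hm ε⟩,
    TorusExample.isPrimeOfHeight_two_iff hq hr,
    fun m m' ε ε' hm hm' => TorusExample.F_eq_F_iff hq hr hm hm',
    TorusExample.isPrimeIdeal_iff hq hr⟩
  have h := TorusExample.isExceptional_lam hp hr hm ε
  refine ⟨⟨TorusExample.quotIdeal p hp q h, fun w => TorusExample.mem_quotIdeal h⟩, fun Q => ?_⟩
  rw [TorusExample.isPrimeIdeal_quot_iff hq h, TwoSidedIdeal.ext_iff]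
  exact forall_congr' fun w => iff_congr Iff.rfl (TorusExample.mem_quotIdeal h)
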